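/- Let $D\subseteq\mathbb R^n$ be an open set with $cD\subseteq D$ for all $c>0$ (in particular $D=\mathbb R^n$). *Semigroup densities* on $D$ are functions $p_t(x,y)$ ($t>0$, $x,y\in D$) that are positive, twice differentiable in $(t,x,y)$ and satisfy $p_{s+t}(x,y)=\int_D p_s(x,z)\,p_t(z,y)\,dz$. A *Markov process on $D$* is a process $(X_t)_{t\ge 0}$ with laws $(\mathbb P_x)_{x\in D}$ such that, under $\mathbb P_x$, $X_0=x$ almost surely and $(X_t)$ is a homogeneous Markov process with transition probabilities $p_t(x,y)\,dy$, where $p$ are semigroup densities on $D$ with $\int_D p_t(x,y)\,dy=1$. Let $\mathcal F_t=\sigma(X_u,u\le t)$. - For $\alpha>0$, the process has the *time-inversion property of degree $\alpha$* if for every $x\in D$ the process $(t^\alpha X_{1/t},\,t>0)$ is, under $\mathbb P_x$, a homogeneous Markov process. - It is *semi-stable of index $\gamma$* (in Lamperti's sense) if for all $c>0$ and $x\in D$ the process $(X_{ct},t\ge0)$ under $\mathbb P_x$ has the same law as $(c^\gamma X_t,t\ge0)$ under $\mathbb P_{x/c^\gamma}$; its densities then satisfy $p_t(x,y)=t^{-n\gamma}p_1(x/t^\gamma,y/t^\gamma)$.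 - $\mathbb P$ is the *$h$-transform* of $\mathbb Q$ with constant $\nu$, for a positive measurable function $h$ on $D$, if $\mathbb P_x|_{\mathcal F_t}=\frac{h(X_t)}{h(x)}e^{-\nu t}\,\mathbb Q_x|_{\mathcal F_t}$ for all $x\in D$ and $t\ge 0$; for semigroup densities this reads $p_t(x,y)=\frac{h(y)}{h(x)}e^{-\nu t}\,r_t(x,y)$. Then: 1. Every Markov process on $\mathbb R^n$ with the time-inversion property of degree $\alpha>0$ is semi-stable of index $\alpha/2$, or is the $h$-transform, with some $h>0$ and some $\nu\ge 0$, of a Markov process on $\mathbb R^n$ that is semi-stable of index $\alpha/2$. 2. If a Markov process on $D$ has the time-inversion property of degree $\alpha>0$, then its semigroup densities are the $h$-transform, with some $h>0$ and $\nu\in\mathbb R$, of semigroup densities $r$ on $D$ (whose total mass is not asserted to be one) with $r_t(x,y)=t^{-n\alpha/2}\,r_1(x/t^{\alpha/2},y/t^{\alpha/2})$. 3. The converse fails: for some $n$ and some $\alpha>0$ there is a Markov process on $\mathbb R^n$ that is semi-stable of index $\alpha/2$ and does not have the time-inversion property of degree $\alpha$; and for every $\alpha>0$ there is such a process on some $D\subseteq\mathbb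 R^n$ as above, for some $n$. -/

import Mathlib

open MeasureTheory ProbabilityTheory Set
open scoped ENNReal NNReal

noncomputable section

namespace TimeInversion

/-- The Euclidean space `ℝⁿ`. -/
abbrev E (n : ℕ) : Type := EuclideanSpace ℝ (Fin n)

/-- Paths `[0, ∞) → ℝⁿ`, with the product σ-algebra; the coordinate process is `X t ω = ω t`. -/
abbrev Path (n : ℕ) : Type := ℝ≥0 → E n

/-- The σ-algebra generated by the coordinates up to (and including) the time `s`, for functions
from a time set `T` to `ℝⁿ`. -/
abbrev past {n : ℕ} {T : Type} [Preorder T] (s : T) : MeasurableSpace (T → E n) :=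
  Filtration.piLE (X := fun _ : T => E n) s

/-- Open subsets of `ℝⁿ` that are stable under all dilations (for instance `ℝⁿ`, `(0, ∞)`,
a Weyl chamber). -/
structure IsOpenCone {n : ℕ} (D : Set (E n)) : Prop where
  isOpen : IsOpen D
  smul_mem : ∀ c : ℝ, 0 < c → ∀ x ∈ D, c • x ∈ D

/-- `f` is twice (Fréchet) differentiable on the open set `U`. -/
def TwiceDifferentiableOn {F : Type} [NormedAddCommGroup F] [NormedSpace ℝ F]
    (f : F → ℝ) (U : Set F) : Prop :=
  DifferentiableOn ℝ f U ∧ DifferentiableOn ℝ (fderiv ℝ f) U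

/-- Semigroup densities `p t x y` (`t > 0`, `x, y ∈ D`) with respect to Lebesgue measure on `D`:
positive, twice differentiable jointly in time and space, and satisfying the Chapman–Kolmogorov
equation. The total mass is not prescribed here. -/
structure IsSemigroupDensity {n : ℕ} (D : Set (E n)) (p : ℝ → E n → E n → ℝ) : Prop where
  pos : ∀ t : ℝ, 0 < t → ∀ x ∈ D, ∀ y ∈ D, 0 < p t x y
  twiceDiff : TwiceDifferentiableOn (fun v : ℝ × E n × E n => p v.1 v.2.1 v.2.2)
    (Ioi (0 : ℝ) ×ˢ D ×ˢ D)
  chapmanKolmogorov : ∀ s t : ℝ, 0 < s → 0 < t → ∀ x ∈ D, ∀ y ∈ D,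
    ∫⁻ z in D, ENNReal.ofReal (p s x z * p t z y) = ENNReal.ofReal (p (s + t) x y)

/-- The laws `P x` (`x ∈ D`) on path space make the coordinate process a conservative homogeneous
Markov process with state space `D` and semigroup densities `p`: under `P x` it starts at `x`, and
the conditional probability of `X (s + t) ∈ B` given the past up to `s` is
`∫ y in B ∩ D, p t (X s) y`. -/
structure IsMarkovProcess {n : ℕ} (D : Set (E n)) (p : ℝ → E n → E n → ℝ)
    (P : E n → Measure (Path n)) : Prop where
  density : IsSemigroupDensity D p
  mass : ∀ t : ℝ, 0 < t → ∀ x ∈ D, ∫⁻ y in D, ENNReal.ofReal (p t x y) = 1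
  prob : ∀ x ∈ D, IsProbabilityMeasure (P x)
  start : ∀ x ∈ D, ∀ᵐ ω ∂(P x), ω 0 = x
  markov : ∀ x ∈ D, ∀ s t : ℝ≥0, 0 < t →
    ∀ A : Set (Path n), MeasurableSet[past s] A → ∀ B : Set (E n), MeasurableSet B →
      P x (A ∩ {ω | ω (s + t) ∈ B}) =
        ∫⁻ ω in A, (∫⁻ y in B ∩ D, ENNReal.ofReal (p t (ω s) y)) ∂(P x)

/-- The time-inverted path `t ↦ t ^ α • ω (1 / t)`, `t > 0`. -/
def timeInvert {n : ℕ} (α : ℝ) (ω : Path n) : Ioi (0 : ℝ) → E n :=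
  fun t => (t.1 ^ α) • ω (Real.toNNReal (1 / t.1))

/-- Under the law `μ`, the coordinate process `(Y t, t > 0)` is a homogeneous Markov process: the
conditional law of `Y t` given the past up to `s < t` is `κ (t - s) (Y s)`, for probability
kernels `κ u` that depend on the time lag only. -/
def IsHomogeneousMarkov {n : ℕ} (μ : Measure (Ioi (0 : ℝ) → E n)) : Prop :=
  ∃ κ : ℝ → Kernel (E n) (E n), (∀ u : ℝ, 0 < u → IsMarkovKernel (κ u)) ∧
    ∀ s t : Ioi (0 : ℝ), s < t →
      ∀ A : Set (Ioi (0 : ℝ) → E n), MeasurableSet[past s] A →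
      ∀ B : Set (E n), MeasurableSet B →
        μ (A ∩ {η | η t ∈ B}) = ∫⁻ η in A, κ (t.1 - s.1) (η s) B ∂μ

/-- The time-inversion property of degree `α`: under each `P x` the process
`(t ^ α • X (1 / t), t > 0)` is a homogeneous Markov process (its transition kernels may
depend on `x`). -/
def HasTimeInversion {n : ℕ} (D : Set (E n)) (α : ℝ) (P : E n → Measure (Path n)) : Prop :=
  ∀ x ∈ D, IsHomogeneousMarkov ((P x).map (timeInvert α))

/-- Semi-stability of index `γ` in Lamperti's sense: `(X (c t), t ≥ 0)` under `P x` has the same law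
as `(c ^ γ X t, t ≥ 0)` under `P (x / c ^ γ)`. -/
def IsSemistable {n : ℕ} (D : Set (E n)) (γ : ℝ) (P : E n → Measure (Path n)) : Prop :=
  ∀ c : ℝ≥0, 0 < c → ∀ x ∈ D,
    (P x).map (fun (ω : Path n) (t : ℝ≥0) => ω (c * t)) =
      (P (((c : ℝ) ^ γ)⁻¹ • x)).map (fun (ω : Path n) (t : ℝ≥0) => ((c : ℝ) ^ γ) • ω t)

/-- `P` is Doob's `h`-transform of `Q` with the constant `ν`: on the past up to any time `t`,
`P x` has density `h (X t) / h x * exp (-ν t)` with respect to `Q x`. -/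
structure IsHTransform {n : ℕ} (D : Set (E n)) (h : E n → ℝ) (ν : ℝ)
    (Q P : E n → Measure (Path n)) : Prop where
  measurable : Measurable h
  pos : ∀ x ∈ D, 0 < h x
  density : ∀ x ∈ D, ∀ t : ℝ≥0, ∀ A : Set (Path n), MeasurableSet[past t] A →
    P x A = ∫⁻ ω in A, ENNReal.ofReal (h (ω t) / h x * Real.exp (-ν * t)) ∂(Q x)

/-- The densities `p` arise from the densities `r` by the `h`-transform with the constant `ν`. -/
structure IsDensityHTransform {n : ℕ} (D : Set (E n)) (h : E n → ℝ) (ν : ℝ)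
    (r p : ℝ → E n → E n → ℝ) : Prop where
  measurable : Measurable h
  pos : ∀ x ∈ D, 0 < h x
  eq : ∀ t : ℝ, 0 < t → ∀ x ∈ D, ∀ y ∈ D,
    p t x y = h y / h x * Real.exp (-ν * t) * r t x y

/-- The scaling of semi-stable densities of index `γ`. -/
def IsSemistableDensity {n : ℕ} (D : Set (E n)) (γ : ℝ) (r : ℝ → E n → E n → ℝ) : Prop :=
  ∀ t : ℝ, 0 < t → ∀ x ∈ D, ∀ y ∈ D,
    r t x y = t ^ (-(n * γ)) * r 1 ((t ^ γ)⁻¹ • x) ((t ^ γ)⁻¹ • y)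

end TimeInversion

end

open TimeInversion

/-! Put l = log p. Under the law from x, the inverted process moves from a at time s to b at time t
with density t^{-nα} p_{1/t}(x, t^{-α}b) p_{1/s-1/t}(t^{-α}b, s^{-α}a) / p_{1/s}(x, s^{-α}a). Time
inversion makes this depend on t - s only, at every point and not just almost everywhere because p
is continuous (`invDensity_eq_of_hasTimeInversion`). Differentiating the logarithm in t at a fixed
lag gives, with V = `endGen` and S = `scaleGen`, the identity V_{τ+σ}(x,z) = V_τ(x,y) + V_σ(y,z) + τ
S_σ(y,z) (`endGen_add`). Comparing two splittings of one time interval shows that S is an additive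
cocycle, so S_t(x,y) = d(y) - d(x) - 2νt. If H solves the radial equation α x·∇H = d + const, then r
= exp(l + νt - H(y) + H(x)) has the scaling of index α/2, and p is its transform with h = exp H.

The solution H is read off from l itself. Since V_t(x,y) - V_t(x',y) depends on neither t nor y, a
suitable radial derivative of l equals -d(x) up to a term C(x)/t and terms that are explicit in t;
the weights 1 and -2 at the times t and 2t eliminate C and turn -d into d. On the whole space the
endpoint is 0, which dilations fix, and the times are 1 and 2. On a cone without the origin the
times are ‖x‖^{1/α} and its double.

On the whole space r has mass one: the same formulas give r_t(x,0) = r_t(0,0) exp(C(x)/t),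
Chapman–Kolmogorov at small times forces C ≤ 0, and at large times it then yields the mass
(`mass_eq_one_of_exp_form`). Kolmogorov extension provides a process Q with densities r; uniqueness
of Markov laws gives its semi-stability, and a change of measure gives the h-transform. A negative ν
would let p charge the unit ball with more than mass one.

For the converse, the Cauchy process has index 1, and an odd power map on the line without 0 changes
this index to any α/2. Two inverted transition densities with the same lag are explicitly different.
-/

namespace TimeInversion

/-! ### Calculus of twice differentiable functions -/

section TwiceDifferentiable

variable {F G K : Type} [NormedAddCommGroup F] [NormedSpace ℝ F] [NormedAddCommGroup G]
  [NormedSpace ℝ G] [NormedAddCommGroup K] [NormedSpace ℝ K]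

/-- `f` is twice Fréchet differentiable on `U`, for vector-valued `f`. -/
def TwiceDiffOn (f : F → G) (U : Set F) : Prop :=
  DifferentiableOn ℝ f U ∧ DifferentiableOn ℝ (fderiv ℝ f) U

/-- The second derivative need not be continuous, so this class is larger than C² and needs its own
chain rule. The other closure rules come from this one and `TwiceDiffOn.prodMk`. -/
theorem TwiceDiffOn.comp {g : G → K} {f : F → G} {U : Set F} {V : Set G}
    (hg : TwiceDiffOn g V) (hf : TwiceDiffOn f U) (hU : IsOpen U) (hV : IsOpen V)
    (h : MapsTo f U V) : TwiceDiffOn (g ∘ f) U := by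
  refine ⟨hg.1.comp hf.1 h, ?_⟩
  have key : DifferentiableOn ℝ (fun x => (fderiv ℝ g (f x)).comp (fderiv ℝ f x)) U :=
    (hg.2.comp hf.1 h).clm_comp hf.2
  refine key.congr fun x hx => ?_
  exact fderiv_comp x (hg.1.differentiableAt (hV.mem_nhds (h hx)))
    (hf.1.differentiableAt (hU.mem_nhds hx))

theorem TwiceDiffOn.of_contDiffOn {f : F → G} {U : Set F} (hf : ContDiffOn ℝ 2 f U)
    (hU : IsOpen U) : TwiceDiffOn f U := by
  refine ⟨hf.differentiableOn (by norm_num), ?_⟩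
  exact (hf.fderiv_of_isOpen hU (m := 1) (by norm_num)).differentiableOn (by norm_num)

theorem TwiceDiffOn.of_contDiff {f : F → G} {U : Set F} (hf : ContDiff ℝ 2 f)
    (hU : IsOpen U) : TwiceDiffOn f U := .of_contDiffOn hf.contDiffOn hU

theorem TwiceDiffOn.prodMk {f : F → G} {g : F → K} {U : Set F} (hf : TwiceDiffOn f U)
    (hg : TwiceDiffOn g U) (hU : IsOpen U) : TwiceDiffOn (fun x => (f x, g x)) U := by
  refine ⟨hf.1.prodMk hg.1, ?_⟩
  have key : DifferentiableOn ℝ (fun x => (ContinuousLinearMap.inl ℝ G K).comp (fderiv ℝ f x) +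
      (ContinuousLinearMap.inr ℝ G K).comp (fderiv ℝ g x)) U :=
    ((differentiableOn_const _).clm_comp hf.2).add ((differentiableOn_const _).clm_comp hg.2)
  refine key.congr fun x hx => ?_
  rw [(hf.1.differentiableAt (hU.mem_nhds hx)).fderiv_prodMk
    (hg.1.differentiableAt (hU.mem_nhds hx))]
  ext v <;> simp

theorem TwiceDiffOn.add {f g : F → G} {U : Set F} (hf : TwiceDiffOn f U)
    (hg : TwiceDiffOn g U) (hU : IsOpen U) : TwiceDiffOn (fun x => f x + g x) U :=
  TwiceDiffOn.comp (g := fun q : G × G => q.1 + q.2) (V := univ)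
    (.of_contDiff (by fun_prop) isOpen_univ) (hf.prodMk hg hU) hU isOpen_univ (mapsTo_univ _ _)

theorem TwiceDiffOn.sub {f g : F → G} {U : Set F} (hf : TwiceDiffOn f U)
    (hg : TwiceDiffOn g U) (hU : IsOpen U) : TwiceDiffOn (fun x => f x - g x) U :=
  TwiceDiffOn.comp (g := fun q : G × G => q.1 - q.2) (V := univ)
    (.of_contDiff (by fun_prop) isOpen_univ) (hf.prodMk hg hU) hU isOpen_univ (mapsTo_univ _ _)

theorem TwiceDiffOn.const_mul {f : F → ℝ} {U : Set F} (hf : TwiceDiffOn f U) (c : ℝ)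
    (hU : IsOpen U) : TwiceDiffOn (fun x => c * f x) U :=
  TwiceDiffOn.comp (g := fun q : ℝ => c * q) (V := univ)
    (.of_contDiff (by fun_prop) isOpen_univ) hf hU isOpen_univ (mapsTo_univ _ _)

theorem TwiceDiffOn.exp {f : F → ℝ} {U : Set F} (hf : TwiceDiffOn f U)
    (hU : IsOpen U) : TwiceDiffOn (fun x => Real.exp (f x)) U :=
  TwiceDiffOn.comp (g := Real.exp) (V := univ)
    (.of_contDiff (by fun_prop) isOpen_univ) hf hU isOpen_univ (mapsTo_univ _ _)

theorem TwiceDiffOn.log {f : F → ℝ} {U : Set F} (hf : TwiceDiffOn f U)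
    (hU : IsOpen U) (hpos : ∀ x ∈ U, 0 < f x) : TwiceDiffOn (fun x => Real.log (f x)) U :=
  TwiceDiffOn.comp (g := Real.log) (V := Ioi 0)
    (.of_contDiffOn (fun _ hx => (Real.contDiffAt_log.2 (ne_of_gt hx)).contDiffWithinAt)
      isOpen_Ioi) hf hU isOpen_Ioi hpos

end TwiceDifferentiable

/-- A continuous additive function on `(0, ∞)` is linear. -/
theorem exists_linear_of_additive {f : ℝ → ℝ} (hf : ContinuousOn f (Ioi 0))
    (hadd : ∀ s t : ℝ, 0 < s → 0 < t → f (s + t) = f s + f t) :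
    ∃ c : ℝ, ∀ t : ℝ, 0 < t → f t = c * t := by
  -- Positive and negative parts, shifted by 1 to stay in the domain, extend f to a continuous
  -- additive function on the line.
  let g : ℝ → ℝ := fun x => f (max x 0 + 1) - f (max (-x) 0 + 1)
  have hg : Continuous g := by
    refine (hf.comp_continuous (by fun_prop) fun x => ?_).sub
      (hf.comp_continuous (by fun_prop) fun x => ?_) <;>
    exact mem_Ioi.2 (by positivity)
  have hgadd : ∀ x y, g (x + y) = g x + g y := by
    intro x y
    have e1 := hadd (max x 0 + 1 + (max y 0 + 1)) (max (-(x + y)) 0 + 1) (by positivity)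
      (by positivity)
    have e2 := hadd (max (-x) 0 + 1 + (max (-y) 0 + 1)) (max (x + y) 0 + 1) (by positivity)
      (by positivity)
    have e3 := hadd (max x 0 + 1) (max y 0 + 1) (by positivity) (by positivity)
    have e4 := hadd (max (-x) 0 + 1) (max (-y) 0 + 1) (by positivity) (by positivity)
    have hm : ∀ x : ℝ, max x 0 = x + max (-x) 0 := by
      intro x
      rcases le_total x 0 with h | h
      · rw [max_eq_right h, max_eq_left (by linarith)]; ring
      · rw [max_eq_left h, max_eq_right (by linarith)]; ring
    have e5 : max x 0 + 1 + (max y 0 + 1) + (max (-(x + y)) 0 + 1) =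
        max (-x) 0 + 1 + (max (-y) 0 + 1) + (max (x + y) 0 + 1) := by
      rw [hm x, hm y, hm (x + y)]; ring
    rw [e5] at e1
    simp only [g]
    linarith
  let L : ℝ →+ ℝ := ⟨⟨g, by simp [g]⟩, hgadd⟩
  refine ⟨g 1, fun t ht => ?_⟩
  have h1 : g t = t * g 1 := by
    have := (L.toRealLinearMap hg).map_smul t 1
    simpa [L] using this
  have h2 : g t = f (t + 1) - f 1 := by
    simp [g, ht.le]
  rw [hadd t 1 ht one_pos] at h2
  linarith

/-! ### The differential identity and the scaling cocycle -/

section Bridge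

variable {n : ℕ} {D : Set (E n)} {α : ℝ} {l : ℝ × E n × E n → ℝ}

/-- The domain `(0, ∞) × D × D` of semigroup densities. -/
abbrev spaceTime (D : Set (E n)) : Set (ℝ × E n × E n) := Ioi (0 : ℝ) ×ˢ D ×ˢ D

theorem IsOpenCone.isOpen_spaceTime (hD : IsOpenCone D) : IsOpen (spaceTime D) :=
  isOpen_Ioi.prod (hD.isOpen.prod hD.isOpen)

theorem mem_spaceTime {t : ℝ} {x y : E n} (ht : 0 < t) (hx : x ∈ D) (hy : y ∈ D) :
    (t, x, y) ∈ spaceTime D := ⟨ht, hx, hy⟩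

/-- The logarithm of the transition density from `a` to `b`, between the times `t - u` and `t`, of
the process `t ^ α • X (1 / t)` under the law `P x`, where `l` is the logarithm of the transition
density of `X`. -/
noncomputable def logInvDensity (α : ℝ) (l : ℝ × E n × E n → ℝ) (x a b : E n) (u t : ℝ) : ℝ :=
  -(n * α) * Real.log t + l (t⁻¹, x, t ^ (-α) • b) +
    l ((t - u)⁻¹ - t⁻¹, t ^ (-α) • b, (t - u) ^ (-α) • a) - l ((t - u)⁻¹, x, (t - u) ^ (-α) • a)

/-- The time-inverted transition densities depend on the time lag only. -/
def IsInvHomogeneous (D : Set (E n)) (α : ℝ) (l : ℝ × E n × E n → ℝ) : Prop :=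
  ∀ x ∈ D, ∀ a ∈ D, ∀ b ∈ D, ∀ u t t' : ℝ, 0 < u → u < t → u < t' →
    logInvDensity α l x a b u t = logInvDensity α l x a b u t'

/-- The derivative of `l` along the dilations that fix the starting point. -/
noncomputable def endGen (α : ℝ) (l : ℝ × E n × E n → ℝ) (t : ℝ) (x y : E n) : ℝ :=
  t * fderiv ℝ l (t, x, y) (t, 0, α • y)

/-- The derivative of `l` along the dilations of index `α / 2`, up to normalization. -/
noncomputable def scaleGen (α : ℝ) (l : ℝ × E n × E n → ℝ) (t : ℝ) (x y : E n) : ℝ :=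
  fderiv ℝ l (t, x, y) (2 * t, α • x, α • y) + n * α

theorem hasDerivAt_inv_curve {t : ℝ} (ht : 0 < t) (α : ℝ) (b : E n) :
    HasDerivAt (fun t : ℝ => t ^ (-α) • b) (-(t⁻¹ * α) • (t ^ (-α) • b)) t := by
  refine ((Real.hasDerivAt_rpow_const (p := -α) (Or.inl ht.ne')).smul_const b).congr_deriv ?_
  rw [smul_smul]
  congr 1
  rw [Real.rpow_sub_one ht.ne']
  field_simp

/-- This is the vanishing of the t-derivative of `logInvDensity` at a fixed lag, in the variables τ
= 1/t, τ + σ = 1/s, y = t^{-α}b, z = s^{-α}a. Since a and b are arbitrary in D, so are y and z. -/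
theorem endGen_add (hD : IsOpenCone D) (hl : DifferentiableOn ℝ l (spaceTime D))
    (hinv : IsInvHomogeneous D α l) {τ σ : ℝ} (hτ : 0 < τ) (hσ : 0 < σ) {x y z : E n}
    (hx : x ∈ D) (hy : y ∈ D) (hz : z ∈ D) :
    endGen α l (τ + σ) x z =
      endGen α l τ x y + endGen α l σ y z + τ * scaleGen α l σ y z := by
  obtain ⟨t, ht, rfl⟩ : ∃ t : ℝ, 0 < t ∧ t⁻¹ = τ := ⟨τ⁻¹, by positivity, inv_inv _⟩
  obtain ⟨s, hs, hsσ⟩ : ∃ s : ℝ, 0 < s ∧ s⁻¹ = t⁻¹ + σ := ⟨(t⁻¹ + σ)⁻¹, by positivity, inv_inv _⟩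
  obtain rfl : σ = s⁻¹ - t⁻¹ := by linarith
  have hst : s < t := by
    by_contra h
    have := inv_anti₀ ht (not_lt.1 h)
    linarith
  set u := t - s with hu
  have hu0 : 0 < u := by linarith
  have hts : t - u = s := by linarith
  set b := t ^ α • y with hb
  set a := s ^ α • z with ha
  have hbD : b ∈ D := hD.smul_mem _ (by positivity) _ hy
  have haD : a ∈ D := hD.smul_mem _ (by positivity) _ hz
  have hby : t ^ (-α) • b = y := by
    rw [hb, smul_smul, ← Real.rpow_add ht]; simp
  have haz : s ^ (-α) • a = z := by
    rw [ha, smul_smul, ← Real.rpow_add hs]; simp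
  have hopen := hD.isOpen_spaceTime
  have hfd : ∀ q ∈ spaceTime D, HasFDerivAt l (fderiv ℝ l q) q := fun q hq =>
    (hl.differentiableAt (hopen.mem_nhds hq)).hasFDerivAt
  -- the three curves
  have c1 : HasDerivAt (fun t : ℝ => t⁻¹) (-(t⁻¹ * t⁻¹)) t := by
    refine (hasDerivAt_inv ht.ne').congr_deriv ?_
    field_simp
  have c2 := hasDerivAt_inv_curve ht α b
  have hsub : HasDerivAt (fun t : ℝ => t - u) 1 t := (hasDerivAt_id t).sub_const u
  have c3 : HasDerivAt (fun t : ℝ => (t - u)⁻¹) (-(s⁻¹ * s⁻¹)) t := by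
    refine (hsub.fun_inv (by rw [hts]; exact hs.ne')).congr_deriv ?_
    rw [hts]; field_simp
  have c4 : HasDerivAt (fun t : ℝ => (t - u) ^ (-α) • a) (-(s⁻¹ * α) • z) t := by
    have h0 : HasDerivAt (fun s : ℝ => s ^ (-α) • a) (-(s⁻¹ * α) • z) (t - u) := by
      rw [hts]
      have := hasDerivAt_inv_curve hs α a
      rwa [haz] at this
    exact (h0.scomp t hsub).congr_deriv (one_smul _ _)
  rw [hby] at c2
  have d1 : HasDerivAt (fun t : ℝ => l (t⁻¹, x, t ^ (-α) • b))
      (fderiv ℝ l (t⁻¹, x, y) (-(t⁻¹ * t⁻¹), 0, -(t⁻¹ * α) • y)) t := by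
    have h0 : HasFDerivAt l (fderiv ℝ l (t⁻¹, x, y)) (t⁻¹, x, t ^ (-α) • b) := by
      rw [hby]; exact hfd _ (mem_spaceTime hτ hx hy)
    exact h0.comp_hasDerivAt t (c1.prodMk ((hasDerivAt_const t x).prodMk c2))
  have d2 : HasDerivAt (fun t : ℝ => l ((t - u)⁻¹ - t⁻¹, t ^ (-α) • b, (t - u) ^ (-α) • a))
      (fderiv ℝ l (s⁻¹ - t⁻¹, y, z)
        (-(s⁻¹ * s⁻¹) - -(t⁻¹ * t⁻¹), -(t⁻¹ * α) • y, -(s⁻¹ * α) • z)) t := by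
    have h0 : HasFDerivAt l (fderiv ℝ l (s⁻¹ - t⁻¹, y, z))
        ((t - u)⁻¹ - t⁻¹, t ^ (-α) • b, (t - u) ^ (-α) • a) := by
      rw [hby, hts, haz]; exact hfd _ (mem_spaceTime hσ hy hz)
    exact h0.comp_hasDerivAt t ((c3.sub c1).prodMk (c2.prodMk c4))
  have d3 : HasDerivAt (fun t : ℝ => l ((t - u)⁻¹, x, (t - u) ^ (-α) • a))
      (fderiv ℝ l (s⁻¹, x, z) (-(s⁻¹ * s⁻¹), 0, -(s⁻¹ * α) • z)) t := by
    have h0 : HasFDerivAt l (fderiv ℝ l (s⁻¹, x, z)) ((t - u)⁻¹, x, (t - u) ^ (-α) • a) := by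
      rw [hts, haz]; exact hfd _ (mem_spaceTime (by positivity) hx hz)
    exact h0.comp_hasDerivAt t (c3.prodMk ((hasDerivAt_const t x).prodMk c4))
  have d0 : HasDerivAt (fun t : ℝ => -(n * α) * Real.log t) (-(n * α) * t⁻¹) t :=
    (Real.hasDerivAt_log ht.ne').const_mul _
  have hder : HasDerivAt (fun t => logInvDensity α l x a b u t) _ t := ((d0.add d1).add d2).sub d3
  have hconst : HasDerivAt (fun t => logInvDensity α l x a b u t) 0 t := by
    refine (hasDerivAt_const t (logInvDensity α l x a b u t)).congr_of_eventuallyEq ?_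
    filter_upwards [Ioi_mem_nhds (show u < t by linarith)] with t' ht'
    exact hinv x hx a haD b hbD u t' t hu0 ht' (by linarith)
  have hz0 := hder.unique hconst
  have v1 : ((-(t⁻¹ * t⁻¹), 0, -(t⁻¹ * α) • y) : ℝ × E n × E n) =
      (-t⁻¹) • ((t⁻¹, 0, α • y) : ℝ × E n × E n) := by
    ext <;> simp [smul_smul]
  have v3 : ((-(s⁻¹ * s⁻¹), 0, -(s⁻¹ * α) • z) : ℝ × E n × E n) =
      (-s⁻¹) • ((s⁻¹, 0, α • z) : ℝ × E n × E n) := by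
    ext <;> simp [smul_smul]
  -- From (τ+σ)² - τ² = 2τσ + σ²: the velocity of the middle factor is -τ times the dilation
  -- direction minus σ times the endpoint direction.
  have v2 : ((-(s⁻¹ * s⁻¹) - -(t⁻¹ * t⁻¹), -(t⁻¹ * α) • y, -(s⁻¹ * α) • z) : ℝ × E n × E n) =
      (-t⁻¹) • ((2 * (s⁻¹ - t⁻¹), α • y, α • z) : ℝ × E n × E n) +
        (-(s⁻¹ - t⁻¹)) • ((s⁻¹ - t⁻¹, 0, α • z) : ℝ × E n × E n) := by
    ext <;> simp [smul_smul] <;> ring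
  rw [v1, v2, v3] at hz0
  simp only [map_smul, map_add, smul_eq_mul] at hz0
  have e : t⁻¹ + (s⁻¹ - t⁻¹) = s⁻¹ := by ring
  simp only [endGen, scaleGen, e]
  linarith

/-- Expand V at time 1 + σ + ρ from y to w in two ways, by splitting at 1 + σ and by splitting at 1.
The weights of S in `endGen_add` are 1 + σ and 1, so everything cancels except the cocycle relation.
-/
theorem scaleGen_add (hD : IsOpenCone D) (hl : DifferentiableOn ℝ l (spaceTime D))
    (hinv : IsInvHomogeneous D α l) {σ ρ : ℝ} (hσ : 0 < σ) (hρ : 0 < ρ) {y z w : E n}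
    (hy : y ∈ D) (hz : z ∈ D) (hw : w ∈ D) :
    scaleGen α l (σ + ρ) y w = scaleGen α l σ y z + scaleGen α l ρ z w := by
  have e1 := endGen_add hD hl hinv (τ := 1 + σ) (by positivity) hρ hy hz hw
  have e2 := endGen_add hD hl hinv one_pos hσ hy hy hz
  have e3 := endGen_add hD hl hinv (τ := 1) (σ := σ + ρ) one_pos (by positivity) hy hy hw
  have e4 := endGen_add hD hl hinv hσ hρ hy hz hw
  rw [← add_assoc] at e3
  linarith

/-- In `endGen_add` the starting point enters only the left side and the first summand. Both
differences therefore equal the difference at time τ + τ' and endpoint y. -/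
theorem endGen_sub (hD : IsOpenCone D) (hl : DifferentiableOn ℝ l (spaceTime D))
    (hinv : IsInvHomogeneous D α l) {τ τ' : ℝ} (hτ : 0 < τ) (hτ' : 0 < τ') {x x' y y' : E n}
    (hx : x ∈ D) (hx' : x' ∈ D) (hy : y ∈ D) (hy' : y' ∈ D) :
    endGen α l τ x y - endGen α l τ x' y = endGen α l τ' x y' - endGen α l τ' x' y' := by
  have e1 := endGen_add hD hl hinv hτ hτ' hx hy hy
  have e2 := endGen_add hD hl hinv hτ hτ' hx' hy hy
  have e3 := endGen_add hD hl hinv hτ' hτ hx hy' hy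
  have e4 := endGen_add hD hl hinv hτ' hτ hx' hy' hy
  rw [add_comm τ' τ] at e3 e4
  linarith

theorem continuousOn_scaleGen (hl : TwiceDiffOn l (spaceTime D))
    {x y : E n} (hx : x ∈ D) (hy : y ∈ D) :
    ContinuousOn (fun t => scaleGen α l t x y) (Ioi 0) := by
  have : ContinuousOn (fun t : ℝ => fderiv ℝ l (t, x, y)) (Ioi 0) :=
    hl.2.continuousOn.comp (by fun_prop) fun t ht => mem_spaceTime ht hx hy
  exact (this.clm_apply (by fun_prop)).add continuousOn_const

theorem continuousOn_endGen (hl : TwiceDiffOn l (spaceTime D))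
    {x y : E n} (hx : x ∈ D) (hy : y ∈ D) :
    ContinuousOn (fun t => endGen α l t x y) (Ioi 0) := by
  have : ContinuousOn (fun t : ℝ => fderiv ℝ l (t, x, y)) (Ioi 0) :=
    hl.2.continuousOn.comp (by fun_prop) fun t ht => mem_spaceTime ht hx hy
  exact continuousOn_id.mul (this.clm_apply (by fun_prop))

/-- The scaling derivative splits into an additive cocycle in space and a linear function of
time. -/
theorem exists_scaleGen_eq (hD : IsOpenCone D) (hl : TwiceDiffOn l (spaceTime D))
    (hinv : IsInvHomogeneous D α l) {e : E n} (he : e ∈ D) :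
    ∃ (ν β : ℝ) (d : E n → ℝ),
      (∀ t : ℝ, 0 < t → ∀ x ∈ D, ∀ y ∈ D, scaleGen α l t x y = d y - d x - 2 * ν * t) ∧
      ∀ t : ℝ, 0 < t → endGen α l t e e = -ν * t ^ 2 + β * t := by
  obtain ⟨c, hc⟩ := exists_linear_of_additive (continuousOn_scaleGen (α := α) hl he he)
    fun s t hs ht => scaleGen_add hD hl.1 hinv hs ht he he he
  have hdiag : ∀ t : ℝ, 0 < t → ∀ x ∈ D, scaleGen α l t x x = c * t := by
    intro t ht x hx
    have e1 := scaleGen_add hD hl.1 hinv ht one_pos hx hx he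
    have e2 := scaleGen_add hD hl.1 hinv one_pos ht hx he he
    rw [add_comm 1 t] at e2
    rw [← hc t ht]
    linarith
  -- At the point e the defect of additivity of V is s·(ct), which is also the defect of c t²/2; the
  -- difference is additive.
  have hend : ∃ β, ∀ t : ℝ, 0 < t → endGen α l t e e - c / 2 * t ^ 2 = β * t := by
    refine exists_linear_of_additive
      ((continuousOn_endGen hl he he).sub (by fun_prop)) fun s t hs ht => ?_
    rw [endGen_add hD hl.1 hinv hs ht he he he, hdiag t ht e he]
    ring
  obtain ⟨β, hβ⟩ := hend
  refine ⟨-c / 2, β, fun x => scaleGen α l 1 e x, fun t ht x hx y hy => ?_, fun t ht => ?_⟩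
  · have e1 := scaleGen_add hD hl.1 hinv one_pos ht he hx hy
    have e2 := scaleGen_add hD hl.1 hinv one_pos ht he hy hy
    have e3 := hdiag t ht y hy
    linarith
  · have := hβ t ht
    linarith

/-- A function whose radial derivative trivializes the cocycle intertwines `l` with its
dilations. -/
theorem scaling_of_radial (hD : IsOpenCone D) (hl : DifferentiableOn ℝ l (spaceTime D))
    {ν : ℝ} {d H : E n → ℝ}
    (hS : ∀ t : ℝ, 0 < t → ∀ x ∈ D, ∀ y ∈ D, scaleGen α l t x y = d y - d x - 2 * ν * t)
    (hH : DifferentiableOn ℝ H D)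
    (hrad : ∃ k : ℝ, ∀ x ∈ D, α * fderiv ℝ H x x = d x + k)
    {t : ℝ} (ht : 0 < t) {x y : E n} (hx : x ∈ D) (hy : y ∈ D) {c : ℝ} (hc : 0 < c) :
    l (c * t, c ^ (α / 2) • x, c ^ (α / 2) • y) + n * α / 2 * Real.log c + ν * (c * t)
        - H (c ^ (α / 2) • y) + H (c ^ (α / 2) • x) =
      l (t, x, y) + ν * t - H y + H x := by
  obtain ⟨k, hk⟩ := hrad
  set Φ : ℝ → ℝ := fun c => l (c * t, c ^ (α / 2) • x, c ^ (α / 2) • y) +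
    n * α / 2 * Real.log c + ν * (c * t) - H (c ^ (α / 2) • y) + H (c ^ (α / 2) • x) with hΦ
  -- The derivative is 1/(2c) times S + 2νct minus the increment of d between the dilated points;
  -- the constant k cancels between the two values of H.
  have hder : ∀ c : ℝ, 0 < c → HasDerivAt Φ 0 c := by
    intro c hc
    have hcur : ∀ v : E n, HasDerivAt (fun c : ℝ => c ^ (α / 2) • v)
        ((c⁻¹ * (1 / 2)) • (α • (c ^ (α / 2) • v))) c := by
      intro v
      refine ((Real.hasDerivAt_rpow_const (p := α / 2)
        (Or.inl hc.ne')).smul_const v).congr_deriv ?_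
      rw [smul_smul, smul_smul]
      congr 1
      rw [Real.rpow_sub_one hc.ne']
      field_simp
    have hxc : c ^ (α / 2) • x ∈ D := hD.smul_mem _ (by positivity) _ hx
    have hyc : c ^ (α / 2) • y ∈ D := hD.smul_mem _ (by positivity) _ hy
    have hm := mem_spaceTime (D := D) (mul_pos hc ht) hxc hyc
    have h1 : HasDerivAt (fun c : ℝ => c * t) t c := by simpa using (hasDerivAt_id c).mul_const t
    have h2 := (hl.differentiableAt (hD.isOpen_spaceTime.mem_nhds hm)).hasFDerivAt.comp_hasDerivAt
      c (h1.prodMk ((hcur x).prodMk (hcur y)))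
    have h3 : HasDerivAt (fun c : ℝ => n * α / 2 * Real.log c) (n * α / 2 * c⁻¹) c :=
      (Real.hasDerivAt_log hc.ne').const_mul _
    have h4 : HasDerivAt (fun c : ℝ => ν * (c * t)) (ν * t) c := h1.const_mul _
    have h5 := (hH.differentiableAt (hD.isOpen.mem_nhds hyc)).hasFDerivAt.comp_hasDerivAt c (hcur y)
    have h6 := (hH.differentiableAt (hD.isOpen.mem_nhds hxc)).hasFDerivAt.comp_hasDerivAt c (hcur x)
    have h7 := (((h2.add h3).add h4).sub h5).add h6
    refine h7.congr_deriv ?_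
    have hv : ((t, (c⁻¹ * (1 / 2)) • (α • (c ^ (α / 2) • x)),
        (c⁻¹ * (1 / 2)) • (α • (c ^ (α / 2) • y))) : ℝ × E n × E n) =
        (c⁻¹ * (1 / 2)) • ((2 * (c * t), α • (c ^ (α / 2) • x), α • (c ^ (α / 2) • y)) :
          ℝ × E n × E n) := by
      ext
      · simp; field_simp
      · simp
      · simp
    have hs := hS (c * t) (mul_pos hc ht) _ hxc _ hyc
    rw [scaleGen] at hs
    have hkx := hk _ hxc
    have hky := hk _ hyc
    rw [hv]
    simp only [map_smul, smul_eq_mul] at hkx hky ⊢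
    rw [hkx, hky, eq_sub_of_add_eq hs]
    field_simp
    ring
  have hcst : Φ c = Φ 1 := by
    refine isOpen_Ioi.is_const_of_deriv_eq_zero (s := Ioi (0 : ℝ)) isPreconnected_Ioi
      (fun c hc => (hder c hc).differentiableAt.differentiableWithinAt)
      (fun c hc => (hder c hc).deriv) hc (mem_Ioi.2 one_pos)
  simpa [hΦ] using hcst

end Bridge

/-! ### Solving the radial equation -/

section Exponent

variable {n : ℕ} {D : Set (E n)} {α : ℝ} {l : ℝ × E n × E n → ℝ}

theorem fderiv_apply_self_eq {H : E n → ℝ} {x : E n} {v : ℝ} (hH : DifferentiableAt ℝ H x)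
    (h : HasDerivAt (fun c : ℝ => H (c • x)) v 1) : fderiv ℝ H x x = v := by
  have h1 : HasDerivAt (fun c : ℝ => c • x) x 1 := by
    simpa using (hasDerivAt_id (1 : ℝ)).smul_const x
  have h2 : HasFDerivAt H (fderiv ℝ H x) ((1 : ℝ) • x) := by
    rw [one_smul]; exact hH.hasFDerivAt
  exact (h2.comp_hasDerivAt (1 : ℝ) h1).unique h

theorem twiceDiffOn_comp_start (hl : TwiceDiffOn l (spaceTime D)) (hD : IsOpenCone D)
    {τ : E n → ℝ} (hτ : TwiceDiffOn τ D) (hpos : ∀ x ∈ D, 0 < τ x) {e : E n} (he : e ∈ D) :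
    TwiceDiffOn (fun x => l (τ x, x, e)) D :=
  TwiceDiffOn.comp (g := l) (f := fun x => (τ x, x, e)) hl
    (hτ.prodMk (.of_contDiff (by fun_prop) hD.isOpen) hD.isOpen) hD.isOpen hD.isOpen_spaceTime
    fun x hx => mem_spaceTime (hpos x hx) hx he

theorem isOpenCone_univ : IsOpenCone (univ : Set (E n)) := ⟨isOpen_univ, fun _ _ _ _ => mem_univ _⟩

/-- The exponent of the `h`-transform on the whole space. -/
noncomputable def originExponent (l : ℝ × E n × E n → ℝ) (x : E n) : ℝ :=
  l (1, x, 0) - 2 * l (2, x, 0)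

theorem twiceDiffOn_originExponent (hl : TwiceDiffOn l (spaceTime univ)) :
    TwiceDiffOn (originExponent l) univ := by
  have h : ∀ t : ℝ, 0 < t → TwiceDiffOn (fun x => l (t, x, 0)) univ := fun t ht =>
    twiceDiffOn_comp_start hl isOpenCone_univ (τ := fun _ => t)
      (.of_contDiff contDiff_const isOpen_univ) (fun _ _ => ht) (mem_univ _)
  exact (h 1 one_pos).sub ((h 2 two_pos).const_mul 2 isOpen_univ) isOpen_univ

/-- With endpoint 0, α times the radial derivative of l(t,·,0) is S - nα - (2/t)V, whose dependence
on x is -d(x) - (2/t)C(x) by `endGen_sub`. The weights 1 and -2 at times 1 and 2 turn -d into d and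
cancel C. -/
theorem radial_originExponent (hl : TwiceDiffOn l (spaceTime univ))
    (hinv : IsInvHomogeneous univ α l) {ν : ℝ} {d : E n → ℝ}
    (hS : ∀ t : ℝ, 0 < t → ∀ x ∈ (univ : Set (E n)), ∀ y ∈ (univ : Set (E n)),
      scaleGen α l t x y = d y - d x - 2 * ν * t) :
    ∃ k : ℝ, ∀ x ∈ (univ : Set (E n)), α * fderiv ℝ (originExponent l) x x = d x + k := by
  refine ⟨-d 0 + 6 * ν + n * α - 2 * (endGen α l 1 0 0 - endGen α l 2 0 0), fun x _ => ?_⟩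
  have hfd : ∀ t : ℝ, 0 < t → HasDerivAt (fun c : ℝ => l (t, c • x, 0))
      (fderiv ℝ l (t, x, 0) (0, x, 0)) 1 := by
    intro t ht
    have h1 : HasDerivAt (fun c : ℝ => c • x) x 1 := by
      simpa using (hasDerivAt_id (1 : ℝ)).smul_const x
    have h2 : HasFDerivAt l (fderiv ℝ l (t, x, 0)) (t, (1 : ℝ) • x, 0) := by
      rw [one_smul]
      exact (hl.1.differentiableAt (isOpenCone_univ.isOpen_spaceTime.mem_nhds
        (mem_spaceTime ht (mem_univ _) (mem_univ _)))).hasFDerivAt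
    exact h2.comp_hasDerivAt (1 : ℝ)
      ((hasDerivAt_const _ t).prodMk (h1.prodMk (hasDerivAt_const _ (0 : E n))))
  have hval : ∀ t : ℝ, 0 < t → α * fderiv ℝ l (t, x, 0) (0, x, 0) =
      scaleGen α l t x 0 - n * α - 2 / t * endGen α l t x 0 := by
    intro t ht
    have hv : ((2 * t, α • x, α • (0 : E n)) : ℝ × E n × E n) =
        α • ((0, x, 0) : ℝ × E n × E n) + (2 : ℝ) • ((t, 0, α • 0) : ℝ × E n × E n) := by
      ext <;> simp
    rw [scaleGen, endGen, hv, map_add, map_smul, map_smul]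
    simp only [smul_eq_mul]
    field_simp
    ring
  have hdiff := (twiceDiffOn_originExponent hl).1.differentiableAt (isOpen_univ.mem_nhds (mem_univ x))
  rw [fderiv_apply_self_eq hdiff ((hfd 1 one_pos).sub ((hfd 2 two_pos).const_mul 2)), mul_sub,
    mul_left_comm, hval 1 one_pos, hval 2 two_pos, hS 1 one_pos x (mem_univ _) 0 (mem_univ _),
    hS 2 two_pos x (mem_univ _) 0 (mem_univ _)]
  have := endGen_sub (x := x) (x' := 0) (y := 0) (y' := 0) isOpenCone_univ hl.1 hinv one_pos two_pos
    (mem_univ _) (mem_univ _) (mem_univ _) (mem_univ _)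
  linarith

/-- Since the endpoint 0 does not move, ∂_t l(t,x,0) = V/t². By `endGen_sub` the difference between
the starting points x and 0 has derivative c/t², so it equals K - c/t. The increment of
`originExponent` from 0 to x is exactly -K. -/
theorem originExponent_add (hl : TwiceDiffOn l (spaceTime univ))
    (hinv : IsInvHomogeneous univ α l) :
    ∃ C : E n → ℝ, ∀ t : ℝ, 0 < t → ∀ x : E n,
      l (t, x, 0) + originExponent l x - (l (t, 0, 0) + originExponent l 0) = C x / t := by
  refine ⟨fun x => -(endGen α l 1 x 0 - endGen α l 1 0 0), fun t ht x => ?_⟩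
  set c := endGen α l 1 x 0 - endGen α l 1 0 0 with hc
  have hfd : ∀ y : E n, ∀ t : ℝ, 0 < t → HasDerivAt (fun t : ℝ => l (t, y, 0))
      (endGen α l t y 0 / t ^ 2) t := by
    intro y t ht
    have h2 : HasFDerivAt l (fderiv ℝ l (t, y, 0)) (t, y, 0) :=
      (hl.1.differentiableAt (isOpenCone_univ.isOpen_spaceTime.mem_nhds
        (mem_spaceTime ht (mem_univ _) (mem_univ _)))).hasFDerivAt
    have h3 := h2.comp_hasDerivAt t
      ((hasDerivAt_id t).prodMk (hasDerivAt_const t ((y, 0) : E n × E n)))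
    refine h3.congr_deriv ?_
    have hv : ((t, 0, α • 0) : ℝ × E n × E n) = t • ((1, 0) : ℝ × E n × E n) := by
      ext <;> simp
    rw [endGen, hv, map_smul, smul_eq_mul]
    field_simp
  have hΦ : ∀ t : ℝ, 0 < t →
      HasDerivAt (fun t : ℝ => l (t, x, 0) - l (t, 0, 0) + c * t⁻¹) 0 t := by
    intro t ht
    refine (((hfd x t ht).sub (hfd 0 t ht)).add
      ((hasDerivAt_inv ht.ne').const_mul c)).congr_deriv ?_
    have := endGen_sub (x := x) (x' := 0) (y := 0) (y' := 0) isOpenCone_univ hl.1 hinv ht one_pos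
      (mem_univ _) (mem_univ _) (mem_univ _) (mem_univ _)
    rw [hc, ← this]
    ring
  have hcst : ∀ t : ℝ, 0 < t → l (t, x, 0) - l (t, 0, 0) + c * t⁻¹ =
      l (1, x, 0) - l (1, 0, 0) + c * 1⁻¹ := by
    intro t ht
    exact isOpen_Ioi.is_const_of_deriv_eq_zero (s := Ioi (0 : ℝ)) isPreconnected_Ioi
      (fun c hc => (hΦ c hc).differentiableAt.differentiableWithinAt)
      (fun c hc => (hΦ c hc).deriv) ht (mem_Ioi.2 one_pos)
  have h1 := hcst t ht
  have h2 := hcst 2 two_pos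
  simp only [originExponent]
  rw [neg_div, div_eq_mul_inv]
  linarith

/-- The exponent of the `h`-transform on a cone that does not contain the origin. -/
noncomputable def coneExponent (α ν : ℝ) (l : ℝ × E n × E n → ℝ) (e x : E n) : ℝ :=
  l (‖x‖ ^ α⁻¹, x, e) - 2 * l (2 * ‖x‖ ^ α⁻¹, x, e) - 3 * ν * ‖x‖ ^ α⁻¹

theorem twiceDiffOn_norm_rpow (hD : IsOpenCone D) (h0 : (0 : E n) ∉ D) (β : ℝ) :
    TwiceDiffOn (fun x : E n => ‖x‖ ^ β) D := by
  refine .of_contDiffOn (fun x hx => ContDiffAt.contDiffWithinAt ?_) hD.isOpen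
  have hx0 : x ≠ 0 := fun h => h0 (h ▸ hx)
  exact (contDiffAt_norm ℝ hx0).rpow_const_of_ne (norm_ne_zero_iff.2 hx0)

theorem twiceDiffOn_coneExponent (hD : IsOpenCone D) (h0 : (0 : E n) ∉ D)
    (hl : TwiceDiffOn l (spaceTime D)) {e : E n} (he : e ∈ D) (ν : ℝ) :
    TwiceDiffOn (coneExponent α ν l e) D := by
  have hτ := twiceDiffOn_norm_rpow hD h0 α⁻¹
  have hpos : ∀ x ∈ D, 0 < ‖x‖ ^ α⁻¹ := fun x hx =>
    Real.rpow_pos_of_pos (norm_pos_iff.2 fun h => h0 (h ▸ hx)) _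
  have h1 := twiceDiffOn_comp_start hl hD hτ hpos he
  have h2 := twiceDiffOn_comp_start hl hD (hτ.const_mul 2 hD.isOpen)
    (fun x hx => mul_pos two_pos (hpos x hx)) he
  exact (h1.sub (h2.const_mul 2 hD.isOpen) hD.isOpen).sub (hτ.const_mul _ hD.isOpen) hD.isOpen

/-- The time τ(x) = ‖x‖^{1/α} has radial derivative τ/α. Along this moving time the derivative of l
at θτ, multiplied by α, is S - nα - V/(θτ), with x-dependence -d - νθτ - C/(θτ). Combining θ = 1 and
θ = 2 with weights 1 and -2 cancels C and leaves 3ντ, which the last term of `coneExponent` removes.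
-/
theorem radial_coneExponent (hα : 0 < α) (hD : IsOpenCone D) (h0 : (0 : E n) ∉ D)
    (hl : TwiceDiffOn l (spaceTime D))
    (hinv : IsInvHomogeneous D α l) {e : E n} (he : e ∈ D) {ν β : ℝ} {d : E n → ℝ}
    (hS : ∀ t : ℝ, 0 < t → ∀ x ∈ D, ∀ y ∈ D, scaleGen α l t x y = d y - d x - 2 * ν * t)
    (hU : ∀ t : ℝ, 0 < t → endGen α l t e e = -ν * t ^ 2 + β * t) :
    ∃ k : ℝ, ∀ x ∈ D, α * fderiv ℝ (coneExponent α ν l e) x x = d x + k := by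
  refine ⟨-d e + n * α + β, fun x hx => ?_⟩
  have hx0 : 0 < ‖x‖ := norm_pos_iff.2 fun h => h0 (h ▸ hx)
  set τ := ‖x‖ ^ α⁻¹ with hτdef
  have hτ : 0 < τ := Real.rpow_pos_of_pos hx0 _
  have hτd : HasDerivAt (fun c : ℝ => ‖c • x‖ ^ α⁻¹) (α⁻¹ * τ) 1 := by
    have h1 : HasDerivAt (fun c : ℝ => c ^ α⁻¹ * τ) (α⁻¹ * τ) 1 := by
      refine ((Real.hasDerivAt_rpow_const (p := α⁻¹) (Or.inl one_ne_zero)).mul_const τ).congr_deriv ?_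
      simp
    refine h1.congr_of_eventuallyEq ?_
    filter_upwards [Ioi_mem_nhds (zero_lt_one (α := ℝ))] with c hc
    rw [norm_smul, Real.norm_of_nonneg (le_of_lt hc), Real.mul_rpow (le_of_lt hc) hx0.le]
  have hfd : ∀ θ : ℝ, 0 < θ → HasDerivAt (fun c : ℝ => l (θ * ‖c • x‖ ^ α⁻¹, c • x, e))
      (fderiv ℝ l (θ * τ, x, e) (θ * (α⁻¹ * τ), x, 0)) 1 := by
    intro θ hθ
    have h1 : HasDerivAt (fun c : ℝ => c • x) x 1 := by
      simpa using (hasDerivAt_id (1 : ℝ)).smul_const x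
    have h2 : HasFDerivAt l (fderiv ℝ l (θ * τ, x, e))
        (θ * ‖(1 : ℝ) • x‖ ^ α⁻¹, (1 : ℝ) • x, e) := by
      rw [one_smul]
      exact (hl.1.differentiableAt (hD.isOpen_spaceTime.mem_nhds
        (mem_spaceTime (mul_pos hθ hτ) hx he))).hasFDerivAt
    exact h2.comp_hasDerivAt (1 : ℝ)
      ((hτd.const_mul θ).prodMk (h1.prodMk (hasDerivAt_const _ e)))
  set C := endGen α l 1 x e - endGen α l 1 e e with hC
  have hval : ∀ θ : ℝ, 0 < θ → α * fderiv ℝ l (θ * τ, x, e) (θ * (α⁻¹ * τ), x, 0) =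
      d e - d x - n * α - β - ν * (θ * τ) - C / (θ * τ) := by
    intro θ hθ
    have hθτ := mul_pos hθ hτ
    have hv : ((2 * (θ * τ), α • x, α • e) : ℝ × E n × E n) =
        α • ((θ * (α⁻¹ * τ), x, 0) : ℝ × E n × E n) +
          ((θ * τ, 0, α • e) : ℝ × E n × E n) := by
      ext
      · simp; field_simp; ring
      · simp
      · simp
    have e1 := hS (θ * τ) hθτ x hx e he
    have e2 := hU (θ * τ) hθτ
    have e3 := endGen_sub (x := x) (x' := e) (y := e) (y' := e) hD hl.1 hinv hθτ one_pos
      hx he he he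
    rw [← hC, e2] at e3
    rw [scaleGen, hv, map_add, map_smul, smul_eq_mul] at e1
    have e4 : fderiv ℝ l (θ * τ, x, e) (θ * τ, 0, α • e) =
        -ν * (θ * τ) + β + C / (θ * τ) := by
      rw [endGen] at e3
      field_simp
      linarith
    rw [e4] at e1
    linarith
  have hdiff := (twiceDiffOn_coneExponent (α := α) hD h0 hl he ν).1.differentiableAt
    (hD.isOpen.mem_nhds hx)
  have hfd1 : HasDerivAt (fun c : ℝ => l (‖c • x‖ ^ α⁻¹, c • x, e))
      (fderiv ℝ l (1 * τ, x, e) (1 * (α⁻¹ * τ), x, 0)) 1 := by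
    simpa only [one_mul] using hfd 1 one_pos
  rw [fderiv_apply_self_eq hdiff ((hfd1.sub ((hfd 2 two_pos).const_mul 2)).sub
    (hτd.const_mul (3 * ν))), mul_sub, mul_sub, mul_left_comm α 2, hval 1 one_pos, hval 2 two_pos]
  field_simp
  ring

/-- Logarithms of densities whose time inversions are homogeneous become invariant under dilations
of index `α / 2` after subtraction of a coboundary in space and a linear function of time. -/
theorem exists_exponent (hα : 0 < α) (hD : IsOpenCone D) (hl : TwiceDiffOn l (spaceTime D))
    (hinv : IsInvHomogeneous D α l) :
    ∃ (ν : ℝ) (H : E n → ℝ), TwiceDiffOn H D ∧ (D = univ → H = originExponent l) ∧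
      ∀ t : ℝ, 0 < t → ∀ x ∈ D, ∀ y ∈ D, ∀ c : ℝ, 0 < c →
        l (c * t, c ^ (α / 2) • x, c ^ (α / 2) • y) + n * α / 2 * Real.log c + ν * (c * t)
          - H (c ^ (α / 2) • y) + H (c ^ (α / 2) • x) = l (t, x, y) + ν * t - H y + H x := by
  rcases D.eq_empty_or_nonempty with rfl | ⟨e, he⟩
  · refine ⟨0, originExponent l, ⟨?_, ?_⟩, fun _ => rfl, by simp⟩ <;> simp [DifferentiableOn]
  by_cases h0 : (0 : E n) ∈ D
  -- A ball around the origin, dilated, covers the space.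
  · have hDu : D = univ := by
      refine eq_univ_of_forall fun x => ?_
      obtain ⟨ε, hε, hball⟩ := Metric.isOpen_iff.1 hD.isOpen 0 h0
      have hxp : 0 < ‖x‖ + 1 := by positivity
      have hmem : (ε / (‖x‖ + 1)) • x ∈ D := by
        apply hball
        rw [mem_ball_zero_iff, norm_smul, Real.norm_of_nonneg (by positivity), div_mul_eq_mul_div,
          div_lt_iff₀ hxp]
        nlinarith [norm_nonneg x]
      have := hD.smul_mem ((‖x‖ + 1) / ε) (by positivity) _ hmem
      rw [smul_smul] at this
      convert this using 1
      rw [div_mul_div_cancel₀ hε.ne', div_self hxp.ne', one_smul]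
    subst hDu
    obtain ⟨ν, β, d, hS, -⟩ := exists_scaleGen_eq hD hl hinv h0
    have hH := twiceDiffOn_originExponent hl
    exact ⟨ν, originExponent l, hH, fun _ => rfl, fun t ht x hx y hy c hc =>
      scaling_of_radial hD hl.1 hS hH.1 (radial_originExponent hl hinv hS) ht hx hy hc⟩
  · obtain ⟨ν, β, d, hS, hU⟩ := exists_scaleGen_eq hD hl hinv he
    have hH := twiceDiffOn_coneExponent (α := α) hD h0 hl he ν
    exact ⟨ν, coneExponent α ν l e, hH, fun h => absurd (h ▸ mem_univ _) h0,
      fun t ht x hx y hy c hc => scaling_of_radial hD hl.1 hS hH.1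
        (radial_coneExponent hα hD h0 hl hinv he hS hU) ht hx hy hc⟩

end Exponent

/-! ### Semi-stable densities obtained from the exponent -/

section DensityTransform

variable {n : ℕ} {D : Set (E n)} {α : ℝ} {p : ℝ → E n → E n → ℝ}

/-- The logarithm of a density as a function of time and space. -/
noncomputable def logDensity (p : ℝ → E n → E n → ℝ) (v : ℝ × E n × E n) : ℝ :=
  Real.log (p v.1 v.2.1 v.2.2)

theorem IsSemigroupDensity.twiceDiffOn_logDensity (hp : IsSemigroupDensity D p)
    (hD : IsOpenCone D) : TwiceDiffOn (logDensity p) (spaceTime D) :=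
  TwiceDiffOn.log (f := fun v : ℝ × E n × E n => p v.1 v.2.1 v.2.2) hp.twiceDiff
    hD.isOpen_spaceTime fun v hv => hp.pos v.1 hv.1 v.2.1 hv.2.1 v.2.2 hv.2.2

theorem IsSemigroupDensity.continuousOn (hp : IsSemigroupDensity D p) :
    ContinuousOn (fun v : ℝ × E n × E n => p v.1 v.2.1 v.2.2) (spaceTime D) :=
  hp.twiceDiff.1.continuousOn

/-- The factor exp(νt - H(y) + H(x)) is multiplicative along chains of points, so Chapman–Kolmogorov
passes from p to r. The last two conclusions serve to control mass and ν on the whole space. -/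
theorem exists_densityHTransform (hα : 0 < α) (hD : IsOpenCone D) (hp : IsSemigroupDensity D p)
    (hinv : IsInvHomogeneous D α (logDensity p)) :
    ∃ (r : ℝ → E n → E n → ℝ) (h : E n → ℝ) (ν : ℝ),
      IsSemigroupDensity D r ∧ IsSemistableDensity D (α / 2) r ∧ IsDensityHTransform D h ν r p ∧
      ContinuousOn h D ∧
      (D = univ → ∃ C : E n → ℝ, ∀ t : ℝ, 0 < t → ∀ x : E n,
        r t x 0 = r t 0 0 * Real.exp (C x / t)) := by
  classical
  have hl := hp.twiceDiffOn_logDensity hD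
  obtain ⟨ν, H, hH, hHu, hscale⟩ := exists_exponent hα hD hl hinv
  set r : ℝ → E n → E n → ℝ := fun t x y =>
    Real.exp (logDensity p (t, x, y) + ν * t - H y + H x) with hr
  -- H is controlled on D only; the constant 1 outside D makes h measurable everywhere.
  set h : E n → ℝ := D.piecewise (fun x => Real.exp (H x)) (fun _ => 1) with hh
  have hhD : ∀ x ∈ D, h x = Real.exp (H x) := fun x hx => piecewise_eq_of_mem _ _ _ hx
  have hexp : ∀ t : ℝ, 0 < t → ∀ x ∈ D, ∀ y ∈ D,
      r t x y = p t x y * Real.exp (ν * t - H y + H x) := by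
    intro t ht x hx y hy
    simp only [hr, logDensity]
    rw [show Real.log (p t x y) + ν * t - H y + H x = Real.log (p t x y) + (ν * t - H y + H x) by
      ring, Real.exp_add, Real.exp_log (hp.pos t ht x hx y hy)]
  have hHc : ContinuousOn H D := hH.1.continuousOn
  refine ⟨r, h, ν, ⟨fun t _ x _ y _ => Real.exp_pos _, ?_, ?_⟩, ?_, ⟨?_, ?_, ?_⟩, ?_, ?_⟩
  · have hO := hD.isOpen_spaceTime
    have hx : TwiceDiffOn (fun v : ℝ × E n × E n => H v.2.1) (spaceTime D) :=
      hH.comp (f := fun v : ℝ × E n × E n => v.2.1) (.of_contDiff (by fun_prop) hO) hO hD.isOpen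
        fun v hv => hv.2.1
    have hy : TwiceDiffOn (fun v : ℝ × E n × E n => H v.2.2) (spaceTime D) :=
      hH.comp (f := fun v : ℝ × E n × E n => v.2.2) (.of_contDiff (by fun_prop) hO) hO hD.isOpen
        fun v hv => hv.2.2
    have ht : TwiceDiffOn (fun v : ℝ × E n × E n => ν * v.1) (spaceTime D) :=
      .of_contDiff (by fun_prop) hO
    exact (((hl.add ht hO).sub hy hO).add hx hO).exp hO
  · intro s t hs ht x hx y hy
    rw [hexp (s + t) (by positivity) x hx y hy, ENNReal.ofReal_mul (hp.pos _ (by positivity) x hx y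
      hy).le, ← hp.chapmanKolmogorov s t hs ht x hx y hy, ← lintegral_mul_const' _ _
      ENNReal.ofReal_ne_top]
    refine setLIntegral_congr_fun hD.isOpen.measurableSet fun z hz => ?_
    rw [hexp s hs x hx z hz, hexp t ht z hz y hy, ← ENNReal.ofReal_mul (mul_pos (hp.pos s hs x hx z
      hz) (hp.pos t ht z hz y hy)).le]
    congr 1
    rw [show ν * (s + t) - H y + H x = (ν * s - H z + H x) + (ν * t - H y + H z) by ring,
      Real.exp_add (ν * s - H z + H x)]
    ring
  · intro t ht x hx y hy
    have hi : 0 < (t ^ (α / 2))⁻¹ := by positivity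
    -- Dilating by c = t from time 1 gives the scaling at time t; the Jacobian is the term (nα/2)
    -- log t.
    have := hscale 1 one_pos _ (hD.smul_mem _ hi x hx) _ (hD.smul_mem _ hi y hy) t ht
    have hne : t ^ (α / 2) ≠ 0 := by positivity
    simp only [smul_smul, mul_inv_cancel₀ hne, one_smul, mul_one] at this
    simp only [hr]
    rw [Real.rpow_def_of_pos ht, ← Real.exp_add]
    congr 1
    linarith
  · exact ContinuousOn.measurable_piecewise (Real.continuous_exp.comp_continuousOn hHc)
      continuousOn_const hD.isOpen.measurableSet
  · intro x hx
    rw [hhD x hx]; exact Real.exp_pos _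
  · intro t ht x hx y hy
    rw [hexp t ht x hx y hy, hhD x hx, hhD y hy, ← Real.exp_sub, ← Real.exp_add, mul_left_comm,
      ← Real.exp_add]
    ring_nf
    simp
  · exact (Real.continuous_exp.comp_continuousOn hHc).congr hhD
  · rintro rfl
    obtain ⟨C, hC⟩ := originExponent_add hl hinv
    refine ⟨C, fun t ht x => ?_⟩
    simp only [hr]
    rw [← Real.exp_add, ← hC t ht x, hHu rfl]
    congr 1
    ring

end DensityTransform

/-! ### Mass one on the whole space, and the sign of ν -/

section Conservative

open Filter Topology

variable {n : ℕ} {γ : ℝ} {r : ℝ → E n → E n → ℝ}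

theorem IsSemigroupDensity.continuous_start (hr : IsSemigroupDensity univ r) {t : ℝ} (ht : 0 < t)
    (y : E n) : Continuous fun x => r t x y :=
  hr.continuousOn.comp_continuous (f := fun x => (t, x, y)) (by fun_prop)
    fun x => mem_spaceTime ht (mem_univ x) (mem_univ y)

theorem IsSemigroupDensity.continuous_end (hr : IsSemigroupDensity univ r) {t : ℝ} (ht : 0 < t)
    (x : E n) : Continuous fun y => r t x y :=
  hr.continuousOn.comp_continuous (f := fun y => (t, x, y)) (by fun_prop)
    fun y => mem_spaceTime ht (mem_univ x) (mem_univ y)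

theorem IsSemistableDensity.origin (hs : IsSemistableDensity univ γ r) {t : ℝ} (ht : 0 < t) :
    r t (0 : E n) 0 = t ^ (-(n * γ)) * r 1 0 0 := by
  simpa using hs t ht 0 (mem_univ _) 0 (mem_univ _)

/-- If C > ε on a nonempty open set B, the paths from 0 to 0 through B at time 1 contribute at least
a constant times exp(ε/t) to r_{1+t}(0,0) for t ≤ 1. That value is at most r_1(0,0) by scaling, a
contradiction as t → 0. -/
theorem nonpos_of_exp_form (hγ : 0 ≤ γ) (hr : IsSemigroupDensity univ r)
    (hs : IsSemistableDensity univ γ r) {C : E n → ℝ}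
    (hC : ∀ t : ℝ, 0 < t → ∀ x : E n, r t x 0 = r t 0 0 * Real.exp (C x / t)) (x : E n) :
    C x ≤ 0 := by
  by_contra hcon
  have hx0 : 0 < C x := not_le.1 hcon
  have h00 : 0 < r 1 (0 : E n) 0 := hr.pos 1 one_pos 0 (mem_univ _) 0 (mem_univ _)
  have hCeq : C = fun x => Real.log (r 1 x 0 / r 1 0 0) := by
    ext x
    rw [hC 1 one_pos x, mul_div_cancel_left₀ _ h00.ne', Real.log_exp, div_one]
  have hCc : Continuous C := by
    rw [hCeq]
    exact ((hr.continuous_start one_pos 0).div_const _).log fun x =>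
      (div_pos (hr.pos 1 one_pos x (mem_univ _) 0 (mem_univ _)) h00).ne'
  set ε := C x / 2 with hε
  have hε0 : 0 < ε := by positivity
  set B : Set (E n) := {z | ε < C z} with hB
  have hBo : IsOpen B := isOpen_lt continuous_const hCc
  have hBx : x ∈ B := by simp only [hB, mem_ofPred_eq]; linarith
  set m := ∫⁻ z in B, ENNReal.ofReal (r 1 0 z) with hm
  have hm0 : m ≠ 0 := by
    have hpos : 0 < m := by
      rw [hm, setLIntegral_pos_iff
        (hr.continuous_end one_pos 0).measurable.ennreal_ofReal]
      refine lt_of_lt_of_le (hBo.measure_pos volume ⟨x, hBx⟩) (measure_mono fun z hz => ⟨?_, hz⟩)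
      simp [Function.mem_support, hr.pos 1 one_pos 0 (mem_univ _) z (mem_univ _)]
    exact hpos.ne'
  -- With kmε > 1 and t = 1/(k+1), the bound exp(ε/t) ≥ kε is already too large; no limit is needed.
  obtain ⟨k, hk⟩ := ENNReal.exists_nat_mul_gt
    (mul_ne_zero hm0 (ENNReal.ofReal_pos.2 hε0).ne') ENNReal.one_ne_top
  have hk1 : (0 : ℝ) < k + 1 := by positivity
  set t : ℝ := ((k : ℝ) + 1)⁻¹ with ht
  have ht0 : 0 < t := by positivity
  have ht1 : t ≤ 1 := inv_le_one_of_one_le₀ (by linarith [(Nat.cast_nonneg k : (0 : ℝ) ≤ k)])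
  have hnγ : 0 ≤ (n : ℝ) * γ := by positivity
  have h1 : m * ENNReal.ofReal (r 1 (0 : E n) 0 * Real.exp (ε / t)) ≤
      ENNReal.ofReal (r 1 (0 : E n) 0) := by
    calc m * ENNReal.ofReal (r 1 (0 : E n) 0 * Real.exp (ε / t))
        = ∫⁻ z in B, ENNReal.ofReal (r 1 0 z) *
            ENNReal.ofReal (r 1 (0 : E n) 0 * Real.exp (ε / t)) := by
          rw [lintegral_mul_const' _ _ ENNReal.ofReal_ne_top]
      _ ≤ ∫⁻ z in B, ENNReal.ofReal (r 1 0 z * r t z 0) := by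
          refine setLIntegral_mono' hBo.measurableSet fun z hz => ?_
          have hp := (hr.pos 1 one_pos 0 (mem_univ _) z (mem_univ _)).le
          rw [← ENNReal.ofReal_mul hp]
          refine ENNReal.ofReal_le_ofReal (mul_le_mul_of_nonneg_left ?_ hp)
          rw [hC t ht0 z, hs.origin ht0]
          have h3 : 1 ≤ t ^ (-(n * γ)) :=
            Real.one_le_rpow_of_pos_of_le_one_of_nonpos ht0 ht1 (by linarith)
          have h4 : ε / t ≤ C z / t := div_le_div_of_nonneg_right (le_of_lt hz) ht0.le
          calc r 1 0 0 * Real.exp (ε / t) ≤ r 1 0 0 * Real.exp (C z / t) := by gcongr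
            _ ≤ t ^ (-(n * γ)) * r 1 0 0 * Real.exp (C z / t) := by
              gcongr; exact le_mul_of_one_le_left h00.le h3
      _ ≤ ∫⁻ z in univ, ENNReal.ofReal (r 1 0 z * r t z 0) :=
          lintegral_mono_set (subset_univ _)
      _ = ENNReal.ofReal (r (1 + t) 0 0) :=
          hr.chapmanKolmogorov 1 t one_pos ht0 0 (mem_univ _) 0 (mem_univ _)
      _ ≤ ENNReal.ofReal (r 1 (0 : E n) 0) := by
          refine ENNReal.ofReal_le_ofReal ?_
          rw [hs.origin (by positivity)]
          exact mul_le_of_le_one_left h00.le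
            (Real.rpow_le_one_of_one_le_of_nonpos (by linarith) (by linarith))
  have h2 : (k : ℝ≥0∞) * (m * ENNReal.ofReal ε) ≤ 1 := by
    rw [ENNReal.ofReal_mul h00.le, ← mul_assoc, mul_comm m, mul_assoc] at h1
    have h3 : m * ENNReal.ofReal (Real.exp (ε / t)) ≤ 1 := by
      have hne := (ENNReal.ofReal_pos.2 h00).ne'
      refine (ENNReal.mul_le_mul_iff_right hne ENNReal.ofReal_ne_top).1 ?_
      rwa [mul_one]
    refine le_trans ?_ h3
    rw [mul_left_comm]
    gcongr
    rw [← ENNReal.ofReal_natCast, ← ENNReal.ofReal_mul (Nat.cast_nonneg k)]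
    refine ENNReal.ofReal_le_ofReal ?_
    rw [ht, div_inv_eq_mul]
    nlinarith [Real.add_one_le_exp (ε * (k + 1))]
  exact absurd hk (not_lt.2 h2)

/-- Semi-stable semigroup densities on the whole space that end at the origin like
`exp (C x / t)` are conservative. -/
theorem mass_eq_one_of_exp_form (hγ : 0 ≤ γ) (hr : IsSemigroupDensity univ r)
    (hs : IsSemistableDensity univ γ r) {C : E n → ℝ}
    (hC : ∀ t : ℝ, 0 < t → ∀ x : E n, r t x 0 = r t 0 0 * Real.exp (C x / t))
    {s : ℝ} (hs0 : 0 < s) (x : E n) :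
    ∫⁻ y in univ, ENNReal.ofReal (r s x y) = 1 := by
  have h00 : 0 < r 1 (0 : E n) 0 := hr.pos 1 one_pos 0 (mem_univ _) 0 (mem_univ _)
  have hCn := nonpos_of_exp_form hγ hr hs hC
  have hCc : ∀ t : ℝ, 0 < t → (fun z => Real.exp (C z / t)) = fun z => r t z 0 / r t 0 0 := by
    intro t ht
    ext z
    rw [hC t ht z, mul_div_cancel_left₀]
    exact (hr.pos t ht 0 (mem_univ _) 0 (mem_univ _)).ne'
  have hk : ∀ k : ℕ, (0 : ℝ) < k + 1 := fun k => by positivity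
  -- Chapman–Kolmogorov with final leg of length k + 1 ending at 0, divided by r_{k+1}(0,0).
  have hval : ∀ k : ℕ, ∫⁻ z in univ, ENNReal.ofReal (r s x z * Real.exp (C z / (k + 1))) =
      ENNReal.ofReal (((s + (k + 1)) / (k + 1)) ^ (-(n * γ)) *
        Real.exp (C x / (s + (k + 1)))) := by
    intro k
    have hpos : 0 < r ((k : ℝ) + 1) (0 : E n) 0 := hr.pos _ (hk k) 0 (mem_univ _) 0 (mem_univ _)
    have h1 := hr.chapmanKolmogorov s (k + 1) hs0 (hk k) x (mem_univ _) 0 (mem_univ _)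
    have h2 : ∀ z, ENNReal.ofReal (r s x z * r ((k : ℝ) + 1) z 0) =
        ENNReal.ofReal (r ((k : ℝ) + 1) (0 : E n) 0) *
          ENNReal.ofReal (r s x z * Real.exp (C z / (k + 1))) := by
      intro z
      rw [hC _ (hk k) z, ← ENNReal.ofReal_mul hpos.le]
      congr 1
      ring
    simp only [h2] at h1
    rw [lintegral_const_mul' _ _ ENNReal.ofReal_ne_top] at h1
    have h3 : r (s + (k + 1)) x 0 = r ((k : ℝ) + 1) (0 : E n) 0 *
        (((s + (k + 1)) / (k + 1)) ^ (-(n * γ)) * Real.exp (C x / (s + (k + 1)))) := by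
      rw [hC _ (by positivity) x, hs.origin (by positivity), hs.origin (hk k),
        Real.div_rpow (by positivity) (hk k).le]
      have : ((k : ℝ) + 1) ^ (-(n * γ)) ≠ 0 := (Real.rpow_pos_of_pos (hk k) _).ne'
      field_simp
    rw [h3, ENNReal.ofReal_mul hpos.le] at h1
    exact (ENNReal.mul_right_inj (ENNReal.ofReal_pos.2 hpos).ne' ENNReal.ofReal_ne_top).1 h1
  -- Because C ≤ 0, the integrands increase to r_s(x,·) and monotone convergence applies.
  have hlim1 : Tendsto (fun k : ℕ =>
      ∫⁻ z in univ, ENNReal.ofReal (r s x z * Real.exp (C z / ((k : ℝ) + 1)))) atTop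
      (𝓝 (∫⁻ y in univ, ENNReal.ofReal (r s x y))) := by
    refine lintegral_tendsto_of_tendsto_of_monotone (fun k => ?_) (ae_of_all _ fun z => ?_)
      (ae_of_all _ fun z => ?_)
    · refine Measurable.aemeasurable (Measurable.ennreal_ofReal ?_)
      have h1 := (hr.continuous_end hs0 x).measurable
      have h2 : Measurable fun z => Real.exp (C z / ((k : ℝ) + 1)) := by
        rw [hCc _ (hk k)]
        exact ((hr.continuous_start (hk k) 0).div_const _).measurable
      exact h1.mul h2
    · intro i j hij
      refine ENNReal.ofReal_le_ofReal (mul_le_mul_of_nonneg_left (Real.exp_le_exp.2 ?_)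
        (hr.pos s hs0 x (mem_univ _) z (mem_univ _)).le)
      have hij' : (i : ℝ) + 1 ≤ j + 1 := by exact_mod_cast Nat.succ_le_succ hij
      rw [div_le_div_iff₀ (hk i) (hk j)]
      exact mul_le_mul_of_nonpos_left hij' (hCn z)
    · refine ENNReal.tendsto_ofReal ?_
      have h1 : Tendsto (fun k : ℕ => C z / ((k : ℝ) + 1)) atTop (𝓝 0) :=
        tendsto_const_nhds.div_atTop
          (tendsto_atTop_add_const_right _ _ tendsto_natCast_atTop_atTop)
      have h2 := (Real.continuous_exp.tendsto 0).comp h1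
      simpa using h2.const_mul (r s x z)
  have hlim2 : Tendsto (fun k : ℕ =>
      ∫⁻ z in univ, ENNReal.ofReal (r s x z * Real.exp (C z / ((k : ℝ) + 1)))) atTop
      (𝓝 1) := by
    simp only [hval]
    rw [← ENNReal.ofReal_one]
    refine ENNReal.tendsto_ofReal ?_
    have hk' : Tendsto (fun k : ℕ => (k : ℝ) + 1) atTop atTop :=
      tendsto_atTop_add_const_right _ _ tendsto_natCast_atTop_atTop
    have h1 : Tendsto (fun k : ℕ => C x / (s + ((k : ℝ) + 1))) atTop (𝓝 0) :=
      tendsto_const_nhds.div_atTop (tendsto_atTop_add_const_left _ _ hk')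
    have h2 := (Real.continuous_exp.tendsto 0).comp h1
    have h3 : Tendsto (fun k : ℕ => (s + ((k : ℝ) + 1)) / ((k : ℝ) + 1)) atTop (𝓝 1) := by
      have : (fun k : ℕ => (s + ((k : ℝ) + 1)) / ((k : ℝ) + 1)) =
          fun k : ℕ => s / ((k : ℝ) + 1) + 1 := by
        ext k; rw [add_div, div_self (hk k).ne']
      rw [this]
      simpa using (tendsto_const_nhds.div_atTop hk').add_const (1 : ℝ)
    have h4 := h3.rpow_const (p := -(n * γ)) (Or.inl one_ne_zero)
    simpa using h4.mul h2
  exact tendsto_nhds_unique hlim1 hlim2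

/-- For t ≥ 1 and y in the unit ball, y/t^γ stays in that ball, where h and r_1(0,·) have positive
minima. So p_t(0,·) gives the ball at least a constant times exp(-νt) t^{-nγ}, which is unbounded
when ν < 0. -/
theorem nonneg_of_htransform (hγ : 0 ≤ γ) (hr : IsSemigroupDensity univ r)
    (hs : IsSemistableDensity univ γ r) {p : ℝ → E n → E n → ℝ}
    (hmass : ∀ t : ℝ, 0 < t → ∀ x ∈ (univ : Set (E n)),
      ∫⁻ y in univ, ENNReal.ofReal (p t x y) = 1)
    {h : E n → ℝ} {ν : ℝ} (hh : IsDensityHTransform univ h ν r p) (hc : Continuous h) :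
    0 ≤ ν := by
  by_contra hν
  have hν : 0 < -ν := by linarith
  have hK : IsCompact (Metric.closedBall (0 : E n) 1) := isCompact_closedBall _ _
  have hne : (Metric.closedBall (0 : E n) 1).Nonempty := ⟨0, by simp⟩
  obtain ⟨y1, -, hy1⟩ := hK.exists_isMinOn hne hc.continuousOn
  obtain ⟨y2, -, hy2⟩ := hK.exists_isMinOn hne (hr.continuous_end one_pos 0).continuousOn
  set c := h y1 / h 0 * r 1 0 y2 with hcdef
  have hc0 : 0 < c := mul_pos (div_pos (hh.pos _ (mem_univ _)) (hh.pos _ (mem_univ _)))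
    (hr.pos 1 one_pos 0 (mem_univ _) _ (mem_univ _))
  set v := volume (Metric.closedBall (0 : E n) 1) with hv
  have hv0 : v ≠ 0 := (Metric.measure_closedBall_pos _ _ one_pos).ne'
  have hbound : ∀ t : ℝ, 1 ≤ t →
      ENNReal.ofReal (c * (Real.exp (-ν * t) / t ^ (n * γ))) * v ≤ 1 := by
    intro t ht
    have ht0 : 0 < t := by linarith
    rw [← hmass t ht0 0 (mem_univ _), hv, ← setLIntegral_const]
    refine le_trans (setLIntegral_mono' Metric.isClosed_closedBall.measurableSet fun y hy => ?_)
      (lintegral_mono_set (subset_univ (Metric.closedBall (0 : E n) 1)))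
    refine ENNReal.ofReal_le_ofReal ?_
    rw [hh.eq t ht0 0 (mem_univ _) y (mem_univ _), hs t ht0 0 (mem_univ _) y (mem_univ _),
      smul_zero, Real.rpow_neg ht0.le, hcdef]
    have h1 : h y1 ≤ h y := hy1 hy
    have h2 : r 1 0 y2 ≤ r 1 0 ((t ^ γ)⁻¹ • y) := by
      apply hy2
      rw [mem_closedBall_zero_iff] at hy ⊢
      rw [norm_smul, Real.norm_of_nonneg (by positivity)]
      have : (t ^ γ)⁻¹ ≤ 1 := inv_le_one_of_one_le₀ (Real.one_le_rpow ht hγ)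
      exact mul_le_one₀ this (norm_nonneg _) hy
    have hh0 := hh.pos 0 (mem_univ _)
    have hr2 := (hr.pos 1 one_pos 0 (mem_univ _) y2 (mem_univ _)).le
    have hhy := (hh.pos y (mem_univ _)).le
    calc h y1 / h 0 * r 1 0 y2 * (Real.exp (-ν * t) / t ^ (n * γ))
        ≤ h y / h 0 * r 1 0 ((t ^ γ)⁻¹ • y) * (Real.exp (-ν * t) / t ^ (n * γ)) := by gcongr
      _ = _ := by ring
  obtain ⟨k, hk⟩ := ENNReal.exists_nat_mul_gt hv0 ENNReal.one_ne_top
  have hlim := (tendsto_exp_mul_div_rpow_atTop (n * γ) (-ν) hν).const_mul_atTop hc0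
  obtain ⟨t, ht1, ht⟩ := ((eventually_ge_atTop (1 : ℝ)).and (hlim.eventually_ge_atTop (k : ℝ))).exists
  have := hbound t ht1
  refine absurd hk (not_lt.2 (le_trans ?_ this))
  gcongr
  rw [← ENNReal.ofReal_natCast]
  exact ENNReal.ofReal_le_ofReal ht

end Conservative

/-! ### Finite-dimensional laws of a Markov process -/

section Laws

variable {n : ℕ} {D : Set (E n)} {p : ℝ → E n → E n → ℝ} {P : E n → Measure (Path n)}

/-- The density `p t` as an extended nonnegative function, extended by zero. -/
noncomputable def extDensity (D : Set (E n)) (p : ℝ → E n → E n → ℝ) (t : ℝ) :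
    E n × E n → ℝ≥0∞ :=
  (D ×ˢ D).indicator fun q => ENNReal.ofReal (p t q.1 q.2)

theorem extDensity_of_mem {t : ℝ} {x y : E n} (hx : x ∈ D) (hy : y ∈ D) :
    extDensity D p t (x, y) = ENNReal.ofReal (p t x y) :=
  indicator_of_mem (mk_mem_prod hx hy) _

theorem extDensity_of_notMem {t : ℝ} {x y : E n} (hy : y ∉ D) :
    extDensity D p t (x, y) = 0 :=
  indicator_of_notMem (fun h => hy h.2) _

theorem measurable_extDensity (hD : MeasurableSet D) (hp : IsSemigroupDensity D p) {t : ℝ}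
    (ht : 0 < t) : Measurable (extDensity D p t) := by
  classical
  have hc : ContinuousOn (fun q : E n × E n => ENNReal.ofReal (p t q.1 q.2)) (D ×ˢ D) := by
    refine ENNReal.continuous_ofReal.comp_continuousOn ?_
    exact hp.continuousOn.comp (f := fun q : E n × E n => (t, q.1, q.2)) (by fun_prop)
      fun q hq => mem_spaceTime ht hq.1 hq.2
  rw [extDensity, ← piecewise_eq_indicator]
  exact hc.measurable_piecewise continuousOn_const (hD.prod hD)

theorem setLIntegral_extDensity (hD : MeasurableSet D) {t : ℝ} {x : E n} (hx : x ∈ D)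
    {B : Set (E n)} (hB : MeasurableSet B) :
    ∫⁻ y in B, extDensity D p t (x, y) = ∫⁻ y in B ∩ D, ENNReal.ofReal (p t x y) := by
  rw [← lintegral_indicator hB, ← lintegral_indicator (hB.inter hD)]
  congr 1
  ext y
  by_cases hy : y ∈ D
  · by_cases hyB : y ∈ B
    · rw [indicator_of_mem hyB, indicator_of_mem (mem_inter hyB hy), extDensity_of_mem hx hy]
    · rw [indicator_of_notMem hyB, indicator_of_notMem fun h => hyB h.1]
  · have h0 : (B ∩ D).indicator (fun y => ENNReal.ofReal (p t x y)) y = 0 :=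
      indicator_of_notMem (fun h => hy h.2) _
    rw [h0, indicator_apply_eq_zero]
    exact fun _ => extDensity_of_notMem hy

theorem measurable_setLIntegral_extDensity (hD : MeasurableSet D) (hp : IsSemigroupDensity D p)
    {t : ℝ} (ht : 0 < t) (B : Set (E n)) :
    Measurable fun x => ∫⁻ y in B, extDensity D p t (x, y) :=
  (measurable_extDensity hD hp ht).lintegral_prod_right'

theorem IsMarkovProcess.law (hD : MeasurableSet D) (hP : IsMarkovProcess D p P) {x : E n}
    (hx : x ∈ D) {t : ℝ≥0} (ht : 0 < t) :
    (P x).map (fun ω => ω t) = volume.withDensity fun y => extDensity D p t (x, y) := by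
  have := hP.prob x hx
  ext B hB
  rw [Measure.map_apply (measurable_pi_apply t) hB, withDensity_apply _ hB,
    setLIntegral_extDensity hD hx hB]
  have h := hP.markov x hx 0 t ht univ MeasurableSet.univ B hB
  rw [univ_inter, zero_add, setLIntegral_univ] at h
  change P x {ω | ω t ∈ B} = _
  rw [h, lintegral_congr_ae (g := fun _ => ∫⁻ y in B ∩ D, ENNReal.ofReal (p t x y))]
  · simp
  · filter_upwards [hP.start x hx] with ω hω
    rw [hω]

theorem IsMarkovProcess.ae_mem (hD : MeasurableSet D) (hP : IsMarkovProcess D p P) {x : E n}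
    (hx : x ∈ D) (t : ℝ≥0) : ∀ᵐ ω ∂(P x), ω t ∈ D := by
  rcases eq_or_lt_of_le (zero_le (a := t)) with rfl | ht
  · filter_upwards [hP.start x hx] with ω hω
    rwa [hω]
  · refine ae_of_ae_map (f := fun ω : Path n => ω t) (measurable_pi_apply t).aemeasurable ?_
    rw [hP.law hD hx ht, ae_iff]
    change (volume.withDensity fun y => extDensity D p t (x, y)) Dᶜ = 0
    rw [withDensity_apply _ hD.compl]
    exact setLIntegral_eq_zero hD.compl fun y hy => extDensity_of_notMem hy

theorem IsMarkovProcess.markov_ext (hD : MeasurableSet D) (hP : IsMarkovProcess D p P) {x : E n}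
    (hx : x ∈ D) (s : ℝ≥0) {t : ℝ≥0} (ht : 0 < t) {A : Set (Path n)}
    (hA : MeasurableSet[past s] A) {B : Set (E n)} (hB : MeasurableSet B) :
    P x (A ∩ {ω | ω (s + t) ∈ B}) =
      ∫⁻ ω in A, (∫⁻ y in B, extDensity D p t (ω s, y)) ∂(P x) := by
  rw [hP.markov x hx s t ht A hA B hB]
  refine lintegral_congr_ae (ae_restrict_of_ae ?_)
  filter_upwards [hP.ae_mem hD hx s] with ω hω
  rw [setLIntegral_extDensity hD hω hB]

theorem measurable_eval_past {T : Type} [Preorder T] {r s : T} (h : r ≤ s) :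
    Measurable[past s] fun ω : T → E n => ω r :=
  (measurable_pi_apply (X := fun _ : Iic s => E n) ⟨r, h⟩).comp
    (comap_measurable (Preorder.restrictLe (π := fun _ : T => E n) s))

theorem IsMarkovProcess.joint (hD : MeasurableSet D) (hP : IsMarkovProcess D p P) {x : E n}
    (hx : x ∈ D) {s t : ℝ≥0} (hs : 0 < s) (ht : 0 < t) {A B : Set (E n)} (hA : MeasurableSet A)
    (hB : MeasurableSet B) :
    P x {ω | ω s ∈ A ∧ ω (s + t) ∈ B} =
      ∫⁻ y in A, extDensity D p s (x, y) * ∫⁻ z in B, extDensity D p t (y, z) := by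
  have hG := measurable_setLIntegral_extDensity hD hP.density (NNReal.coe_pos.2 ht) B
  have h := hP.markov_ext hD hx s ht (A := {ω | ω s ∈ A}) (measurable_eval_past le_rfl hA) hB
  have h2 := setLIntegral_map (μ := P x) (f := fun y => ∫⁻ z in B, extDensity D p t (y, z))
    (g := fun ω : Path n => ω s) hA hG (measurable_pi_apply s)
  change P x ({ω | ω s ∈ A} ∩ {ω | ω (s + t) ∈ B}) = _
  rw [h]
  refine h2.symm.trans ?_
  rw [hP.law hD hx hs, setLIntegral_withDensity_eq_setLIntegral_mul _ _ hG hA]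
  · rfl
  · exact (measurable_extDensity hD hP.density (NNReal.coe_pos.2 hs)).comp measurable_prodMk_left

end Laws

/-! ### Transition densities of the time-inverted process -/

section Inversion

variable {n : ℕ} {D : Set (E n)} {p : ℝ → E n → E n → ℝ} {P : E n → Measure (Path n)} {α : ℝ}

theorem measurable_timeInvert (α : ℝ) : Measurable (timeInvert (n := n) α) :=
  measurable_pi_lambda _ fun t =>
    (measurable_const_smul (t.1 ^ α)).comp (measurable_pi_apply _)

/-- Inversion reverses the order: the value at the later time t comes from X at the earlier time
1/t. Conditioning on X at 1/s is tested against all measurable sets C, so the exceptional null set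
may depend on B. -/
theorem ae_setLIntegral_inv (hD : MeasurableSet D) (hP : IsMarkovProcess D p P) {x : E n}
    (hx : x ∈ D) {κ : Kernel (E n) (E n)} [IsMarkovKernel κ] {s t : Ioi (0 : ℝ)} (hst : s < t)
    {B : Set (E n)} (hB : MeasurableSet B)
    (hκ : ∀ A : Set (Ioi (0 : ℝ) → E n), MeasurableSet[past s] A →
      ((P x).map (timeInvert α)) (A ∩ {η | η t ∈ B}) =
        ∫⁻ η in A, κ (η s) B ∂((P x).map (timeInvert α))) :
    ∀ᵐ z : E n, ∫⁻ y in {y | t.1 ^ α • y ∈ B},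
        extDensity D p (1 / t.1) (x, y) * extDensity D p (1 / s.1 - 1 / t.1) (y, z) =
      extDensity D p (1 / s.1) (x, z) * κ (s.1 ^ α • z) B := by
  obtain ⟨s, hs⟩ := s
  obtain ⟨t, ht⟩ := t
  have hs : 0 < s := hs
  have ht : 0 < t := ht
  have hst : s < t := hst
  have hlt : 1 / t < 1 / s := one_div_lt_one_div_of_lt hs hst
  simp only at hκ ⊢
  obtain ⟨τ, hτ⟩ : ∃ τ : ℝ≥0, (τ : ℝ) = 1 / t := ⟨⟨1 / t, by positivity⟩, rfl⟩
  obtain ⟨σ, hσ⟩ : ∃ σ : ℝ≥0, (σ : ℝ) = 1 / s - 1 / t := ⟨⟨1 / s - 1 / t, by linarith⟩, rfl⟩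
  have hT : ((τ + σ : ℝ≥0) : ℝ) = 1 / s := by rw [NNReal.coe_add, hτ, hσ]; ring
  have hτ0 : 0 < τ := by rw [← NNReal.coe_pos, hτ]; positivity
  have hσ0 : 0 < σ := by rw [← NNReal.coe_pos, hσ]; linarith
  have hnn1 : Real.toNNReal (1 / t) = τ := by rw [← hτ, Real.toNNReal_coe]
  have hnn2 : Real.toNNReal (1 / s) = τ + σ := by rw [← hT, Real.toNNReal_coe]
  rw [← hσ, ← hτ, ← hT]
  have hmτ := measurable_extDensity hD hP.density (NNReal.coe_pos.2 hτ0)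
  have hmσ := measurable_extDensity hD hP.density (NNReal.coe_pos.2 hσ0)
  have hmT := measurable_extDensity hD hP.density (NNReal.coe_pos.2 (add_pos hτ0 hσ0))
  have hmul : Measurable fun q : E n × E n =>
      extDensity D p τ (x, q.2) * extDensity D p σ (q.2, q.1) :=
    (hmτ.comp (measurable_const.prodMk measurable_snd)).mul (hmσ.comp measurable_swap)
  have hκm : Measurable fun z : E n => κ (s ^ α • z) B :=
    (κ.measurable_coe hB).comp (measurable_const_smul _)
  have hB' : MeasurableSet {y : E n | t ^ α • y ∈ B} := measurable_const_smul (t ^ α) hB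
  refine ae_eq_of_forall_setLIntegral_eq_of_sigmaFinite ?_ ?_ fun C hC _ => ?_
  · exact hmul.lintegral_prod_right'
  · exact (hmT.comp measurable_prodMk_left).mul hκm
  have hsα : s ^ α ≠ 0 := (Real.rpow_pos_of_pos hs _).ne'
  have hA' : MeasurableSet {a : E n | (s ^ α)⁻¹ • a ∈ C} := measurable_const_smul ((s ^ α)⁻¹) hC
  have hpast : MeasurableSet[past (⟨s, hs⟩ : Ioi (0 : ℝ))]
      {η : Ioi (0 : ℝ) → E n | (s ^ α)⁻¹ • η ⟨s, hs⟩ ∈ C} :=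
    measurable_eval_past (n := n) (le_refl (⟨s, hs⟩ : Ioi (0 : ℝ))) hA'
  have h := hκ {η | (s ^ α)⁻¹ • η ⟨s, hs⟩ ∈ C} hpast
  have hAm : MeasurableSet {η : Ioi (0 : ℝ) → E n | (s ^ α)⁻¹ • η ⟨s, hs⟩ ∈ C} :=
    measurable_pi_apply (X := fun _ : Ioi (0 : ℝ) => E n) ⟨s, hs⟩ hA'
  have hBm : MeasurableSet {η : Ioi (0 : ℝ) → E n | η ⟨t, ht⟩ ∈ B} :=
    measurable_pi_apply (X := fun _ : Ioi (0 : ℝ) => E n) ⟨t, ht⟩ hB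
  have hset1 : timeInvert α ⁻¹' ({η : Ioi (0 : ℝ) → E n | (s ^ α)⁻¹ • η ⟨s, hs⟩ ∈ C} ∩
      {η | η ⟨t, ht⟩ ∈ B}) =
      {ω : Path n | ω τ ∈ {y : E n | t ^ α • y ∈ B} ∧ ω (τ + σ) ∈ C} := by
    ext ω
    simp only [timeInvert, mem_preimage, mem_inter_iff, mem_ofPred_eq, hnn1, hnn2, smul_smul,
      inv_mul_cancel₀ hsα, one_smul]
    exact and_comm
  have hset2 : timeInvert α ⁻¹' {η : Ioi (0 : ℝ) → E n | (s ^ α)⁻¹ • η ⟨s, hs⟩ ∈ C} =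
      (fun ω : Path n => ω (τ + σ)) ⁻¹' C := by
    ext ω
    simp only [timeInvert, mem_preimage, mem_ofPred_eq, hnn2, smul_smul,
      inv_mul_cancel₀ hsα, one_smul]
  have hev : Measurable fun η : Ioi (0 : ℝ) → E n => κ (η ⟨s, hs⟩) B :=
    (κ.measurable_coe hB).comp (measurable_pi_apply _)
  rw [Measure.map_apply (measurable_timeInvert α) (hAm.inter hBm), hset1,
    hP.joint hD hx hτ0 hσ0 hB' hC, setLIntegral_map hAm hev (measurable_timeInvert α), hset2] at h
  have h3 := setLIntegral_map (μ := P x) (f := fun z : E n => κ (s ^ α • z) B)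
    (g := fun ω : Path n => ω (τ + σ)) hC hκm (measurable_pi_apply _)
  simp only [timeInvert, hnn2] at h
  have hmTx : Measurable fun y => extDensity D p (τ + σ : ℝ≥0) (x, y) :=
    hmT.comp measurable_prodMk_left
  rw [← h3, hP.law hD hx (add_pos hτ0 hσ0),
    setLIntegral_withDensity_eq_setLIntegral_mul _ hmTx hκm hC] at h
  rw [lintegral_lintegral_swap hmul.aemeasurable]
  refine Eq.trans ?_ h
  refine lintegral_congr fun y => ?_
  rw [lintegral_const_mul]
  exact hmσ.comp measurable_prodMk_left

theorem lintegral_eq_smul (c : ℝ) (hc : 0 < c) {f : E n → ℝ≥0∞} (hf : Measurable f) :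
    ∫⁻ y, f y = ENNReal.ofReal (c ^ n) * ∫⁻ b, f (c • b) := by
  have h := Measure.map_addHaar_smul (volume : Measure (E n)) hc.ne'
  have h2 : ∫⁻ b, f (c • b) = ENNReal.ofReal (c ^ n)⁻¹ * ∫⁻ y, f y := by
    rw [← lintegral_map (g := fun b : E n => c • b) hf (measurable_const_smul c), h,
      lintegral_smul_measure, finrank_euclideanSpace_fin, abs_of_pos (by positivity), smul_eq_mul]
  rw [h2, ← mul_assoc, ← ENNReal.ofReal_mul (by positivity), mul_inv_cancel₀ (by positivity)]
  simp

theorem ae_smul {Q : E n → Prop} {c : ℝ} (hc : 0 < c) (h : ∀ᵐ z : E n, Q z) :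
    ∀ᵐ a : E n, Q (c • a) := by
  refine ae_of_ae_map (f := fun b : E n => c • b) (measurable_const_smul c).aemeasurable ?_
  rw [Measure.map_addHaar_smul (volume : Measure (E n)) hc.ne']
  exact Measure.ae_smul_measure h _

/-- The transition density of the time-inverted process. -/
noncomputable def invDensity (α : ℝ) (p : ℝ → E n → E n → ℝ) (x : E n) (s t : ℝ)
    (q : E n × E n) : ℝ :=
  (t ^ (-α)) ^ n * (p t⁻¹ x (t ^ (-α) • q.2) * p (s⁻¹ - t⁻¹) (t ^ (-α) • q.2) (s ^ (-α) • q.1)) /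
    p s⁻¹ x (s ^ (-α) • q.1)

theorem ae_setLIntegral_invDensity (hD : IsOpenCone D) (hP : IsMarkovProcess D p P) {x : E n}
    (hx : x ∈ D) {κ : Kernel (E n) (E n)} [IsMarkovKernel κ] {s t : ℝ} (hs : 0 < s) (hst : s < t)
    {B : Set (E n)} (hB : MeasurableSet B)
    (hκ : ∀ A : Set (Ioi (0 : ℝ) → E n), MeasurableSet[past (⟨s, hs⟩ : Ioi (0 : ℝ))] A →
      ((P x).map (timeInvert α)) (A ∩ {η | η ⟨t, hs.trans hst⟩ ∈ B}) =
        ∫⁻ η in A, κ (η ⟨s, hs⟩) B ∂((P x).map (timeInvert α))) :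
    ∀ᵐ a : E n, a ∈ D → ∫⁻ b in B ∩ D, ENNReal.ofReal (invDensity α p x s t (a, b)) = κ a B := by
  have hDm := hD.isOpen.measurableSet
  have ht : 0 < t := hs.trans hst
  have hlt : t⁻¹ < s⁻¹ := inv_strictAnti₀ hs hst
  have hsα : 0 < s ^ (-α) := Real.rpow_pos_of_pos hs _
  have htα : 0 < t ^ (-α) := Real.rpow_pos_of_pos ht _
  have h := ae_setLIntegral_inv hDm hP hx (s := ⟨s, hs⟩) (t := ⟨t, ht⟩) hst hB hκ
  filter_upwards [ae_smul hsα h] with a ha haD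
  simp only [one_div, smul_smul] at ha
  rw [← Real.rpow_add hs, add_neg_cancel, Real.rpow_zero, one_smul] at ha
  have hsa : s ^ (-α) • a ∈ D := hD.smul_mem _ hsα _ haD
  rw [extDensity_of_mem hx hsa] at ha
  have hpos : 0 < p s⁻¹ x (s ^ (-α) • a) := hP.density.pos _ (by positivity) _ hx _ hsa
  have hB' : MeasurableSet {y : E n | t ^ α • y ∈ B} := measurable_const_smul (t ^ α) hB
  have hm : Measurable fun y => extDensity D p t⁻¹ (x, y) *
      extDensity D p (s⁻¹ - t⁻¹) (y, s ^ (-α) • a) :=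
    ((measurable_extDensity hDm hP.density (by positivity)).comp measurable_prodMk_left).mul
      ((measurable_extDensity hDm hP.density (by linarith)).comp measurable_prodMk_right)
  rw [← lintegral_indicator hB', lintegral_eq_smul (t ^ (-α)) htα (hm.indicator hB')] at ha
  have hne := (ENNReal.ofReal_pos.2 hpos).ne'
  refine (ENNReal.mul_right_inj hne ENNReal.ofReal_ne_top).1 (Eq.trans ?_ ha)
  rw [← lintegral_const_mul' _ _ ENNReal.ofReal_ne_top,
    ← lintegral_const_mul' _ _ ENNReal.ofReal_ne_top, ← lintegral_indicator (hB.inter hDm)]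
  refine lintegral_congr fun b => ?_
  have hmem : t ^ (-α) • b ∈ {y : E n | t ^ α • y ∈ B} ↔ b ∈ B := by
    rw [mem_ofPred_eq, smul_smul, ← Real.rpow_add ht, add_neg_cancel, Real.rpow_zero, one_smul]
  by_cases hbB : b ∈ B
  · rw [indicator_of_mem (hmem.2 hbB)]
    by_cases hbD : b ∈ D
    · have htb : t ^ (-α) • b ∈ D := hD.smul_mem _ htα _ hbD
      have h1 := hP.density.pos t⁻¹ (by positivity) _ hx _ htb
      have h2 := hP.density.pos (s⁻¹ - t⁻¹) (by linarith) _ htb _ hsa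
      rw [indicator_of_mem (mem_inter hbB hbD), extDensity_of_mem hx htb,
        extDensity_of_mem htb hsa, ← ENNReal.ofReal_mul hpos.le, ← ENNReal.ofReal_mul h1.le,
        ← ENNReal.ofReal_mul (by positivity), invDensity, mul_div_cancel₀ _ hpos.ne']
    · have htb : t ^ (-α) • b ∉ D := by
        intro hc
        have := hD.smul_mem _ (Real.rpow_pos_of_pos ht α) _ hc
        rw [smul_smul, ← Real.rpow_add ht, add_neg_cancel, Real.rpow_zero, one_smul] at this
        exact hbD this
      rw [indicator_of_notMem fun hc => hbD hc.2, extDensity_of_notMem htb, zero_mul, mul_zero]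
  · rw [indicator_of_notMem fun hc => hbB (hmem.1 hc), indicator_of_notMem fun hc => hbB hc.1,
      mul_zero]

/-- If F < G at a point, continuity separates F < M < N < G on a product of balls. Taking the second
ball for B contradicts the equality at some point of the first ball; a single B is used, so a null
set that depends on B is harmless. -/
theorem le_of_ae_setLIntegral_eq (hD : IsOpen D) {F G : E n × E n → ℝ}
    (hF : ContinuousOn F (D ×ˢ D)) (hG : ContinuousOn G (D ×ˢ D))
    (hF0 : ∀ q ∈ D ×ˢ D, 0 < F q)
    (h : ∀ B : Set (E n), MeasurableSet B → ∀ᵐ a : E n, a ∈ D →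
      ∫⁻ b in B ∩ D, ENNReal.ofReal (F (a, b)) = ∫⁻ b in B ∩ D, ENNReal.ofReal (G (a, b)))
    {a b : E n} (ha : a ∈ D) (hb : b ∈ D) : G (a, b) ≤ F (a, b) := by
  by_contra hlt
  obtain ⟨M, hM1, hM2⟩ := exists_between (not_le.1 hlt)
  obtain ⟨N, hN1, hN2⟩ := exists_between hM2
  have hm : (a, b) ∈ D ×ˢ D := mk_mem_prod ha hb
  have hO : IsOpen (D ×ˢ D) := hD.prod hD
  have h1 : ∀ᶠ q in nhds (a, b), q ∈ D ×ˢ D ∧ F q < M ∧ N < G q :=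
    (hO.eventually_mem hm).and (((hF.continuousAt (hO.mem_nhds hm)).eventually_lt_const hM1).and
      ((hG.continuousAt (hO.mem_nhds hm)).eventually_const_lt hN2))
  obtain ⟨ε, hε, hball⟩ := Metric.eventually_nhds_iff_ball.1 h1
  set B := Metric.ball b ε with hBdef
  have hsub : ∀ a' ∈ Metric.ball a ε, ∀ b' ∈ B, (a', b') ∈ D ×ˢ D ∧ F (a', b') < M ∧
      N < G (a', b') := by
    intro a' ha' b' hb'
    apply hball
    rw [← ball_prod_same]
    exact mk_mem_prod ha' hb'
  have hBD : B ⊆ D := fun b' hb' => (hsub a (Metric.mem_ball_self hε) b' hb').1.2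
  have hae := h B measurableSet_ball
  obtain ⟨a', ha', hmem⟩ : ∃ a', (a' ∈ D → ∫⁻ b in B ∩ D, ENNReal.ofReal (F (a', b)) =
      ∫⁻ b in B ∩ D, ENNReal.ofReal (G (a', b))) ∧ a' ∈ Metric.ball a ε := by
    by_contra hcon
    push Not at hcon
    have h0 : volume (Metric.ball a ε) = 0 := by
      refine measure_mono_null (fun z hz => ?_) hae
      intro hQ
      exact hcon z hQ hz
    exact (Metric.measure_ball_pos volume a hε).ne' h0
  have heq := ha' (hsub a' hmem b (Metric.mem_ball_self hε)).1.1
  rw [inter_eq_left.2 hBD] at heq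
  have hv0 : volume B ≠ 0 := (Metric.measure_ball_pos volume b hε).ne'
  have hvt : volume B ≠ ∞ := measure_ball_lt_top.ne
  have hN0 : 0 < N := (hF0 _ hm).trans (hM1.trans hN1)
  have hl : ∫⁻ b in B, ENNReal.ofReal (F (a', b)) ≤ ENNReal.ofReal M * volume B := by
    rw [← setLIntegral_const]
    exact setLIntegral_mono' measurableSet_ball fun b' hb' =>
      ENNReal.ofReal_le_ofReal (hsub a' hmem b' hb').2.1.le
  have hr : ENNReal.ofReal N * volume B ≤ ∫⁻ b in B, ENNReal.ofReal (G (a', b)) := by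
    rw [← setLIntegral_const]
    exact setLIntegral_mono' measurableSet_ball fun b' hb' =>
      ENNReal.ofReal_le_ofReal (hsub a' hmem b' hb').2.2.le
  have : ENNReal.ofReal M * volume B < ENNReal.ofReal N * volume B :=
    (ENNReal.mul_lt_mul_iff_left hv0 hvt).2 ((ENNReal.ofReal_lt_ofReal_iff hN0).2 hN1)
  exact absurd (hr.trans (heq ▸ hl)) (not_le.2 this)

theorem invDensity_pos (hD : IsOpenCone D) (hp : IsSemigroupDensity D p) {x : E n}
    (hx : x ∈ D) {s t : ℝ} (hs : 0 < s) (hst : s < t) {q : E n × E n} (hq : q ∈ D ×ˢ D) :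
    0 < invDensity α p x s t q := by
  have ht : 0 < t := hs.trans hst
  have hlt : t⁻¹ < s⁻¹ := inv_strictAnti₀ hs hst
  have hsα : 0 < s ^ (-α) := Real.rpow_pos_of_pos hs _
  have htα : 0 < t ^ (-α) := Real.rpow_pos_of_pos ht _
  have h1 := hD.smul_mem _ hsα _ hq.1
  have h2 := hD.smul_mem _ htα _ hq.2
  have h3 := hp.pos t⁻¹ (by positivity) _ hx _ h2
  have h4 := hp.pos (s⁻¹ - t⁻¹) (by linarith) _ h2 _ h1
  have h5 := hp.pos s⁻¹ (by positivity) _ hx _ h1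
  unfold invDensity
  positivity

theorem continuousOn_invDensity (hD : IsOpenCone D) (hp : IsSemigroupDensity D p) {x : E n}
    (hx : x ∈ D) {s t : ℝ} (hs : 0 < s) (hst : s < t) :
    ContinuousOn (invDensity α p x s t) (D ×ˢ D) := by
  have ht : 0 < t := hs.trans hst
  have hlt : t⁻¹ < s⁻¹ := inv_strictAnti₀ hs hst
  have hsα : 0 < s ^ (-α) := Real.rpow_pos_of_pos hs _
  have htα : 0 < t ^ (-α) := Real.rpow_pos_of_pos ht _
  have c1 : ContinuousOn (fun q : E n × E n => p t⁻¹ x (t ^ (-α) • q.2)) (D ×ˢ D) :=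
    hp.continuousOn.comp (f := fun q : E n × E n => (t⁻¹, x, t ^ (-α) • q.2)) (by fun_prop)
      fun q hq => mem_spaceTime (by positivity) hx (hD.smul_mem _ htα _ hq.2)
  have c2 : ContinuousOn (fun q : E n × E n =>
      p (s⁻¹ - t⁻¹) (t ^ (-α) • q.2) (s ^ (-α) • q.1)) (D ×ˢ D) :=
    hp.continuousOn.comp
      (f := fun q : E n × E n => (s⁻¹ - t⁻¹, t ^ (-α) • q.2, s ^ (-α) • q.1)) (by fun_prop)
      fun q hq => mem_spaceTime (by linarith) (hD.smul_mem _ htα _ hq.2) (hD.smul_mem _ hsα _ hq.1)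
  have c3 : ContinuousOn (fun q : E n × E n => p s⁻¹ x (s ^ (-α) • q.1)) (D ×ˢ D) :=
    hp.continuousOn.comp (f := fun q : E n × E n => (s⁻¹, x, s ^ (-α) • q.1)) (by fun_prop)
      fun q hq => mem_spaceTime (by positivity) hx (hD.smul_mem _ hsα _ hq.1)
  exact (continuousOn_const.mul (c1.mul c2)).div c3 fun q hq =>
    (hp.pos s⁻¹ (by positivity) _ hx _ (hD.smul_mem _ hsα _ hq.1)).ne'

/-- The time-inversion property makes the inverted transition densities homogeneous in time. -/
theorem invDensity_eq_of_hasTimeInversion (hD : IsOpenCone D) (hP : IsMarkovProcess D p P)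
    (hT : HasTimeInversion D α P) {x a b : E n} (hx : x ∈ D) (ha : a ∈ D) (hb : b ∈ D)
    {s t s' t' : ℝ} (hs : 0 < s) (hst : s < t) (hs' : 0 < s') (hst' : s' < t')
    (hlag : t - s = t' - s') :
    invDensity α p x s t (a, b) = invDensity α p x s' t' (a, b) := by
  obtain ⟨κ, hκ, hmk⟩ := hT x hx
  have hk : IsMarkovKernel (κ (t - s)) := hκ _ (by linarith)
  -- Both pairs of times have the same lag, hence the same kernel, and each density represents it.
  have key : ∀ B : Set (E n), MeasurableSet B → ∀ᵐ a : E n, a ∈ D →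
      ∫⁻ b in B ∩ D, ENNReal.ofReal (invDensity α p x s t (a, b)) =
        ∫⁻ b in B ∩ D, ENNReal.ofReal (invDensity α p x s' t' (a, b)) := by
    intro B hB
    have h1 := ae_setLIntegral_invDensity hD hP hx (κ := κ (t - s)) hs hst hB
      fun A hA => hmk ⟨s, hs⟩ ⟨t, hs.trans hst⟩ hst A hA B hB
    have h2 := ae_setLIntegral_invDensity hD hP hx (κ := κ (t - s)) hs' hst' hB
      fun A hA => by
        rw [hlag]
        exact hmk ⟨s', hs'⟩ ⟨t', hs'.trans hst'⟩ hst' A hA B hB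
    filter_upwards [h1, h2] with a h1 h2 haD
    rw [h1 haD, h2 haD]
  have hc1 := continuousOn_invDensity (α := α) hD hP.density hx hs hst
  have hc2 := continuousOn_invDensity (α := α) hD hP.density hx hs' hst'
  refine le_antisymm ?_ ?_
  · exact le_of_ae_setLIntegral_eq hD.isOpen hc2 hc1
      (fun q hq => invDensity_pos hD hP.density hx hs' hst' hq)
      (fun B hB => (key B hB).mono fun a h haD => (h haD).symm) ha hb
  · exact le_of_ae_setLIntegral_eq hD.isOpen hc1 hc2
      (fun q hq => invDensity_pos hD hP.density hx hs hst hq) key ha hb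

theorem isInvHomogeneous_of_hasTimeInversion (hD : IsOpenCone D) (hP : IsMarkovProcess D p P)
    (hT : HasTimeInversion D α P) : IsInvHomogeneous D α (logDensity p) := by
  intro x hx a ha b hb u t t' hu ht ht'
  have key : ∀ t : ℝ, u < t → logInvDensity α (logDensity p) x a b u t =
      Real.log (invDensity α p x (t - u) t (a, b)) := by
    intro t ht
    have ht0 : 0 < t := hu.trans ht
    have hs : 0 < t - u := by linarith
    have hlt : t⁻¹ < (t - u)⁻¹ := inv_strictAnti₀ hs (by linarith)
    have h1 := hD.smul_mem _ (Real.rpow_pos_of_pos hs (-α)) _ ha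
    have h2 := hD.smul_mem _ (Real.rpow_pos_of_pos ht0 (-α)) _ hb
    have h3 := hP.density.pos t⁻¹ (by positivity) _ hx _ h2
    have h4 := hP.density.pos ((t - u)⁻¹ - t⁻¹) (by linarith) _ h2 _ h1
    have h5 := hP.density.pos (t - u)⁻¹ (by positivity) _ hx _ h1
    have h6 : (t ^ (-α)) ^ n ≠ 0 := by positivity
    rw [logInvDensity, invDensity, Real.log_div (by positivity) h5.ne',
      Real.log_mul h6 (by positivity), Real.log_mul h3.ne' h4.ne', Real.log_pow,
      Real.log_rpow ht0]
    simp only [logDensity]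
    ring
  rw [key t ht, key t' ht', invDensity_eq_of_hasTimeInversion hD hP hT hx ha hb
    (s := t - u) (t := t) (s' := t' - u) (t' := t') (by linarith)
    (by linarith) (by linarith) (by linarith) (by ring)]

end Inversion

/-! ### Kolmogorov's extension theorem -/

section Kolmogorov

open Filter Topology

variable {ι X : Type} [TopologicalSpace X] [PolishSpace X] [MeasurableSpace X] [BorelSpace X]
  [Nonempty X] {P : ∀ J : Finset ι, Measure (∀ _ : J, X)}

/-- Compactness argument: each cylinder is replaced by one with compact base, with total loss below
the infimum ε of the contents. The compact cylinders then have the finite intersection property, and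
a limit along an ultrafilter lies in every A n. -/
theorem projectiveFamilyContent_tendsto_zero [∀ J, IsFiniteMeasure (P J)]
    (hP : IsProjectiveMeasureFamily P) {A : ℕ → Set (ι → X)}
    (hA : ∀ n, A n ∈ measurableCylinders fun _ : ι => X) (hanti : Antitone A)
    (hinter : ⋂ n, A n = ∅) :
    Tendsto (fun n => projectiveFamilyContent hP (A n)) atTop (𝓝 0) := by
  set m := projectiveFamilyContent hP with hm
  have hmono : Antitone fun n => m (A n) := fun i j hij =>
    projectiveFamilyContent_mono hP (hA j) (hA i) (hanti hij)
  have hlim := tendsto_atTop_iInf hmono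
  suffices h0 : ⨅ n, m (A n) = 0 by rwa [h0] at hlim
  by_contra hne
  set ε := ⨅ n, m (A n) with hε
  have hεle : ∀ n, ε ≤ m (A n) := fun n => iInf_le _ n
  have hεtop : ε ≠ ∞ := ne_top_of_le_ne_top (projectiveFamilyContent_ne_top hP) (hεle 0)
  obtain ⟨δ, hδpos, hδsum⟩ := ENNReal.exists_pos_sum_of_countable hne ℕ
  choose s S hS hAS using fun n => (mem_measurableCylinders (A n)).1 (hA n)
  have hK : ∀ n, ∃ K ⊆ S n, IsCompact K ∧ P (s n) (S n \ K) < δ n := fun n =>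
    (hS n).exists_isCompact_sdiff_lt (measure_ne_top _ _) (by exact_mod_cast (hδpos n).ne')
  choose K hKS hKc hKlt using hK
  set C : ℕ → Set (ι → X) := fun n => cylinder (s n) (K n) with hC
  have hCm : ∀ n, C n ∈ measurableCylinders fun _ : ι => X := fun n =>
    cylinder_mem_measurableCylinders _ _ (hKc n).measurableSet
  have hdiff : ∀ n, m (A n \ C n) < δ n := by
    intro n
    have : A n \ C n = cylinder (s n) (S n \ K n) := by rw [hAS n, hC, sdiff_cylinder_same]
    rw [this, hm, projectiveFamilyContent_cylinder hP ((hS n).diff (hKc n).measurableSet)]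
    exact hKlt n
  have hne' : ∀ n, (⋂ k ∈ Finset.range (n + 1), C k).Nonempty := by
    intro n
    by_contra hemp
    rw [not_nonempty_iff_eq_empty] at hemp
    have hsub : A n ⊆ ⋃ k ∈ Finset.range (n + 1), (A k \ C k) := by
      intro ω hω
      by_contra hcon
      have : ω ∈ ⋂ k ∈ Finset.range (n + 1), C k := by
        simp only [mem_iInter]
        intro k hk
        by_contra hk'
        refine hcon (mem_biUnion hk ⟨hanti (Nat.lt_succ_iff.1 (Finset.mem_range.1 hk)) hω, hk'⟩)
      rw [hemp] at this
      exact this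
    have hdm : ∀ k, A k \ C k ∈ measurableCylinders fun _ : ι => X := fun k =>
      sdiff_mem_measurableCylinders (hA k) (hCm k)
    have h1 : m (A n) ≤ ∑ k ∈ Finset.range (n + 1), m (A k \ C k) :=
      (projectiveFamilyContent_mono hP (hA n)
        (isSetRing_measurableCylinders.biUnion_mem _ fun k _ => hdm k) hsub).trans
        (addContent_biUnion_le isSetRing_measurableCylinders fun k _ => hdm k)
    have h2 : ∑ k ∈ Finset.range (n + 1), m (A k \ C k) ≤ ∑' k, (δ k : ℝ≥0∞) :=
      (Finset.sum_le_sum fun k _ => (hdiff k).le).trans (ENNReal.sum_le_tsum _)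
    exact absurd ((hεle n).trans (h1.trans h2)) (not_le.2 hδsum)
  choose x hx using hne'
  have hxK : ∀ k, ∀ᶠ n in (hyperfilter ℕ : Filter ℕ), (s k).restrict (x n) ∈ K k := by
    intro k
    have : ∀ᶠ n in atTop, (s k).restrict (x n) ∈ K k := by
      filter_upwards [eventually_ge_atTop k] with n hn
      have := hx n
      simp only [mem_iInter] at this
      exact this k (Finset.mem_range.2 (Nat.lt_succ_iff.2 hn))
    rw [← Nat.cofinite_eq_atTop] at this
    exact this.filter_mono (hyperfilter_le_cofinite (α := ℕ))
  have hw : ∀ k, ∃ w ∈ K k, Tendsto (fun n => (s k).restrict (x n)) (hyperfilter ℕ) (𝓝 w) := by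
    intro k
    have := (hKc k).ultrafilter_le_nhds ((hyperfilter ℕ).map fun n => (s k).restrict (x n))
      (le_principal_iff.2 (hxK k))
    exact this
  choose w hwK hwlim using hw
  -- Coordinates outside every s k may fail to converge; `lim` is then arbitrary, and no A n depends
  -- on them.
  set z : ι → X := fun i => lim ((hyperfilter ℕ : Filter ℕ).map fun n => x n i) with hz
  have hzw : ∀ k, (s k).restrict z = w k := by
    intro k
    ext i
    have := (tendsto_pi_nhds.1 (hwlim k)) i
    exact this.limUnder_eq
  have : z ∈ ⋂ n, A n := by
    refine mem_iInter.2 fun k => ?_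
    rw [hAS k, mem_cylinder]
    rw [hzw k]
    exact hKS k (hwK k)
  rw [hinter] at this
  exact this

/-- Kolmogorov's extension theorem for Polish spaces. -/
theorem exists_isProjectiveLimit [∀ J, IsFiniteMeasure (P J)]
    (hP : IsProjectiveMeasureFamily (α := fun _ : ι => X) P) :
    ∃ μ : Measure (ι → X), IsProjectiveLimit (α := fun _ : ι => X) μ P := by
  have hσ : (projectiveFamilyContent hP).IsSigmaSubadditive := by
    refine isSigmaSubadditive_of_addContent_iUnion_eq_tsum
      isSetRing_measurableCylinders (fun f hf hf_Union hf' => ?_)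
    exact addContent_iUnion_eq_sum_of_tendsto_zero isSetRing_measurableCylinders
      (projectiveFamilyContent hP) (fun s hs => projectiveFamilyContent_ne_top _)
      (fun _ => projectiveFamilyContent_tendsto_zero hP) hf hf_Union hf'
  refine ⟨(projectiveFamilyContent hP).measure isSetSemiring_measurableCylinders
    generateFrom_measurableCylinders.ge hσ, fun I => ?_⟩
  ext S hS
  rw [Measure.map_apply (Finset.measurable_restrict I) hS, AddContent.measure_eq, ← cylinder,
    projectiveFamilyContent_cylinder hP hS]
  · exact generateFrom_measurableCylinders.symm
  · exact cylinder_mem_measurableCylinders _ _ hS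

end Kolmogorov

/-! ### Events depending on a set of times -/

section Events

variable {n : ℕ}

/-- The σ-algebra of path events that depend on the times in `Δ`. -/
abbrev events (n : ℕ) (Δ : Set ℝ≥0) : MeasurableSpace (Path n) :=
  cylinderEvents (X := fun _ : ℝ≥0 => E n) Δ

theorem events_le (Δ : Set ℝ≥0) : events n Δ ≤ MeasurableSpace.pi := cylinderEvents_le_pi

theorem events_eq_comap (Δ : Set ℝ≥0) :
    events n Δ = MeasurableSpace.comap (fun (ω : Path n) (i : Δ) => ω i) MeasurableSpace.pi := by
  simp only [events, cylinderEvents, MeasurableSpace.pi, MeasurableSpace.comap_iSup,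
    MeasurableSpace.comap_comp, Function.comp_def, iSup_subtype]

theorem past_eq_events (s : ℝ≥0) : (past s : MeasurableSpace (Path n)) = events n (Iic s) := by
  rw [events_eq_comap]; rfl

theorem measurable_eval_events {Δ : Set ℝ≥0} {t : ℝ≥0} (h : t ∈ Δ) :
    Measurable[events n Δ] fun ω : Path n => ω t :=
  measurable_cylinderEvent_apply (X := fun _ : ℝ≥0 => E n) h

theorem mem_iff_of_events {Δ : Set ℝ≥0} {A : Set (Path n)} (hA : MeasurableSet[events n Δ] A)
    {ω ω' : Path n} (h : ∀ i ∈ Δ, ω i = ω' i) : ω ∈ A ↔ ω' ∈ A := by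
  rw [events_eq_comap] at hA
  obtain ⟨S, -, rfl⟩ := hA
  have : (fun i : Δ => ω i) = fun i : Δ => ω' i := funext fun i => h i i.2
  simp only [mem_preimage, this]

theorem measure_eq_on_events {μ ν : Measure (Path n)} [IsFiniteMeasure μ] {Δ : Set ℝ≥0}
    (h : ∀ F : Finset ℝ≥0, ↑F ⊆ Δ → ∀ A, MeasurableSet[events n F] A → μ A = ν A)
    {A : Set (Path n)} (hA : MeasurableSet[events n Δ] A) : μ A = ν A := by
  let m : ℝ≥0 → MeasurableSpace (Path n) := fun i =>
    MeasurableSpace.comap (fun ω : Path n => ω i) inferInstance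
  have hgen : events n Δ =
      MeasurableSpace.generateFrom (piiUnionInter (fun i => {s | MeasurableSet[m i] s}) Δ) :=
    (generateFrom_piiUnionInter_measurableSet m Δ).symm
  have hpi : IsPiSystem (piiUnionInter (fun i => {s | MeasurableSet[m i] s}) Δ) :=
    isPiSystem_piiUnionInter _ (fun i => (m i).isPiSystem_measurableSet) Δ
  have huniv : μ univ = ν univ := h ∅ (by simp) univ MeasurableSet.univ
  have hle := events_le (n := n) Δ
  have : IsFiniteMeasure ν := ⟨huniv ▸ measure_lt_top μ univ⟩
  have hm : ∀ A ∈ piiUnionInter (fun i => {s | MeasurableSet[m i] s}) Δ, μ A = ν A := by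
    rintro A ⟨F, hF, f, hf, rfl⟩
    refine h F hF _ (F.measurableSet_biInter fun i hi => ?_)
    have hmi : m i ≤ events n F := le_iSup₂_of_le (f := fun i _ => m i) i hi le_rfl
    exact hmi _ (hf i hi)
  induction A, hA using MeasurableSpace.induction_on_inter hgen hpi with
  | empty => simp
  | basic A hA => exact hm A hA
  | compl A hA ih =>
    rw [measure_compl (hle _ hA) (measure_ne_top _ _), measure_compl (hle _ hA)
      (measure_ne_top _ _), ih, huniv]
  | iUnion f hd hf ih =>
    rw [measure_iUnion hd fun i => hle _ (hf i), measure_iUnion hd fun i => hle _ (hf i)]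
    simp only [ih]

theorem setLIntegral_eq_of_measure_eq {Ω : Type} {m m0 : MeasurableSpace Ω} (hm : m ≤ m0)
    {μ ν : Measure Ω} (h : ∀ A, MeasurableSet[m] A → μ A = ν A) {f : Ω → ℝ≥0∞}
    (hf : Measurable[m] f) {A : Set Ω} (hA : MeasurableSet[m] A) :
    ∫⁻ ω in A, f ω ∂μ = ∫⁻ ω in A, f ω ∂ν := by
  have htrim : μ.trim hm = ν.trim hm := by
    refine @Measure.ext _ m _ _ fun B hB => ?_
    rw [trim_measurableSet_eq hm hB, trim_measurableSet_eq hm hB, h B hB]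
  have hi : Measurable[m] (A.indicator f) := hf.indicator hA
  rw [← lintegral_indicator (hm _ hA), ← lintegral_indicator (hm _ hA), ← lintegral_trim hm hi,
    ← lintegral_trim hm hi, htrim]

end Events

/-! ### Change of measure and uniqueness for Markov laws -/

section MarkovAt

variable {n : ℕ} {K L : ℝ≥0 → Kernel (E n) (E n)} {x : E n} {J : Set ℝ≥0} {μ ν : Measure (Path n)}

/-- Under `μ`, the coordinate process observed at the times in `J` starts at `x` and is Markov with
the transition kernels `K`. -/
structure IsMarkovAt (K : ℝ≥0 → Kernel (E n) (E n)) (x : E n) (J : Set ℝ≥0)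
    (μ : Measure (Path n)) : Prop where
  prob : IsProbabilityMeasure μ
  start : ∀ᵐ ω ∂μ, ω 0 = x
  markov : ∀ s ∈ J, ∀ t ∈ J, s < t → ∀ A, MeasurableSet[events n (J ∩ Iic s)] A →
    ∀ B : Set (E n), MeasurableSet B →
      μ (A ∩ {ω | ω t ∈ B}) = ∫⁻ ω in A, K (t - s) (ω s) B ∂μ

theorem IsMarkovAt.mono {J' : Set ℝ≥0} (h : IsMarkovAt K x J' μ) (hJ : J ⊆ J') :
    IsMarkovAt K x J μ where
  prob := h.prob
  start := h.start
  markov s hs t ht hst A hA B hB := h.markov s (hJ hs) t (hJ ht) hst A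
    (cylinderEvents_mono (inter_subset_inter_left _ hJ) _ hA) B hB

theorem IsMarkovAt.setLIntegral (h : IsMarkovAt K x J μ) {s t : ℝ≥0} (hs : s ∈ J) (ht : t ∈ J)
    (hst : s < t) {A : Set (Path n)} (hA : MeasurableSet[events n (J ∩ Iic s)] A)
    {f : E n → ℝ≥0∞} (hf : Measurable f) :
    ∫⁻ ω in A, f (ω t) ∂μ = ∫⁻ ω in A, (∫⁻ y, f y ∂(K (t - s) (ω s))) ∂μ := by
  have hAm : MeasurableSet A := events_le _ _ hA
  have hlaw : (μ.restrict A).map (fun ω => ω t) =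
      (μ.restrict A).bind fun ω => K (t - s) (ω s) := by
    ext B hB
    rw [Measure.map_apply (measurable_pi_apply t) hB, Measure.restrict_apply
      (measurable_pi_apply t hB), inter_comm, Measure.bind_apply hB]
    · exact h.markov s hs t ht hst A hA B hB
    · exact ((K (t - s)).measurable.comp (measurable_pi_apply s)).aemeasurable
  rw [← lintegral_map (g := fun ω : Path n => ω t) hf (measurable_pi_apply t), hlaw,
    Measure.lintegral_bind _ hf.aemeasurable]
  exact ((K (t - s)).measurable.comp (measurable_pi_apply s)).aemeasurable

/-- The change of measure between two Markov processes whose kernels are related by the weights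
`w`. -/
theorem IsMarkovAt.measure_eq {D : Set (E n)} {w : ℝ≥0 → E n → ℝ≥0∞}
    [∀ t, IsMarkovKernel (K t)]
    (hμ : IsMarkovAt K x J μ) (hν : IsMarkovAt L x J ν) (h0 : 0 ∈ J)
    (hw : ∀ t, Measurable (w t)) (hw0 : w 0 x = 1) (hD : ∀ t ∈ J, ∀ᵐ ω ∂ν, ω t ∈ D)
    (hKL : ∀ s t : ℝ≥0, s < t → ∀ y ∈ D, ∀ B, MeasurableSet B →
      ∫⁻ z in B, w t z ∂(L (t - s) y) = w s y * K (t - s) y B)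
    {t : ℝ≥0} (ht : t ∈ J) {A : Set (Path n)} (hA : MeasurableSet[events n (J ∩ Iic t)] A) :
    μ A = ∫⁻ ω in A, w t (ω t) ∂ν := by
  have := hμ.prob
  have := hν.prob
  have hstep : ∀ s ∈ J, ∀ t ∈ J, s < t → ∀ A, MeasurableSet[events n (J ∩ Iic s)] A →
      ∀ B : Set (E n), MeasurableSet B → ∫⁻ ω in A ∩ {ω | ω t ∈ B}, w t (ω t) ∂ν =
        ∫⁻ ω in A, w s (ω s) * K (t - s) (ω s) B ∂ν := by
    intro s hs t ht hst A hA B hB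
    have hAm : MeasurableSet A := events_le _ _ hA
    have hBm : MeasurableSet {ω : Path n | ω t ∈ B} :=
      measurable_pi_apply (X := fun _ : ℝ≥0 => E n) t hB
    have h1 := hν.setLIntegral hs ht hst hA ((hw t).indicator hB)
    rw [inter_comm, ← Measure.restrict_restrict hBm, ← lintegral_indicator hBm]
    refine h1.trans (lintegral_congr_ae (ae_restrict_of_ae ?_))
    filter_upwards [hD s hs] with ω hω
    rw [lintegral_indicator hB, hKL s t hst _ hω B hB]
  -- The weights form a martingale under ν, so an event of the past may be weighted at any later
  -- time.
  have hcons : ∀ s ∈ J, ∀ t ∈ J, s ≤ t → ∀ A, MeasurableSet[events n (J ∩ Iic s)] A →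
      ∫⁻ ω in A, w t (ω t) ∂ν = ∫⁻ ω in A, w s (ω s) ∂ν := by
    intro s hs t ht hst A hA
    rcases eq_or_lt_of_le hst with rfl | hst
    · rfl
    · have := hstep s hs t ht hst A hA univ MeasurableSet.univ
      simpa using this
  -- the claim for finite sets of times
  have hbase : ∀ A, MeasurableSet[events n ({0} : Set ℝ≥0)] A →
      μ A = ∫⁻ ω in A, w 0 (ω 0) ∂ν := by
    intro A hA
    have hAm : MeasurableSet A := events_le _ _ hA
    -- An event of time 0 is almost surely decided by the constant path x, under either law.
    have hconst : ∀ ρ : Measure (Path n), (∀ᵐ ω ∂ρ, ω 0 = x) →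
        ∀ᵐ ω ∂ρ, (ω ∈ A ↔ (fun _ : ℝ≥0 => x) ∈ A) := by
      intro ρ hρ
      filter_upwards [hρ] with ω hω
      exact mem_iff_of_events hA fun i hi => by rw [mem_singleton_iff.1 hi, hω]
    have hone : ∫⁻ ω in A, w 0 (ω 0) ∂ν = ν A := by
      rw [← setLIntegral_one]
      refine lintegral_congr_ae (ae_restrict_of_ae ?_)
      filter_upwards [hν.start] with ω hω
      rw [hω, hw0]
    rw [hone]
    by_cases hx : (fun _ : ℝ≥0 => x) ∈ A
    · have h1 : ∀ᵐ ω ∂μ, ω ∈ A := (hconst μ hμ.start).mono fun ω h => h.2 hx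
      have h2 : ∀ᵐ ω ∂ν, ω ∈ A := (hconst ν hν.start).mono fun ω h => h.2 hx
      rw [prob_compl_eq_zero_iff hAm |>.1 h1, prob_compl_eq_zero_iff hAm |>.1 h2]
    · have h1 : ∀ᵐ ω ∂μ, ω ∉ A := (hconst μ hμ.start).mono fun ω h h' => hx (h.1 h')
      have h2 : ∀ᵐ ω ∂ν, ω ∉ A := (hconst ν hν.start).mono fun ω h h' => hx (h.1 h')
      rw [measure_eq_zero_iff_ae_notMem.2 h1, measure_eq_zero_iff_ae_notMem.2 h2]
  -- Induction on the largest time: the claim for the previous times, at the weight of their maximum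
  -- s, combines with one Markov step from s to a. Time 0 is kept in the set so that this s exists.
  have hfin : ∀ F : Finset ℝ≥0, ↑F ⊆ J → ∀ t ∈ J, (∀ i ∈ insert 0 F, i ≤ t) →
      ∀ A, MeasurableSet[events n (insert 0 F : Finset ℝ≥0)] A →
        μ A = ∫⁻ ω in A, w t (ω t) ∂ν := by
    intro F
    induction F using Finset.induction_on_max with
    | empty =>
      intro _ t ht _ A hA
      have hA0 : MeasurableSet[events n ({0} : Set ℝ≥0)] A := cylinderEvents_mono (by simp) _ hA
      rw [hbase A hA0, hcons 0 h0 t ht zero_le]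
      exact cylinderEvents_mono (by simpa using h0) _ hA0
    | insert a F hmax ih =>
      intro hFJ t ht hle A hA
      have haJ : a ∈ J := hFJ (by simp)
      have hFJ' : ↑F ⊆ J := fun i hi => hFJ (by simp [Finset.mem_coe.1 hi])
      have hat : a ≤ t := hle a (by simp)
      rcases eq_or_lt_of_le (zero_le (a := a)) with rfl | ha
      · refine ih hFJ' t ht (fun i hi => hle i ?_) A ?_
        · simp only [Finset.mem_insert] at hi ⊢; tauto
        · exact cylinderEvents_mono (by simp) _ hA
      set G := insert 0 F with hG
      have hGa : ∀ i ∈ G, i < a := by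
        intro i hi
        rcases Finset.mem_insert.1 hi with rfl | hi
        · exact ha
        · exact hmax i hi
      have hGJ : ∀ i ∈ G, i ∈ J := by
        intro i hi
        rcases Finset.mem_insert.1 hi with rfl | hi
        · exact h0
        · exact hFJ' hi
      have hGne : G.Nonempty := ⟨0, by simp [hG]⟩
      set s := G.max' hGne with hs
      have hsG : s ∈ G := G.max'_mem hGne
      have hsle : ∀ i ∈ G, i ≤ s := fun i hi => G.le_max' i hi
      have hGs : (G : Set ℝ≥0) ⊆ J ∩ Iic s := fun i hi => ⟨hGJ i hi, hsle i hi⟩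
      have hins : (insert 0 (insert a F) : Finset ℝ≥0) = insert a G := by
        rw [hG, Finset.insert_comm]
      rw [hins] at hA
      have haG : ((insert a G : Finset ℝ≥0) : Set ℝ≥0) ⊆ J ∩ Iic a := by
        intro i hi
        rcases Finset.mem_insert.1 (Finset.mem_coe.1 hi) with rfl | hi
        · exact ⟨haJ, mem_Iic.2 le_rfl⟩
        · exact ⟨hGJ i hi, mem_Iic.2 (hGa i hi).le⟩
      rw [hcons a haJ t ht hat A (cylinderEvents_mono haG _ hA)]
      -- equality on products
      have hprod : ∀ A', MeasurableSet[events n G] A' → ∀ B : Set (E n), MeasurableSet B →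
          μ (A' ∩ {ω | ω a ∈ B}) = ∫⁻ ω in A' ∩ {ω | ω a ∈ B}, w a (ω a) ∂ν := by
        intro A' hA' B hB
        have hA'' := cylinderEvents_mono hGs _ hA'
        have hws : Measurable fun ω : Path n => w s (ω s) := (hw s).comp (measurable_pi_apply s)
        have hKm : Measurable[events n G] fun ω : Path n => K (a - s) (ω s) B :=
          ((K (a - s)).measurable_coe hB).comp (measurable_eval_events hsG)
        have hKm' : Measurable fun ω : Path n => K (a - s) (ω s) B :=
          hKm.mono (events_le _) le_rfl
        rw [hμ.markov s (hGJ s hsG) a haJ (hGa s hsG) A' hA'' B hB,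
          hstep s (hGJ s hsG) a haJ (hGa s hsG) A' hA'' B hB]
        have hih := setLIntegral_eq_of_measure_eq (events_le (n := n) (G : Set ℝ≥0)) (μ := μ)
          (ν := ν.withDensity fun ω => w s (ω s)) (fun C hC => by
            rw [withDensity_apply _ (events_le _ _ hC)]
            exact ih hFJ' s (hGJ s hsG) hsle C hC) hKm hA'
        rw [hih, setLIntegral_withDensity_eq_setLIntegral_mul _ hws hKm' (events_le _ _ hA')]
        rfl
      let φ : Path n → (G → E n) × E n := fun ω => (fun i => ω i, ω a)
      have hφ : Measurable φ := (measurable_pi_lambda _ fun i => measurable_pi_apply _).prodMk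
        (measurable_pi_apply a)
      have hwa : Measurable fun ω : Path n => w a (ω a) := (hw a).comp (measurable_pi_apply a)
      have hmap : μ.map φ = (ν.withDensity fun ω => w a (ω a)).map φ := by
        have := Measure.isFiniteMeasure_map μ φ
        refine Measure.ext_prod fun {S B} hS hB => ?_
        rw [Measure.map_apply hφ (hS.prod hB), Measure.map_apply hφ (hS.prod hB),
          withDensity_apply _ (hφ (hS.prod hB))]
        refine hprod ((fun (ω : Path n) (i : G) => ω i) ⁻¹' S) ?_ B hB
        have hGe := events_eq_comap (n := n) (G : Set ℝ≥0)
        rw [hGe]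
        exact ⟨S, hS, rfl⟩
      have hle' : events n ((insert a G : Finset ℝ≥0) : Set ℝ≥0) ≤
          MeasurableSpace.comap φ inferInstance := by
        refine iSup₂_le fun i hi => ?_
        rw [← measurable_iff_comap_le]
        rcases Finset.mem_insert.1 (Finset.mem_coe.1 hi) with rfl | hi
        · exact measurable_snd.comp (comap_measurable φ)
        · exact ((measurable_pi_apply (⟨i, hi⟩ : G)).comp measurable_fst).comp (comap_measurable φ)
      obtain ⟨S, hS, rfl⟩ := hle' _ hA
      rw [← Measure.map_apply hφ hS, hmap, Measure.map_apply hφ hS, withDensity_apply _ (hφ hS)]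
  have hwt : Measurable fun ω : Path n => w t (ω t) := (hw t).comp (measurable_pi_apply t)
  rw [← withDensity_apply _ (events_le _ _ hA)]
  refine measure_eq_on_events (Δ := J ∩ Iic t) (fun F hF A hA => ?_) hA
  rw [withDensity_apply _ (events_le _ _ hA)]
  refine hfin F (fun i hi => (hF hi).1) t ht (fun i hi => ?_) A
    (cylinderEvents_mono (by simp) _ hA)
  rcases Finset.mem_insert.1 hi with rfl | hi
  · exact zero_le
  · exact (hF hi).2

theorem IsMarkovAt.unique [∀ t, IsMarkovKernel (K t)] (hμ : IsMarkovAt K x J μ)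
    (hν : IsMarkovAt K x J ν) (h0 : 0 ∈ J) {t : ℝ≥0} (ht : t ∈ J) {A : Set (Path n)}
    (hA : MeasurableSet[events n (J ∩ Iic t)] A) : μ A = ν A := by
  have := hμ.measure_eq (D := univ) (w := fun _ _ => 1) hν h0 (fun _ => measurable_const) rfl
    (fun _ _ => ae_of_all _ fun _ => mem_univ _) (fun s t _ y _ B hB => by simp) ht hA
  simpa using this

end MarkovAt

/-! ### Construction of Markov processes -/

section Existence

variable {n : ℕ} {K : ℝ≥0 → Kernel (E n) (E n)} {x : E n} {μ : Measure (Path n)}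

/-- The law obtained from `μ` by resampling the path at time `a` from `κ` started at its value at
time `s`. -/
noncomputable def resample (μ : Measure (Path n)) (κ : Kernel (E n) (E n)) (s a : ℝ≥0) :
    Measure (Path n) :=
  (μ ⊗ₘ (κ.comap (fun ω : Path n => ω s) (measurable_pi_apply s))).map
    fun q => Function.update q.1 a q.2

theorem measurable_resample_map (a : ℝ≥0) :
    Measurable fun q : Path n × E n => Function.update q.1 a q.2 := by
  refine measurable_pi_lambda _ fun i => ?_
  by_cases h : i = a
  · subst h; simpa using measurable_snd
  · have : (fun q : Path n × E n => Function.update q.1 a q.2 i) = fun q => q.1 i :=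
      funext fun q => Function.update_of_ne h _ _
    rw [this]
    exact (measurable_pi_apply (X := fun _ : ℝ≥0 => E n) i).comp measurable_fst

theorem lintegral_resample [IsProbabilityMeasure μ] (κ : Kernel (E n) (E n)) [IsMarkovKernel κ]
    (s a : ℝ≥0) {f : Path n → ℝ≥0∞} (hf : Measurable f) :
    ∫⁻ ω, f ω ∂(resample μ κ s a) =
      ∫⁻ ω, (∫⁻ y, f (Function.update ω a y) ∂(κ (ω s))) ∂μ := by
  have hm : Measurable fun q : Path n × E n => f (Function.update q.1 a q.2) :=
    hf.comp (measurable_resample_map a)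
  rw [resample, lintegral_map hf (measurable_resample_map a), Measure.lintegral_compProd hm]
  rfl

theorem lintegral_resample_of_events [IsProbabilityMeasure μ] (κ : Kernel (E n) (E n))
    [IsMarkovKernel κ] (s : ℝ≥0) {a : ℝ≥0} {f : Path n → ℝ≥0∞} (hf : Measurable f)
    (hfa : ∀ ω y, f (Function.update ω a y) = f ω) :
    ∫⁻ ω, f ω ∂(resample μ κ s a) = ∫⁻ ω, f ω ∂μ := by
  rw [lintegral_resample κ s a hf]
  simp [hfa]

theorem update_mem_iff {Δ : Set ℝ≥0} {a : ℝ≥0} (ha : a ∉ Δ) {A : Set (Path n)}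
    (hA : MeasurableSet[events n Δ] A) (ω : Path n) (y : E n) :
    Function.update ω a y ∈ A ↔ ω ∈ A :=
  mem_iff_of_events hA fun _ hi => Function.update_of_ne (ne_of_mem_of_not_mem hi ha) _ _

/-- Overwriting the coordinate a leaves all events of G unchanged, so the old Markov relations
persist. A relation from s' to a is the old one from s' to s followed by the resampling, and `hCK`
merges the two kernels. -/
theorem isMarkovAt_resample [∀ t, IsMarkovKernel (K t)]
    (hCK : ∀ s t : ℝ≥0, 0 < s → 0 < t → ∀ y B, MeasurableSet B →
      ∫⁻ z, K t z B ∂(K s y) = K (s + t) y B)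
    {G : Finset ℝ≥0} (h0 : 0 ∈ G) (hμ : IsMarkovAt K x G μ) {s a : ℝ≥0} (hs : s ∈ G)
    (hmax : ∀ i ∈ G, i ≤ s) (ha : s < a) :
    IsMarkovAt K x ((insert a G : Finset ℝ≥0) : Set ℝ≥0) (resample μ (K (a - s)) s a) := by
  have := hμ.prob
  have haG : ∀ i ∈ G, i ≠ a := fun i hi h => absurd (hmax i hi) (not_le.2 (h ▸ ha))
  have hset : ∀ A : Set (Path n), MeasurableSet A → (∀ ω y, Function.update ω a y ∈ A ↔ ω ∈ A) →
      ∀ f : Path n → ℝ≥0∞, Measurable f → (∀ ω y, f (Function.update ω a y) = f ω) →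
      ∫⁻ ω in A, f ω ∂(resample μ (K (a - s)) s a) = ∫⁻ ω in A, f ω ∂μ := by
    intro A hA hAa f hf hfa
    rw [← lintegral_indicator hA, ← lintegral_indicator hA]
    refine lintegral_resample_of_events _ s (hf.indicator hA) fun ω y => ?_
    by_cases hω : ω ∈ A
    · rw [indicator_of_mem hω, indicator_of_mem ((hAa ω y).2 hω), hfa]
    · rw [indicator_of_notMem hω, indicator_of_notMem fun h => hω ((hAa ω y).1 h)]
  have hev : ∀ i, i ≠ a → ∀ (ω : Path n) (y : E n), Function.update ω a y i = ω i :=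
    fun i hi ω y => Function.update_of_ne hi _ _
  refine ⟨?_, ?_, ?_⟩
  · rw [resample]
    exact Measure.isProbabilityMeasure_map (measurable_resample_map a).aemeasurable
  · have hm : MeasurableSet {ω : Path n | ¬ ω 0 = x} :=
      (measurable_pi_apply (X := fun _ : ℝ≥0 => E n) 0
        (measurableSet_singleton x)).compl
    rw [ae_iff, ← setLIntegral_one, hset _ hm (fun ω y => ?_) _ measurable_const fun _ _ => rfl,
      setLIntegral_one]
    · exact hμ.start
    · simp only [mem_ofPred_eq, hev 0 (haG 0 h0)]
  · intro s' hs' t' ht' hst A hA B hB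
    have hs'G : s' ∈ G := by
      rcases Finset.mem_insert.1 (Finset.mem_coe.1 hs') with rfl | h
      · rcases Finset.mem_insert.1 (Finset.mem_coe.1 ht') with rfl | h'
        · exact absurd hst (lt_irrefl _)
        · exact absurd ((hmax _ h').trans_lt ha) (not_lt.2 hst.le)
      · exact h
    have hA' : MeasurableSet[events n (↑G ∩ Iic s')] A := by
      refine cylinderEvents_mono (fun i hi => ?_) _ hA
      rcases Finset.mem_insert.1 (Finset.mem_coe.1 hi.1) with rfl | h
      · exact absurd (hi.2 : i ≤ s') (not_le.2 ((hmax s' hs'G).trans_lt ha))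
      · exact ⟨h, hi.2⟩
    have hAm : MeasurableSet A := events_le _ _ hA
    have hAa : ∀ ω y, Function.update ω a y ∈ A ↔ ω ∈ A :=
      update_mem_iff (fun h => haG a h.1 rfl) hA'
    have hKm : ∀ u v : ℝ≥0, Measurable fun ω : Path n => K u (ω v) B := fun u v =>
      ((K u).measurable_coe hB).comp (measurable_pi_apply v)
    have hR : ∫⁻ ω in A, K (t' - s') (ω s') B ∂(resample μ (K (a - s)) s a) =
        ∫⁻ ω in A, K (t' - s') (ω s') B ∂μ :=
      hset A hAm hAa _ (hKm _ _) fun ω y => by rw [hev s' (haG s' hs'G)]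
    rw [hR]
    rcases Finset.mem_insert.1 (Finset.mem_coe.1 ht') with rfl | ht'G
    · have hBm : MeasurableSet {ω : Path n | ω t' ∈ B} :=
        measurable_pi_apply (X := fun _ : ℝ≥0 => E n) t' hB
      have h1 : resample μ (K (t' - s)) s t' (A ∩ {ω | ω t' ∈ B}) =
          ∫⁻ ω in A, K (t' - s) (ω s) B ∂μ := by
        rw [← lintegral_indicator_one (hAm.inter hBm),
          lintegral_resample _ s t' (measurable_one.indicator (hAm.inter hBm)),
          ← lintegral_indicator hAm]
        refine lintegral_congr fun ω => ?_
        by_cases hω : ω ∈ A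
        · rw [indicator_of_mem hω, ← lintegral_indicator_one hB]
          refine lintegral_congr fun y => ?_
          have hy : Function.update ω t' y ∈ A ∩ {ω | ω t' ∈ B} ↔ y ∈ B := by
            simp only [mem_inter_iff, (hAa ω y).2 hω, true_and, mem_ofPred_eq,
              Function.update_self]
          by_cases hyB : y ∈ B
          · rw [indicator_of_mem hyB, indicator_of_mem (hy.2 hyB)]; rfl
          · rw [indicator_of_notMem hyB, indicator_of_notMem fun h => hyB (hy.1 h)]
        · rw [indicator_of_notMem hω, lintegral_eq_zero_of_ae_eq_zero]
          refine ae_of_all _ fun y => indicator_of_notMem (fun h => hω ((hAa ω y).1 h.1)) _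
      rw [h1]
      rcases eq_or_lt_of_le (hmax s' hs'G) with rfl | hlt
      · rfl
      · rw [hμ.setLIntegral (f := fun y => K (t' - s) y B) hs'G hs hlt hA'
          ((K (t' - s)).measurable_coe hB)]
        refine lintegral_congr fun ω => ?_
        rw [hCK _ _ (tsub_pos_of_lt hlt) (tsub_pos_of_lt ha) _ B hB, add_comm,
          tsub_add_tsub_cancel ha.le hlt.le]
    · have hBm : MeasurableSet {ω : Path n | ω t' ∈ B} :=
        measurable_pi_apply (X := fun _ : ℝ≥0 => E n) t' hB
      rw [← hμ.markov s' hs'G t' ht'G hst A hA' B hB, ← setLIntegral_one, ← setLIntegral_one]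
      refine hset _ (hAm.inter hBm) (fun ω y => ?_) _ measurable_const fun _ _ => rfl
      simp only [mem_inter_iff, hAa, mem_ofPred_eq, hev t' (haG t' ht'G)]

theorem exists_isMarkovAt_finset [∀ t, IsMarkovKernel (K t)]
    (hCK : ∀ s t : ℝ≥0, 0 < s → 0 < t → ∀ y B, MeasurableSet B →
      ∫⁻ z, K t z B ∂(K s y) = K (s + t) y B) (x : E n) (F : Finset ℝ≥0) :
    ∃ μ : Measure (Path n), IsMarkovAt K x ((insert 0 F : Finset ℝ≥0) : Set ℝ≥0) μ := by
  induction F using Finset.induction_on_max with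
  | empty =>
    refine ⟨Measure.dirac fun _ => x, inferInstance, ?_, ?_⟩
    · have hm : MeasurableSet {ω : Path n | ω 0 = x} :=
        measurable_pi_apply (X := fun _ : ℝ≥0 => E n) 0 (measurableSet_singleton x)
      rw [ae_dirac_iff hm]
    · intro s hs t ht hst
      simp only [insert_empty_eq, Finset.coe_singleton, mem_singleton_iff] at hs ht
      exact absurd hst (by simp [hs, ht])
  | insert a F hmax ih =>
    obtain ⟨μ, hμ⟩ := ih
    set G := insert 0 F with hG
    rcases eq_or_lt_of_le (zero_le (a := a)) with rfl | ha
    · exact ⟨μ, hμ.mono (by simp [hG])⟩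
    have hGne : G.Nonempty := ⟨0, by simp [hG]⟩
    have hsG := G.max'_mem hGne
    have hlt : G.max' hGne < a := by
      rcases Finset.mem_insert.1 hsG with h | h
      · rw [h]; exact ha
      · exact hmax _ h
    have hins : (insert 0 (insert a F) : Finset ℝ≥0) = insert a G := by
      rw [hG, Finset.insert_comm]
    rw [hins]
    exact ⟨_, isMarkovAt_resample hCK (by simp [hG]) hμ hsG (fun i hi => G.le_max' i hi) hlt⟩

/-- Every conservative semigroup of kernels has a Markov process. -/
theorem exists_isMarkovAt [∀ t, IsMarkovKernel (K t)]
    (hCK : ∀ s t : ℝ≥0, 0 < s → 0 < t → ∀ y B, MeasurableSet B →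
      ∫⁻ z, K t z B ∂(K s y) = K (s + t) y B) (x : E n) :
    ∃ μ : Measure (Path n), IsMarkovAt K x univ μ := by
  choose M hM using exists_isMarkovAt_finset hCK x
  have hprob : ∀ F, IsProbabilityMeasure (M F) := fun F => (hM F).prob
  -- Uniqueness on finite time sets makes the separately chosen laws consistent, hence a projective
  -- family.
  have huniq : ∀ (F : Finset ℝ≥0) {μ ν : Measure (Path n)},
      IsMarkovAt K x ((insert 0 F : Finset ℝ≥0) : Set ℝ≥0) μ →
      IsMarkovAt K x ((insert 0 F : Finset ℝ≥0) : Set ℝ≥0) ν →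
      ∀ A, MeasurableSet[events n F] A → μ A = ν A := by
    intro F μ ν hμ hν A hA
    have hne : (insert 0 F).Nonempty := ⟨0, by simp⟩
    refine hμ.unique hν (by simp) ((insert 0 F).max'_mem hne)
      (cylinderEvents_mono (fun i hi => ?_) _ hA)
    have : i ∈ insert 0 F := Finset.mem_insert_of_mem hi
    exact ⟨this, (insert 0 F).le_max' i this⟩
  have hrest : ∀ F : Finset ℝ≥0, Measurable (fun (ω : Path n) (i : F) => ω i) := fun F =>
    measurable_pi_lambda _ fun i => measurable_pi_apply _
  let Q : ∀ F : Finset ℝ≥0, Measure (∀ _ : F, E n) := fun F =>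
    (M F).map fun (ω : Path n) (i : F) => ω i
  have hQ : ∀ F, IsProbabilityMeasure (Q F) := fun F =>
    Measure.isProbabilityMeasure_map (hrest F).aemeasurable
  have hevents : ∀ (F : Finset ℝ≥0) (S : Set (∀ _ : F, E n)), MeasurableSet S →
      MeasurableSet[events n F] ((fun (ω : Path n) (i : F) => ω i) ⁻¹' S) := by
    intro F S hS
    have h := events_eq_comap (n := n) (F : Set ℝ≥0)
    rw [h]
    exact ⟨S, hS, rfl⟩
  have hproj : IsProjectiveMeasureFamily (α := fun _ : ℝ≥0 => E n) Q := by
    intro I F hFI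
    ext S hS
    have hr2 : Measurable (Finset.restrict₂ (π := fun _ : ℝ≥0 => E n) hFI) :=
      Finset.measurable_restrict₂ hFI
    rw [Measure.map_apply (hrest F) hS, Measure.map_apply hr2 hS,
      Measure.map_apply (hrest I) (hr2 hS)]
    refine huniq F (hM F) ((hM I).mono ?_) _ (hevents F S hS)
    exact_mod_cast Finset.insert_subset_insert 0 hFI
  obtain ⟨μ, hμ⟩ := exists_isProjectiveLimit hproj
  have hagree : ∀ (F : Finset ℝ≥0) A, MeasurableSet[events n F] A → μ A = M F A := by
    intro F A hA
    have h := events_eq_comap (n := n) (F : Set ℝ≥0)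
    rw [h] at hA
    obtain ⟨S, hS, rfl⟩ := hA
    have := congrArg (fun ρ => ρ S) (hμ F)
    simp only at this
    rw [Measure.map_apply (Finset.measurable_restrict F) hS, Measure.map_apply (hrest F) hS] at this
    exact this
  have hprobμ : IsProbabilityMeasure μ :=
    ⟨by rw [hagree ∅ univ MeasurableSet.univ, measure_univ]⟩
  refine ⟨μ, hprobμ, ?_, ?_⟩
  · have hm : MeasurableSet[events n ({0} : Finset ℝ≥0)] {ω : Path n | ¬ ω 0 = x} :=
      (measurable_eval_events (by simp) (measurableSet_singleton x)).compl
    rw [ae_iff, hagree {0} _ hm]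
    exact (hM {0}).start
  · intro s _ t _ hst A hA B hB
    rw [univ_inter] at hA
    have hBm : MeasurableSet {ω : Path n | ω t ∈ B} :=
      measurable_pi_apply (X := fun _ : ℝ≥0 => E n) t hB
    rw [← Measure.restrict_apply (events_le _ _ hA), ← withDensity_apply _ (events_le _ _ hA)]
    refine measure_eq_on_events (Δ := Iic s) (fun F hF A hA => ?_) hA
    rw [Measure.restrict_apply (events_le _ _ hA), withDensity_apply _ (events_le _ _ hA)]
    -- A finite set of past times, enlarged by s and t, reduces the Markov property of μ to that of
    -- one law M G.
    set G : Finset ℝ≥0 := insert s (insert t F) with hG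
    have hsG : s ∈ (G : Set ℝ≥0) := by simp [hG]
    have htG : t ∈ (G : Set ℝ≥0) := by simp [hG]
    have hFG : (F : Set ℝ≥0) ⊆ G := fun i hi => by simp [hG, Finset.mem_coe.1 hi]
    have hAG : MeasurableSet[events n G] A := cylinderEvents_mono hFG _ hA
    have hBG : MeasurableSet[events n G] {ω : Path n | ω t ∈ B} := measurable_eval_events htG hB
    have hG0 : (G : Set ℝ≥0) ⊆ ((insert 0 G : Finset ℝ≥0) : Set ℝ≥0) := by simp
    have hsub : (F : Set ℝ≥0) ⊆ ((insert 0 G : Finset ℝ≥0) : Set ℝ≥0) ∩ Iic s :=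
      fun i hi => ⟨hG0 (hFG hi), hF hi⟩
    rw [hagree G _ (hAG.inter hBG), (hM G).markov s (hG0 hsG) t (hG0 htG) hst A
      (cylinderEvents_mono hsub _ hA) B hB]
    exact (setLIntegral_eq_of_measure_eq (events_le _) (hagree G)
      (((K (t - s)).measurable_coe hB).comp (measurable_eval_events hsG)) hAG).symm

end Existence

/-! ### From densities to kernels and back -/

section TransitionKernel

variable {n : ℕ} {D : Set (E n)} {p : ℝ → E n → E n → ℝ} {P : E n → Measure (Path n)}

theorem measurable_extDensity_right (hD : MeasurableSet D) (hp : IsSemigroupDensity D p) {t : ℝ}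
    (ht : 0 < t) (x : E n) : Measurable fun y => extDensity D p t (x, y) :=
  (measurable_extDensity hD hp ht).comp measurable_prodMk_left

open Classical in
/-- The transition kernel at time `t` of the semigroup densities `p`, where the points outside `D`
do not move. -/
noncomputable def transKernel (hD : MeasurableSet D) (p : ℝ → E n → E n → ℝ) (t : ℝ≥0) :
    Kernel (E n) (E n) :=
  if 0 < t then Kernel.piecewise hD
    (Kernel.withDensity (Kernel.const (E n) volume) fun x y => extDensity D p t (x, y)) Kernel.id
  else Kernel.id

theorem transKernel_of_mem (hD : MeasurableSet D) (hp : IsSemigroupDensity D p) {t : ℝ≥0}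
    (ht : 0 < t) {x : E n} (hx : x ∈ D) :
    transKernel hD p t x = volume.withDensity fun y => extDensity D p t (x, y) := by
  classical
  have hm : Measurable (Function.uncurry fun x y => extDensity D p t (x, y)) :=
    measurable_extDensity hD hp (NNReal.coe_pos.2 ht)
  rw [transKernel, if_pos ht, Kernel.piecewise_apply, if_pos hx, Kernel.withDensity_apply _ hm,
    Kernel.const_apply]

theorem transKernel_zero (hD : MeasurableSet D) : transKernel hD p 0 = Kernel.id := by
  simp [transKernel]

theorem transKernel_of_notMem (hD : MeasurableSet D) {t : ℝ≥0} {x : E n} (hx : x ∉ D) :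
    transKernel hD p t x = Measure.dirac x := by
  classical
  rw [transKernel]
  split_ifs
  · rw [Kernel.piecewise_apply, if_neg hx, Kernel.id_apply]
  · rw [Kernel.id_apply]

theorem transKernel_apply (hD : MeasurableSet D) (hp : IsSemigroupDensity D p) {t : ℝ≥0}
    (ht : 0 < t) {x : E n} (hx : x ∈ D) {B : Set (E n)} (hB : MeasurableSet B) :
    transKernel hD p t x B = ∫⁻ y in B, extDensity D p t (x, y) := by
  rw [transKernel_of_mem hD hp ht hx, withDensity_apply _ hB]

theorem isMarkovKernel_transKernel (hD : MeasurableSet D) (hp : IsSemigroupDensity D p)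
    (hm : ∀ t : ℝ, 0 < t → ∀ x ∈ D, ∫⁻ y in D, ENNReal.ofReal (p t x y) = 1) (t : ℝ≥0) :
    IsMarkovKernel (transKernel hD p t) := by
  refine ⟨fun x => ⟨?_⟩⟩
  rcases eq_or_lt_of_le (zero_le (a := t)) with rfl | ht
  · rw [transKernel_zero, Kernel.id_apply]; simp
  by_cases hx : x ∈ D
  · rw [transKernel_apply hD hp ht hx MeasurableSet.univ,
      setLIntegral_extDensity hD hx MeasurableSet.univ, univ_inter, hm t ht x hx]
  · rw [transKernel_of_notMem hD hx]; simp

theorem lintegral_extDensity_mul (hD : MeasurableSet D) (hp : IsSemigroupDensity D p) {s t : ℝ}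
    (hs : 0 < s) (ht : 0 < t) {x : E n} (hx : x ∈ D) (y : E n) :
    ∫⁻ z, extDensity D p s (x, z) * extDensity D p t (z, y) = extDensity D p (s + t) (x, y) := by
  by_cases hy : y ∈ D
  · rw [extDensity_of_mem hx hy, ← hp.chapmanKolmogorov s t hs ht x hx y hy,
      ← lintegral_indicator hD]
    refine lintegral_congr fun z => ?_
    by_cases hz : z ∈ D
    · rw [indicator_of_mem hz, extDensity_of_mem hx hz, extDensity_of_mem hz hy,
        ENNReal.ofReal_mul (hp.pos s hs x hx z hz).le]
    · rw [indicator_of_notMem hz, extDensity_of_notMem hz, zero_mul]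
  · simp [extDensity_of_notMem hy]

theorem lintegral_transKernel (hD : MeasurableSet D) (hp : IsSemigroupDensity D p) {s t : ℝ≥0}
    (hs : 0 < s) (ht : 0 < t) (x : E n) {B : Set (E n)} (hB : MeasurableSet B) :
    ∫⁻ z, transKernel hD p t z B ∂(transKernel hD p s x) = transKernel hD p (s + t) x B := by
  by_cases hx : x ∈ D
  · have hs' : (0 : ℝ) < s := hs
    have ht' : (0 : ℝ) < t := ht
    have hms := measurable_extDensity hD hp hs'
    have hmt := measurable_extDensity hD hp ht'
    rw [transKernel_apply hD hp (add_pos hs ht) hx hB, transKernel_of_mem hD hp hs hx,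
      lintegral_withDensity_eq_lintegral_mul _ (measurable_extDensity_right hD hp hs' x)
        ((transKernel hD p t).measurable_coe hB)]
    have h1 : ∀ z, ((fun y => extDensity D p s (x, y)) * fun z => transKernel hD p t z B) z =
        ∫⁻ y in B, extDensity D p s (x, z) * extDensity D p t (z, y) := by
      intro z
      rw [lintegral_const_mul _ (measurable_extDensity_right hD hp ht' z), Pi.mul_apply]
      by_cases hz : z ∈ D
      · rw [transKernel_apply hD hp ht hz hB]
      · rw [extDensity_of_notMem hz, zero_mul, zero_mul]
    simp_rw [h1]
    rw [lintegral_lintegral_swap]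
    · refine lintegral_congr fun y => ?_
      rw [lintegral_extDensity_mul hD hp hs' ht' hx, NNReal.coe_add]
    · exact ((hms.comp (measurable_const.prodMk measurable_fst)).mul hmt).aemeasurable
  · rw [transKernel_of_notMem hD hx, transKernel_of_notMem hD hx,
      lintegral_dirac' _ ((transKernel hD p t).measurable_coe hB), transKernel_of_notMem hD hx]

theorem IsMarkovProcess.isMarkovAt (hD : MeasurableSet D) (hP : IsMarkovProcess D p P) {x : E n}
    (hx : x ∈ D) : IsMarkovAt (transKernel hD p) x univ (P x) where
  prob := hP.prob x hx
  start := hP.start x hx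
  markov s _ t _ hst A hA B hB := by
    have hpos : 0 < t - s := tsub_pos_of_lt hst
    rw [univ_inter, ← past_eq_events] at hA
    have h := hP.markov_ext hD hx s hpos hA hB
    rw [add_tsub_cancel_of_le hst.le] at h
    rw [h]
    refine lintegral_congr_ae (ae_restrict_of_ae ?_)
    filter_upwards [hP.ae_mem hD hx s] with ω hω
    rw [transKernel_apply hD hP.density hpos hω hB]

theorem isMarkovProcess_of_isMarkovAt (hD : MeasurableSet D) (hp : IsSemigroupDensity D p)
    (hm : ∀ t : ℝ, 0 < t → ∀ x ∈ D, ∫⁻ y in D, ENNReal.ofReal (p t x y) = 1)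
    (h : ∀ x ∈ D, IsMarkovAt (transKernel hD p) x univ (P x)) : IsMarkovProcess D p P where
  density := hp
  mass := hm
  prob x hx := (h x hx).prob
  start x hx := (h x hx).start
  markov x hx s t ht A hA B hB := by
    have := (h x hx).prob
    have hmem : ∀ᵐ ω ∂(P x), ω s ∈ D := by
      rcases eq_or_lt_of_le (zero_le (a := s)) with rfl | hs
      · filter_upwards [(h x hx).start] with ω hω
        rwa [hω]
      · have h0 := (h x hx).markov 0 (mem_univ _) s (mem_univ _) hs univ MeasurableSet.univ
          Dᶜ hD.compl
        rw [univ_inter, setLIntegral_univ, tsub_zero] at h0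
        rw [ae_iff]
        refine h0.trans ?_
        rw [lintegral_congr_ae (g := fun _ => 0), lintegral_zero]
        filter_upwards [(h x hx).start] with ω hω
        rw [hω, transKernel_apply hD hp hs hx hD.compl]
        exact setLIntegral_eq_zero hD.compl fun y hy => extDensity_of_notMem hy
    rw [past_eq_events, ← univ_inter (Iic s)] at hA
    rw [(h x hx).markov s (mem_univ _) (s + t) (mem_univ _) (lt_add_of_pos_right s ht) A hA B hB,
      add_tsub_cancel_left]
    refine lintegral_congr_ae (ae_restrict_of_ae ?_)
    filter_upwards [hmem] with ω hω
    rw [transKernel_apply hD hp ht hω hB, setLIntegral_extDensity hD hω hB]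

/-- Conservative semigroup densities are the transition densities of a Markov process. -/
theorem exists_isMarkovProcess (hD : MeasurableSet D) (hp : IsSemigroupDensity D p)
    (hm : ∀ t : ℝ, 0 < t → ∀ x ∈ D, ∫⁻ y in D, ENNReal.ofReal (p t x y) = 1) :
    ∃ P, IsMarkovProcess D p P := by
  have := isMarkovKernel_transKernel hD hp hm
  choose P hP using exists_isMarkovAt (K := transKernel hD p)
    fun s t hs ht y B hB => lintegral_transKernel hD hp hs ht y hB
  exact ⟨P, isMarkovProcess_of_isMarkovAt hD hp hm fun x _ => hP x⟩

end TransitionKernel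

/-! ### h-transforms and semi-stability of laws -/

section Transforms

variable {n : ℕ} {D : Set (E n)} {p r : ℝ → E n → E n → ℝ} {P Q : E n → Measure (Path n)}

/-- An instance of `IsMarkovAt.measure_eq` with the weight h(y)/h(x) exp(-νt), which is 1 at the
start; splitting exp(-νt) at s gives the required relation between the two kernels. -/
theorem isHTransform_of_density {h : E n → ℝ} {ν : ℝ} (hD : MeasurableSet D)
    (hP : IsMarkovProcess D p P) (hQ : IsMarkovProcess D r Q)
    (hh : IsDensityHTransform D h ν r p) : IsHTransform D h ν Q P where
  measurable := hh.measurable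
  pos := hh.pos
  density x hx t A hA := by
    have := isMarkovKernel_transKernel hD hP.density hP.mass
    have hm := hh.measurable
    rw [past_eq_events, ← univ_inter (Iic t)] at hA
    refine (hP.isMarkovAt hD hx).measure_eq (D := D)
      (w := fun t y => ENNReal.ofReal (h y / h x * Real.exp (-ν * t))) (hQ.isMarkovAt hD hx)
      (mem_univ _) (fun t => by fun_prop) ?_ (fun t _ => hQ.ae_mem hD hx t) ?_ (mem_univ t) hA
    · simp [div_self (hh.pos x hx).ne']
    · intro s t hst y hy B hB
      have hpos : 0 < t - s := tsub_pos_of_lt hst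
      have hpos' : (0 : ℝ) < (t - s : ℝ≥0) := hpos
      have hw : Measurable fun z => ENNReal.ofReal (h z / h x * Real.exp (-ν * t)) := by fun_prop
      rw [transKernel_of_mem hD hQ.density hpos hy, transKernel_apply hD hP.density hpos hy hB,
        setLIntegral_withDensity_eq_setLIntegral_mul _
          (measurable_extDensity_right hD hQ.density hpos' y) hw hB,
        ← lintegral_const_mul _ (measurable_extDensity_right hD hP.density hpos' y)]
      refine lintegral_congr fun z => ?_
      rw [Pi.mul_apply]
      by_cases hz : z ∈ D
      · have h1 := hh.pos x hx
        have h2 := hh.pos y hy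
        have h3 := hh.pos z hz
        have h4 := hQ.density.pos _ hpos' y hy z hz
        rw [extDensity_of_mem hy hz, extDensity_of_mem hy hz, hh.eq _ hpos' y hy z hz,
          ← ENNReal.ofReal_mul h4.le, ← ENNReal.ofReal_mul (by positivity)]
        congr 1
        have he : Real.exp (-ν * t) = Real.exp (-ν * s) * Real.exp (-ν * (t - s : ℝ≥0)) := by
          rw [← Real.exp_add, NNReal.coe_sub hst.le]
          congr 1
          ring
        rw [he]
        field_simp
      · rw [extDensity_of_notMem hz, extDensity_of_notMem hz, zero_mul, mul_zero]

theorem measurable_events_of_eval {Δ Δ' : Set ℝ≥0} {φ : Path n → Path n}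
    (h : ∀ i ∈ Δ', Measurable[events n Δ] fun ω => φ ω i) :
    Measurable[events n Δ, events n Δ'] φ := by
  rw [measurable_iff_comap_le]
  simp only [events, cylinderEvents, MeasurableSpace.comap_iSup, MeasurableSpace.comap_comp]
  exact iSup₂_le fun i hi => (h i hi).comap_le

theorem IsMarkovAt.map {K K' : ℝ≥0 → Kernel (E n) (E n)} {x : E n} {μ : Measure (Path n)}
    (h : IsMarkovAt K x univ μ) {c : ℝ≥0} (hc : 0 < c) (a : ℝ)
    (hK : ∀ u y B, MeasurableSet B → K' u (a • y) B = K (c * u) y ((a • ·) ⁻¹' B)) :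
    IsMarkovAt K' (a • x) univ (μ.map fun ω t => a • ω (c * t)) := by
  have := h.prob
  have hφ : Measurable fun (ω : Path n) (t : ℝ≥0) => a • ω (c * t) :=
    measurable_pi_lambda _ fun t => (measurable_const_smul a).comp (measurable_pi_apply _)
  have hφe : ∀ s, Measurable[events n (Iic (c * s)), events n (Iic s)]
      fun (ω : Path n) (t : ℝ≥0) => a • ω (c * t) := fun s =>
    measurable_events_of_eval fun i hi => (measurable_const_smul a).comp
      (measurable_eval_events (mem_Iic.2 (mul_le_mul_right (mem_Iic.1 hi) c)))
  refine ⟨Measure.isProbabilityMeasure_map hφ.aemeasurable, ?_, ?_⟩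
  · have hm : MeasurableSet {ω : Path n | ω 0 = a • x} :=
      measurable_pi_apply (X := fun _ : ℝ≥0 => E n) 0 (measurableSet_singleton _)
    rw [ae_map_iff hφ.aemeasurable hm]
    filter_upwards [h.start] with ω hω
    rw [mul_zero, hω]
  · intro s _ t _ hst A hA B hB
    have hBm : MeasurableSet {ω : Path n | ω t ∈ B} :=
      measurable_pi_apply (X := fun _ : ℝ≥0 => E n) t hB
    have hAm : MeasurableSet A := events_le _ _ hA
    have hB' : MeasurableSet ((a • ·) ⁻¹' B : Set (E n)) := measurable_const_smul a hB
    rw [univ_inter] at hA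
    have hA' := hφe s hA
    rw [← univ_inter (Iic (c * s))] at hA'
    have hKm : Measurable fun ω : Path n => K' (t - s) (ω s) B :=
      ((K' (t - s)).measurable_coe hB).comp (measurable_pi_apply s)
    rw [Measure.map_apply hφ (hAm.inter hBm), setLIntegral_map hAm hKm hφ]
    refine (h.markov (c * s) (mem_univ _) (c * t) (mem_univ _)
      (mul_lt_mul_of_pos_left hst hc) _ hA' _ hB').trans ?_
    refine lintegral_congr fun ω => ?_
    rw [hK _ _ B hB, mul_tsub]

theorem IsMarkovAt.eq_of_univ {K : ℝ≥0 → Kernel (E n) (E n)} [∀ t, IsMarkovKernel (K t)] {x : E n}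
    {μ ν : Measure (Path n)} (hμ : IsMarkovAt K x univ μ) (hν : IsMarkovAt K x univ ν) :
    μ = ν := by
  have := hμ.prob
  ext A hA
  have hA' : MeasurableSet[events n univ] A := by
    rw [events, cylinderEvents_univ]; exact hA
  refine measure_eq_on_events (fun F _ A hA => ?_) hA'
  refine hμ.unique hν (mem_univ _) (mem_univ (F.sup id)) (cylinderEvents_mono ?_ _ hA)
  exact fun i hi => ⟨mem_univ _, mem_Iic.2 (F.le_sup (f := id) hi)⟩

theorem transKernel_smul {γ : ℝ} (hD : IsOpenCone D) (hp : IsSemigroupDensity D p)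
    (hs : IsSemistableDensity D γ p) {c : ℝ≥0} (hc : 0 < c) (u : ℝ≥0) (y : E n) {B : Set (E n)}
    (hB : MeasurableSet B) :
    transKernel hD.isOpen.measurableSet p (c * u) (((c : ℝ) ^ γ) • y) B =
      transKernel hD.isOpen.measurableSet p u y ((((c : ℝ) ^ γ) • ·) ⁻¹' B) := by
  have hc' : (0 : ℝ) < c := hc
  set a : ℝ := (c : ℝ) ^ γ with ha
  have ha0 : 0 < a := Real.rpow_pos_of_pos hc' γ
  have hmem : ∀ z : E n, a • z ∈ D ↔ z ∈ D := fun z => by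
    refine ⟨fun h => ?_, hD.smul_mem a ha0 z⟩
    have := hD.smul_mem a⁻¹ (inv_pos.2 ha0) _ h
    rwa [inv_smul_smul₀ ha0.ne'] at this
  have hB' : MeasurableSet ((a • ·) ⁻¹' B : Set (E n)) := measurable_const_smul a hB
  have hdirac : Measure.dirac (a • y) B = Measure.dirac y ((a • ·) ⁻¹' B) := by
    rw [Measure.dirac_apply' _ hB, Measure.dirac_apply' _ hB']; rfl
  rcases eq_or_lt_of_le (zero_le (a := u)) with rfl | hu
  · rw [mul_zero, transKernel_zero, Kernel.id_apply, Kernel.id_apply, hdirac]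
  by_cases hy : y ∈ D
  · have hu' : (0 : ℝ) < u := hu
    have hcu : (0 : ℝ) < (c * u : ℝ≥0) := mul_pos hc hu
    rw [transKernel_apply _ hp (mul_pos hc hu) ((hmem y).2 hy) hB,
      transKernel_apply _ hp hu hy hB', ← lintegral_indicator hB, ← lintegral_indicator hB',
      lintegral_eq_smul a ha0 ((measurable_extDensity_right hD.isOpen.measurableSet hp hcu
        (a • y)).indicator hB), ← lintegral_const_mul']
    swap
    · exact ENNReal.ofReal_ne_top
    refine lintegral_congr fun b => ?_
    by_cases hbB : a • b ∈ B
    · rw [indicator_of_mem hbB, indicator_of_mem (s := (a • ·) ⁻¹' B) hbB]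
      by_cases hb : b ∈ D
      · rw [extDensity_of_mem ((hmem y).2 hy) ((hmem b).2 hb), extDensity_of_mem hy hb,
          ← ENNReal.ofReal_mul (by positivity), hs _ hcu _ ((hmem y).2 hy) _ ((hmem b).2 hb),
          hs _ hu' _ hy _ hb, NNReal.coe_mul, Real.mul_rpow hc'.le hu'.le,
          Real.mul_rpow hc'.le hu'.le, ← ha]
        have h1 : ∀ z : E n, (a * (u : ℝ) ^ γ)⁻¹ • a • z = ((u : ℝ) ^ γ)⁻¹ • z := fun z => by
          rw [smul_smul, mul_inv, mul_right_comm, inv_mul_cancel₀ ha0.ne', one_mul]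
        -- The scaling factor of the density is the inverse of the Jacobian of the dilation by a =
        -- c^γ.
        have h2 : (c : ℝ) ^ (-(n * γ)) = (a ^ n)⁻¹ := by
          rw [ha, Real.rpow_neg hc'.le, mul_comm, Real.rpow_mul hc'.le, Real.rpow_natCast]
        rw [h1, h1, h2, ← mul_assoc, ← mul_assoc, mul_inv_cancel₀ (by positivity), one_mul]
      · rw [extDensity_of_notMem hb, extDensity_of_notMem fun h => hb ((hmem b).1 h), mul_zero]
    · rw [indicator_of_notMem hbB, indicator_of_notMem (s := (a • ·) ⁻¹' B) hbB, mul_zero]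
  · rw [transKernel_of_notMem _ hy, transKernel_of_notMem _ fun h => hy ((hmem y).1 h), hdirac]

/-- A Markov process with semi-stable densities is semi-stable. -/
theorem isSemistable_of_density {γ : ℝ} (hD : IsOpenCone D) (hP : IsMarkovProcess D p P)
    (hs : IsSemistableDensity D γ p) : IsSemistable D γ P := by
  intro c hc x hx
  have hDm := hD.isOpen.measurableSet
  have := isMarkovKernel_transKernel hDm hP.density hP.mass
  have ha0 : 0 < (c : ℝ) ^ γ := Real.rpow_pos_of_pos hc γ
  -- The pure time change and the pure dilation both give Markov laws from x with kernels at time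
  -- cu, so uniqueness identifies them.
  have h1 := (hP.isMarkovAt hDm hx).map (K' := fun u => transKernel hDm p (c * u)) hc 1
    (by simp)
  have h2 := (hP.isMarkovAt hDm (hD.smul_mem _ (inv_pos.2 ha0) x hx)).map
    (K' := fun u => transKernel hDm p (c * u)) (c := 1) one_pos ((c : ℝ) ^ γ)
    fun u y B hB => by rw [transKernel_smul hD hP.density hs hc u y hB, one_mul]
  rw [smul_inv_smul₀ ha0.ne'] at h2
  simp only [one_smul, one_mul] at h1 h2
  exact h1.eq_of_univ h2

end Transforms

/-- A process on `ℝⁿ` with the time-inversion property is an `h`-transform of a semi-stable one. -/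
theorem exists_semistable_of_hasTimeInversion {n : ℕ} {α : ℝ} (hα : 0 < α)
    {p : ℝ → E n → E n → ℝ} {P : E n → Measure (Path n)} (hP : IsMarkovProcess univ p P)
    (hT : HasTimeInversion univ α P) :
    ∃ (r : ℝ → E n → E n → ℝ) (Q : E n → Measure (Path n)) (h : E n → ℝ) (ν : ℝ),
      IsMarkovProcess univ r Q ∧ IsSemistable univ (α / 2) Q ∧ 0 ≤ ν ∧
        IsHTransform univ h ν Q P := by
  obtain ⟨r, h, ν, hr, hs, hh, hc, hC⟩ := exists_densityHTransform hα isOpenCone_univ hP.density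
    (isInvHomogeneous_of_hasTimeInversion isOpenCone_univ hP hT)
  obtain ⟨C, hC⟩ := hC rfl
  have hγ : 0 ≤ α / 2 := by positivity
  have hmass : ∀ t : ℝ, 0 < t → ∀ x ∈ (univ : Set (E n)),
      ∫⁻ y in univ, ENNReal.ofReal (r t x y) = 1 := fun t ht x _ =>
    mass_eq_one_of_exp_form hγ hr hs hC ht x
  obtain ⟨Q, hQ⟩ := exists_isMarkovProcess MeasurableSet.univ hr hmass
  exact ⟨r, Q, h, ν, hQ, isSemistable_of_density isOpenCone_univ hQ hs,
    nonneg_of_htransform hγ hr hs hP.mass hh (continuousOn_univ.1 hc),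
    isHTransform_of_density MeasurableSet.univ hP hQ hh⟩

/-! ### The Cauchy convolution semigroup -/

section Cauchy

open Filter Topology

/-- The density at `x` of the symmetric Cauchy law with scale `t`. -/
noncomputable def cauchyKernel (t x : ℝ) : ℝ := t / (Real.pi * (t ^ 2 + x ^ 2))

theorem cauchyKernel_pos {t : ℝ} (ht : 0 < t) (x : ℝ) : 0 < cauchyKernel t x := by
  have := Real.pi_pos
  rw [cauchyKernel]; positivity

theorem cauchyKernel_neg (t x : ℝ) : cauchyKernel t (-x) = cauchyKernel t x := by
  rw [cauchyKernel, cauchyKernel, neg_sq]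

theorem continuous_cauchyKernel {t : ℝ} (ht : 0 < t) : Continuous (cauchyKernel t) := by
  have := Real.pi_pos
  exact continuous_const.div (by fun_prop) fun x => by positivity

theorem lintegral_cauchyKernel {t : ℝ} (ht : 0 < t) :
    ∫⁻ x, ENNReal.ofReal (cauchyKernel t x) = 1 := by
  lift t to ℝ≥0 using ht.le
  rw [← lintegral_cauchyPDF_eq_one 0 (γ := t) (NNReal.coe_ne_zero.1 ht.ne')]
  refine lintegral_congr fun x => ?_
  rw [cauchyPDF_def, cauchyPDFReal_def, cauchyKernel, sub_zero]
  congr 1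
  have := Real.pi_pos
  rw [add_comm (x ^ 2)]
  field_simp

theorem integrable_cauchyKernel {t : ℝ} (ht : 0 < t) : Integrable (cauchyKernel t) := by
  refine ⟨(continuous_cauchyKernel ht).aestronglyMeasurable, ?_⟩
  rw [hasFiniteIntegral_iff_ofReal (ae_of_all _ fun x => (cauchyKernel_pos ht x).le),
    lintegral_cauchyKernel ht]
  exact ENNReal.one_lt_top

theorem integrable_cauchyKernel_mul {s t : ℝ} (hs : 0 < s) (ht : 0 < t) (d : ℝ) :
    Integrable fun w => cauchyKernel s w * cauchyKernel t (w - d) := by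
  have hc := (continuous_cauchyKernel ht).comp (continuous_sub_right d)
  refine (integrable_cauchyKernel hs).mul_bdd (c := cauchyKernel t 0) hc.aestronglyMeasurable
    (ae_of_all _ fun w => ?_)
  rw [Real.norm_of_nonneg (cauchyKernel_pos ht _).le, cauchyKernel, cauchyKernel]
  refine div_le_div_of_nonneg_left ht.le (by have := Real.pi_pos; positivity)
    (mul_le_mul_of_nonneg_left ?_ Real.pi_pos.le)
  nlinarith [sq_nonneg (w - d)]

theorem hasDerivAt_arctan_div {t : ℝ} (ht : 0 < t) (d w : ℝ) :
    HasDerivAt (fun w => Real.arctan ((w - d) / t)) (t / ((w - d) ^ 2 + t ^ 2)) w := by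
  have h := (((hasDerivAt_id w).sub_const d).div_const t).arctan
  refine h.congr_deriv ?_
  simp only [id]
  field_simp
  ring

theorem tendsto_arctan_div_atTop {t : ℝ} (ht : 0 < t) (d : ℝ) :
    Tendsto (fun w => Real.arctan ((w - d) / t)) atTop (𝓝 (Real.pi / 2)) :=
  (tendsto_nhds_of_tendsto_nhdsWithin Real.tendsto_arctan_atTop).comp
    ((tendsto_atTop_add_const_right _ (-d) tendsto_id).atTop_div_const ht)

theorem tendsto_arctan_div_atBot {t : ℝ} (ht : 0 < t) (d : ℝ) :
    Tendsto (fun w => Real.arctan ((w - d) / t)) atBot (𝓝 (-(Real.pi / 2))) :=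
  (tendsto_nhds_of_tendsto_nhdsWithin Real.tendsto_arctan_atBot).comp
    ((tendsto_atBot_add_const_right _ (-d) tendsto_id).atBot_div_const ht)

/-- After division by w² the logarithms are continuous functions of 1/w at 0; this treats both ends
of the line at once. -/
theorem tendsto_log_ratio {s t : ℝ} (hs : 0 < s) (ht : 0 < t) (d : ℝ) {l : Filter ℝ}
    (h0 : Tendsto (fun w : ℝ => w⁻¹) l (𝓝 0)) (hne : ∀ᶠ w in l, w ≠ 0) :
    Tendsto (fun w => Real.log (w ^ 2 + s ^ 2) - Real.log ((w - d) ^ 2 + t ^ 2)) l (𝓝 0) := by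
  have hc : ContinuousAt (fun u : ℝ => Real.log (1 + s ^ 2 * u ^ 2) -
      Real.log ((1 - d * u) ^ 2 + t ^ 2 * u ^ 2)) 0 := by
    refine ContinuousAt.sub (ContinuousAt.log (by fun_prop) (by simp))
      (ContinuousAt.log (by fun_prop) (by simp))
  have h := hc.tendsto.comp h0
  simp only [ne_eq, OfNat.ofNat_ne_zero, not_false_eq_true, zero_pow, mul_zero, add_zero,
    Real.log_one, sub_zero, one_pow] at h
  refine h.congr' ?_
  filter_upwards [hne] with w hw
  have hw2 : 0 < w ^ 2 := by positivity
  have e1 : w ^ 2 + s ^ 2 = w ^ 2 * (1 + s ^ 2 * w⁻¹ ^ 2) := by field_simp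
  have e2 : (w - d) ^ 2 + t ^ 2 = w ^ 2 * ((1 - d * w⁻¹) ^ 2 + t ^ 2 * w⁻¹ ^ 2) := by field_simp
  have hp : 0 < (1 - d * w⁻¹) ^ 2 + t ^ 2 * w⁻¹ ^ 2 := by positivity
  rw [Function.comp_apply, e1, e2, Real.log_mul hw2.ne' (by positivity),
    Real.log_mul hw2.ne' hp.ne']
  ring

/-- The Cauchy densities form a convolution semigroup. -/
theorem integral_cauchyKernel_mul {s t : ℝ} (hs : 0 < s) (ht : 0 < t) (d : ℝ) :
    ∫ w, cauchyKernel s w * cauchyKernel t (w - d) = cauchyKernel (s + t) d := by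
  have hpi := Real.pi_pos
  have hint := integrable_cauchyKernel_mul hs ht d
  -- The partial fractions have the denominator Δ, which vanishes exactly here, where the two
  -- kernels have the same poles; this case has its own antiderivative.
  by_cases hdeg : d = 0 ∧ s = t
  · obtain ⟨rfl, rfl⟩ := hdeg
    have hF : ∀ w : ℝ, HasDerivAt (fun w : ℝ => s ^ 2 / Real.pi ^ 2 *
        (w / (2 * s ^ 2 * (w ^ 2 + s ^ 2)) + Real.arctan ((w - 0) / s) / (2 * s ^ 3)))
        (cauchyKernel s w * cauchyKernel s (w - 0)) w := by
      intro w
      have hw0 : 2 * s ^ 2 * (w ^ 2 + s ^ 2) ≠ 0 := by positivity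
      have h1 := (hasDerivAt_id w).div ((((hasDerivAt_id w).pow 2).add_const (s ^ 2)).const_mul
        (2 * s ^ 2)) hw0
      refine ((h1.add ((hasDerivAt_arctan_div hs 0 w).div_const (2 * s ^ 3))).const_mul
        (s ^ 2 / Real.pi ^ 2)).congr_deriv ?_
      have hw : w ^ 2 + s ^ 2 ≠ 0 := by positivity
      simp only [id, cauchyKernel, sub_zero, add_comm (s ^ 2) (w ^ 2)]
      simp
      field_simp
      ring
    have hlim : ∀ {l : Filter ℝ} {b : ℝ}, Tendsto (fun w : ℝ => w⁻¹) l (𝓝 0) →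
        (∀ᶠ w in l, w ≠ 0) → Tendsto (fun w => Real.arctan ((w - 0) / s)) l (𝓝 b) →
        Tendsto (fun w : ℝ => s ^ 2 / Real.pi ^ 2 *
          (w / (2 * s ^ 2 * (w ^ 2 + s ^ 2)) + Real.arctan ((w - 0) / s) / (2 * s ^ 3))) l
          (𝓝 (s ^ 2 / Real.pi ^ 2 * (0 + b / (2 * s ^ 3)))) := by
      intro l b h0 hne hb
      refine (Tendsto.add ?_ (hb.div_const _)).const_mul _
      have hc : ContinuousAt (fun u : ℝ => u / (2 * s ^ 2 * (1 + s ^ 2 * u ^ 2))) 0 :=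
        ContinuousAt.div (by fun_prop) (by fun_prop) (by simp [hs.ne'])
      have h := hc.tendsto.comp h0
      rw [zero_div] at h
      refine h.congr' ?_
      filter_upwards [hne] with w hw
      have : w ^ 2 + s ^ 2 ≠ 0 := by positivity
      rw [Function.comp_apply]
      field_simp
    rw [integral_of_hasDerivAt_of_tendsto hF hint
      (hlim tendsto_inv_atBot_zero (eventually_ne_atBot 0) (tendsto_arctan_div_atBot hs 0))
      (hlim tendsto_inv_atTop_zero (eventually_ne_atTop 0) (tendsto_arctan_div_atTop hs 0)),
      cauchyKernel]
    field_simp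
    ring
  · have hst : 0 < d ^ 2 + (s - t) ^ 2 := by
      rcases not_and_or.1 hdeg with h | h
      · positivity
      · have : s - t ≠ 0 := sub_ne_zero.2 h
        positivity
    have hst' : 0 < d ^ 2 + (s + t) ^ 2 := by positivity
    set Δ := (d ^ 2 + (s - t) ^ 2) * (d ^ 2 + (s + t) ^ 2) with hΔ
    have hΔ0 : 0 < Δ := mul_pos hst hst'
    have hF : ∀ w : ℝ, HasDerivAt (fun w : ℝ => s * t / (Real.pi ^ 2 * Δ) *
        (d * (Real.log (w ^ 2 + s ^ 2) - Real.log ((w - d) ^ 2 + t ^ 2)) +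
          ((d ^ 2 + t ^ 2 - s ^ 2) / s * Real.arctan ((w - 0) / s) +
            (d ^ 2 + s ^ 2 - t ^ 2) / t * Real.arctan ((w - d) / t))))
        (cauchyKernel s w * cauchyKernel t (w - d)) w := by
      intro w
      have hw : w ^ 2 + s ^ 2 ≠ 0 := by positivity
      have hwd : (w - d) ^ 2 + t ^ 2 ≠ 0 := by positivity
      have h1 := (((hasDerivAt_id w).pow 2).add_const (s ^ 2)).log hw
      have h2 := ((((hasDerivAt_id w).sub_const d).pow 2).add_const (t ^ 2)).log hwd
      refine ((((h1.sub h2).const_mul d).add (((hasDerivAt_arctan_div hs 0 w).const_mul _).add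
        ((hasDerivAt_arctan_div ht d w).const_mul _))).const_mul _).congr_deriv ?_
      simp only [id, cauchyKernel, sub_zero, add_comm (s ^ 2) (w ^ 2),
        add_comm (t ^ 2) ((w - d) ^ 2)]
      simp
      field_simp
      rw [hΔ]
      ring
    have hlim : ∀ {l : Filter ℝ} {b : ℝ}, Tendsto (fun w : ℝ => w⁻¹) l (𝓝 0) →
        (∀ᶠ w in l, w ≠ 0) → Tendsto (fun w => Real.arctan ((w - 0) / s)) l (𝓝 b) →
        Tendsto (fun w => Real.arctan ((w - d) / t)) l (𝓝 b) →
        Tendsto (fun w : ℝ => s * t / (Real.pi ^ 2 * Δ) *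
        (d * (Real.log (w ^ 2 + s ^ 2) - Real.log ((w - d) ^ 2 + t ^ 2)) +
          ((d ^ 2 + t ^ 2 - s ^ 2) / s * Real.arctan ((w - 0) / s) +
            (d ^ 2 + s ^ 2 - t ^ 2) / t * Real.arctan ((w - d) / t)))) l
          (𝓝 (s * t / (Real.pi ^ 2 * Δ) * (d * 0 + ((d ^ 2 + t ^ 2 - s ^ 2) / s * b +
            (d ^ 2 + s ^ 2 - t ^ 2) / t * b)))) := fun h0 hne hb hb' =>
      (((tendsto_log_ratio hs ht d h0 hne).const_mul _).add
        ((hb.const_mul _).add (hb'.const_mul _))).const_mul _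
    rw [integral_of_hasDerivAt_of_tendsto hF hint
      (hlim tendsto_inv_atBot_zero (eventually_ne_atBot 0) (tendsto_arctan_div_atBot hs 0)
        (tendsto_arctan_div_atBot ht d))
      (hlim tendsto_inv_atTop_zero (eventually_ne_atTop 0) (tendsto_arctan_div_atTop hs 0)
        (tendsto_arctan_div_atTop ht d)), cauchyKernel]
    have h3 : (s + t) ^ 2 + d ^ 2 ≠ 0 := by positivity
    field_simp
    rw [hΔ]
    ring

theorem lintegral_cauchyKernel_mul {s t : ℝ} (hs : 0 < s) (ht : 0 < t) (a b : ℝ) :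
    ∫⁻ w, ENNReal.ofReal (cauchyKernel s (a - w) * cauchyKernel t (w - b)) =
      ENNReal.ofReal (cauchyKernel (s + t) (a - b)) := by
  rw [← lintegral_add_right_eq_self _ a, ← neg_sub b a, cauchyKernel_neg,
    ← integral_cauchyKernel_mul hs ht, ofReal_integral_eq_lintegral_ofReal
      (integrable_cauchyKernel_mul hs ht _)
      (ae_of_all _ fun w => (mul_pos (cauchyKernel_pos hs _) (cauchyKernel_pos ht _)).le)]
  refine lintegral_congr fun w => ?_
  rw [show a - (w + a) = -w by ring, cauchyKernel_neg, show w + a - b = w - (b - a) by ring]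

end Cauchy

/-! ### Images of the Cauchy process under a change of variable -/

section TransformedCauchy

variable {U : Set ℝ} {ψ J : ℝ → ℝ} {α : ℝ}

/-- The transition densities on the line of the image of the Cauchy process under the inverse of
`ψ`, where `J` is the derivative of `ψ`. -/
noncomputable def cauchyDensity (ψ J : ℝ → ℝ) (t : ℝ) (x y : E 1) : ℝ :=
  cauchyKernel t (ψ (x 0) - ψ (y 0)) * J (y 0)

theorem measurePreserving_coord : MeasurePreserving (fun x : E 1 => x 0) :=
  (volume_preserving_funUnique (Fin 1) ℝ).comp (PiLp.volume_preserving_ofLp (Fin 1))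

theorem setLIntegral_coord (U : Set ℝ) (f : ℝ → ℝ≥0∞) :
    ∫⁻ x in {x : E 1 | x 0 ∈ U}, f (x 0) = ∫⁻ z in U, f z := by
  have hemb : MeasurableEmbedding (fun x : E 1 => x 0) :=
    ((MeasurableEquiv.toLp 2 (Fin 1 → ℝ)).symm.trans
      (MeasurableEquiv.funUnique (Fin 1) ℝ)).measurableEmbedding
  exact measurePreserving_coord.setLIntegral_comp_preimage_emb hemb f U

/-- Hypothesis `hsub` says that ψ carries J dz on U to Lebesgue measure on the whole line, which
transports Chapman–Kolmogorov from the Cauchy kernel. -/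
theorem isSemigroupDensity_cauchyDensity (hU : IsOpen U) (hψ : ContDiffOn ℝ 2 ψ U)
    (hJ : ContDiffOn ℝ 2 J U) (hJ0 : ∀ z ∈ U, 0 < J z)
    (hsub : ∀ f : ℝ → ℝ≥0∞, ∫⁻ z in U, ENNReal.ofReal (J z) * f (ψ z) = ∫⁻ w, f w) :
    IsSemigroupDensity {x : E 1 | x 0 ∈ U} (cauchyDensity ψ J) where
  pos t ht x _ y hy := mul_pos (cauchyKernel_pos ht _) (hJ0 _ hy)
  twiceDiff := by
    have hc : Continuous fun x : E 1 => x 0 := by fun_prop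
    have hopen : IsOpen {x : E 1 | x 0 ∈ U} := hU.preimage hc
    refine TwiceDiffOn.of_contDiffOn ?_ (isOpen_Ioi.prod (hopen.prod hopen))
    have h1 : ContDiffOn ℝ 2 (fun v : ℝ × E 1 × E 1 => ψ (v.2.1 0))
        (Ioi (0 : ℝ) ×ˢ {x : E 1 | x 0 ∈ U} ×ˢ {x : E 1 | x 0 ∈ U}) :=
      hψ.comp (g := ψ) (f := fun v : ℝ × E 1 × E 1 => v.2.1 0)
        (ContDiff.contDiffOn (by fun_prop)) fun v hv => hv.2.1
    have h2 : ContDiffOn ℝ 2 (fun v : ℝ × E 1 × E 1 => ψ (v.2.2 0))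
        (Ioi (0 : ℝ) ×ˢ {x : E 1 | x 0 ∈ U} ×ˢ {x : E 1 | x 0 ∈ U}) :=
      hψ.comp (g := ψ) (f := fun v : ℝ × E 1 × E 1 => v.2.2 0)
        (ContDiff.contDiffOn (by fun_prop)) fun v hv => hv.2.2
    have h3 : ContDiffOn ℝ 2 (fun v : ℝ × E 1 × E 1 => J (v.2.2 0))
        (Ioi (0 : ℝ) ×ˢ {x : E 1 | x 0 ∈ U} ×ˢ {x : E 1 | x 0 ∈ U}) :=
      hJ.comp (g := J) (f := fun v : ℝ × E 1 × E 1 => v.2.2 0)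
        (ContDiff.contDiffOn (by fun_prop)) fun v hv => hv.2.2
    have h4 : ContDiffOn ℝ 2 (fun v : ℝ × E 1 × E 1 => v.1)
        (Ioi (0 : ℝ) ×ˢ {x : E 1 | x 0 ∈ U} ×ˢ {x : E 1 | x 0 ∈ U}) := contDiff_fst.contDiffOn
    refine ContDiffOn.mul (h4.div (contDiffOn_const.mul ((h4.pow 2).add ((h1.sub h2).pow 2)))
      fun v hv => ?_) h3
    have hv0 : 0 < v.1 := hv.1
    have := Real.pi_pos
    positivity
  chapmanKolmogorov s t hs ht x _ y hy := by
    have hy0 := hJ0 _ hy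
    have h := hsub fun w => ENNReal.ofReal (J (y 0)) *
      ENNReal.ofReal (cauchyKernel s (ψ (x 0) - w) * cauchyKernel t (w - ψ (y 0)))
    rw [lintegral_const_mul' _ _ ENNReal.ofReal_ne_top, lintegral_cauchyKernel_mul hs ht,
      ← ENNReal.ofReal_mul hy0.le, ← setLIntegral_coord U] at h
    rw [cauchyDensity, mul_comm (cauchyKernel _ _), ← h]
    refine setLIntegral_congr_fun (hU.measurableSet.preimage measurePreserving_coord.measurable)
      fun z hz => ?_
    have hz0 := hJ0 _ hz
    have h1 := cauchyKernel_pos hs (ψ (x 0) - ψ (z 0))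
    have h2 := cauchyKernel_pos ht (ψ (z 0) - ψ (y 0))
    change ENNReal.ofReal _ = ENNReal.ofReal _ * _
    rw [← ENNReal.ofReal_mul hy0.le, ← ENNReal.ofReal_mul hz0.le, cauchyDensity, cauchyDensity]
    congr 1
    ring

theorem lintegral_cauchyDensity (hU : IsOpen U) (hJ0 : ∀ z ∈ U, 0 < J z)
    (hsub : ∀ f : ℝ → ℝ≥0∞, ∫⁻ z in U, ENNReal.ofReal (J z) * f (ψ z) = ∫⁻ w, f w)
    {t : ℝ} (ht : 0 < t) (x : E 1) :
    ∫⁻ y in {x : E 1 | x 0 ∈ U}, ENNReal.ofReal (cauchyDensity ψ J t x y) = 1 := by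
  have h := hsub fun w => ENNReal.ofReal (cauchyKernel t (ψ (x 0) - w))
  rw [lintegral_sub_left_eq_self fun w => ENNReal.ofReal (cauchyKernel t w),
    lintegral_cauchyKernel ht, ← setLIntegral_coord U] at h
  rw [← h]
  refine setLIntegral_congr_fun (hU.measurableSet.preimage measurePreserving_coord.measurable)
    fun z hz => ?_
  rw [cauchyDensity, mul_comm, ENNReal.ofReal_mul (hJ0 _ hz).le]

theorem cauchyKernel_scale {t : ℝ} (ht : 0 < t) (x : ℝ) :
    cauchyKernel t x = t⁻¹ * cauchyKernel 1 (t⁻¹ * x) := by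
  have := Real.pi_pos
  rw [cauchyKernel, cauchyKernel]
  field_simp

/-- The preimage of the Cauchy process under a homogeneous change of variable of degree `2 / α` is
semi-stable of index `α / 2` without the time-inversion property of degree `α`. -/
theorem exists_semistable_not_hasTimeInversion (hα : 0 < α) (hU : IsOpen U)
    (hcone : ∀ c : ℝ, 0 < c → ∀ z ∈ U, c * z ∈ U) (h1U : (1 : ℝ) ∈ U)
    (hψ : ContDiffOn ℝ 2 ψ U) (hJ : ContDiffOn ℝ 2 J U) (hJ0 : ∀ z ∈ U, 0 < J z)
    (hsub : ∀ f : ℝ → ℝ≥0∞, ∫⁻ z in U, ENNReal.ofReal (J z) * f (ψ z) = ∫⁻ w, f w)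
    (hψc : ∀ c : ℝ, 0 < c → ∀ z, ψ (c * z) = c ^ (2 / α) * ψ z)
    (hJc : ∀ c : ℝ, 0 < c → ∀ z, J (c * z) = c ^ (2 / α - 1) * J z) (hψ1 : ψ 1 = 1) :
    IsOpenCone {x : E 1 | x 0 ∈ U} ∧ ∃ (p : ℝ → E 1 → E 1 → ℝ) (P : E 1 → Measure (Path 1)),
      IsMarkovProcess {x : E 1 | x 0 ∈ U} p P ∧ IsSemistable {x : E 1 | x 0 ∈ U} (α / 2) P ∧
        ¬ HasTimeInversion {x : E 1 | x 0 ∈ U} α P := by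
  have hc : Continuous fun x : E 1 => x 0 := by fun_prop
  have hD : IsOpenCone {x : E 1 | x 0 ∈ U} := ⟨hU.preimage hc, fun c hc x hx => hcone c hc _ hx⟩
  have hp := isSemigroupDensity_cauchyDensity hU hψ hJ hJ0 hsub
  obtain ⟨P, hP⟩ := exists_isMarkovProcess hD.isOpen.measurableSet hp
    fun t ht x _ => lintegral_cauchyDensity hU hJ0 hsub ht x
  refine ⟨hD, cauchyDensity ψ J, P, hP, isSemistable_of_density hD hP ?_, ?_⟩
  · intro t ht x _ y _
    have hcoord : ∀ (c : ℝ) (z : E 1), (c • z) 0 = c * z 0 := fun c z => rfl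
    have hs : (0 : ℝ) < (t ^ (α / 2))⁻¹ := by positivity
    have e1 : ((t ^ (α / 2))⁻¹) ^ (2 / α) = t⁻¹ := by
      rw [← Real.rpow_neg ht.le, ← Real.rpow_mul ht.le, ← Real.rpow_neg_one]
      congr 1
      field_simp
    have e2 : t ^ (-((1 : ℕ) * (α / 2))) * ((t ^ (α / 2))⁻¹) ^ (2 / α - 1) = t⁻¹ := by
      rw [← Real.rpow_neg ht.le, ← Real.rpow_mul ht.le, ← Real.rpow_add ht, ← Real.rpow_neg_one]
      congr 1
      push_cast
      field_simp
      ring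
    rw [cauchyDensity, cauchyDensity, hcoord, hcoord, hψc _ hs, hψc _ hs, hJc _ hs, ← mul_sub, e1,
      cauchyKernel_scale ht, ← e2]
    ring
  · intro hT
    set e : E 1 := EuclideanSpace.single 0 1 with he
    have he0 : e 0 = 1 := by simp [he]
    have heD : e ∈ {x : E 1 | x 0 ∈ U} := by
      change e 0 ∈ U
      rwa [he0]
    -- Homogeneity of ψ and J removes α except through the factor J(1), so one numerical comparison
    -- serves every degree.
    have hval : ∀ s t : ℝ, 0 < s → 0 < t → invDensity α (cauchyDensity ψ J) e s t (e, e) =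
        J 1 * ((t ^ 2)⁻¹ * (cauchyKernel t⁻¹ (1 - (t ^ 2)⁻¹) *
          cauchyKernel (s⁻¹ - t⁻¹) ((t ^ 2)⁻¹ - (s ^ 2)⁻¹)) /
            cauchyKernel s⁻¹ (1 - (s ^ 2)⁻¹)) := by
      intro s t hs ht
      have hcoord : ∀ c : ℝ, (c • e) 0 = c * 1 := fun c => by rw [← he0]; rfl
      have e1 : ∀ t : ℝ, 0 < t → (t ^ (-α)) ^ (2 / α) = (t ^ 2)⁻¹ := by
        intro t ht
        rw [← Real.rpow_mul ht.le, ← Real.rpow_natCast, ← Real.rpow_neg ht.le]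
        congr 1
        push_cast
        field_simp
      have e2 : t ^ (-α) * (t ^ (-α)) ^ (2 / α - 1) = (t ^ 2)⁻¹ := by
        rw [← Real.rpow_mul ht.le, ← Real.rpow_add ht, ← Real.rpow_natCast, ← Real.rpow_neg ht.le]
        congr 1
        push_cast
        field_simp
        ring
      have hs' : 0 < s ^ (-α) := Real.rpow_pos_of_pos hs _
      have ht' : 0 < t ^ (-α) := Real.rpow_pos_of_pos ht _
      have hJs : J (s ^ (-α) * 1) ≠ 0 := (hJ0 _ (hcone _ hs' _ h1U)).ne'
      have hck := (cauchyKernel_pos (inv_pos.2 hs) (1 - (s ^ 2)⁻¹)).ne'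
      simp only [invDensity, cauchyDensity, hcoord, he0, hψc _ hs', hψc _ ht', hψ1, e1 s hs,
        e1 t ht, mul_one (((_ : ℝ) ^ 2)⁻¹), pow_one]
      rw [hJc _ ht']
      have key : ∀ u v A B C K : ℝ, C ≠ 0 → K ≠ 0 →
          u * (A * (v * J 1) * (B * K)) / (C * K) = J 1 * (u * v * (A * B) / C) := by
        intro u v A B C K hC hK
        field_simp
      rw [key _ _ _ _ _ _ hck hJs, e2]
    have h := invDensity_eq_of_hasTimeInversion hD hP hT heD heD heD (s := 1) (t := 2) (s' := 2)
      (t' := 3) one_pos one_lt_two two_pos (by norm_num) (by norm_num)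
    -- Divided by J(1), the two values are 16/(169π) and 1053/(4453π).
    rw [hval 1 2 one_pos two_pos, hval 2 3 two_pos three_pos] at h
    have h' := mul_left_cancel₀ (hJ0 1 h1U).ne' h
    have hpi := Real.pi_ne_zero
    simp only [cauchyKernel] at h'
    norm_num at h'
    field_simp at h'
    norm_num at h'

end TransformedCauchy

/-! ### Odd power maps and the counterexamples -/

section Power

/-- The odd extension of the power function with exponent `1 + 2 * κ`. -/
noncomputable def oddPow (κ z : ℝ) : ℝ := z * (z ^ 2) ^ κ

theorem oddPow_mul (κ : ℝ) {c : ℝ} (hc : 0 < c) (z : ℝ) :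
    oddPow κ (c * z) = c ^ (1 + 2 * κ) * oddPow κ z := by
  rw [oddPow, oddPow, mul_pow, Real.mul_rpow (by positivity) (by positivity), Real.rpow_add hc,
    Real.rpow_mul hc.le, Real.rpow_one, Real.rpow_two]
  ring

theorem oddPow_ne_zero (κ : ℝ) {z : ℝ} (hz : z ≠ 0) : oddPow κ z ≠ 0 :=
  mul_ne_zero hz (Real.rpow_pos_of_pos (by positivity) κ).ne'

/-- The hypothesis says (1 + 2κ)(1 + 2κ') = 1: the degrees are inverse to each other. -/
theorem oddPow_oddPow {κ κ' : ℝ} (h : κ + κ' + 2 * κ * κ' = 0) {z : ℝ} (hz : z ≠ 0) :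
    oddPow κ' (oddPow κ z) = z := by
  have hz2 : 0 < z ^ 2 := by positivity
  have hp : 0 < (z ^ 2) ^ κ := Real.rpow_pos_of_pos hz2 κ
  rw [oddPow, oddPow, mul_pow, Real.mul_rpow hz2.le (by positivity), ← Real.rpow_two ((z ^ 2) ^ κ),
    ← Real.rpow_mul hz2.le, ← Real.rpow_mul hz2.le, mul_assoc, ← Real.rpow_add hz2,
    ← Real.rpow_add hz2, show κ + (κ' + κ * 2 * κ') = 0 by linarith, Real.rpow_zero, mul_one]

theorem hasDerivAt_oddPow (κ : ℝ) {z : ℝ} (hz : z ≠ 0) :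
    HasDerivAt (oddPow κ) ((1 + 2 * κ) * (z ^ 2) ^ κ) z := by
  have hz2 : z ^ 2 ≠ 0 := by positivity
  have h := (hasDerivAt_id z).mul (((hasDerivAt_id z).pow 2).rpow_const (p := κ) (Or.inl hz2))
  refine h.congr_deriv ?_
  have e : (z ^ 2) ^ κ = (z ^ 2) ^ (κ - 1) * z ^ 2 := by
    rw [← Real.rpow_add_one hz2, sub_add_cancel]
  simp only [id, Pi.pow_apply]
  rw [e]
  push_cast
  ring

/-- The power map is a bijection of the punctured line, and the removed point is null. -/
theorem lintegral_oddPow {κ : ℝ} (hκ : 0 < 1 + 2 * κ) (f : ℝ → ℝ≥0∞) :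
    ∫⁻ z in {0}ᶜ, ENNReal.ofReal ((1 + 2 * κ) * (z ^ 2) ^ κ) * f (oddPow κ z) = ∫⁻ w, f w := by
  have hne := hκ.ne'
  have hκ' : κ + -κ / (1 + 2 * κ) + 2 * κ * (-κ / (1 + 2 * κ)) = 0 := by
    rw [add_assoc, ← one_add_mul, mul_div_cancel₀ _ hne, add_neg_cancel]
  have himg : oddPow κ '' {0}ᶜ = {0}ᶜ := by
    ext w
    constructor
    · rintro ⟨z, hz, rfl⟩
      exact oddPow_ne_zero κ hz
    · intro hw
      exact ⟨oddPow (-κ / (1 + 2 * κ)) w, oddPow_ne_zero _ hw,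
        oddPow_oddPow (by linarith) hw⟩
  have hinj : InjOn (oddPow κ) {0}ᶜ := fun z hz w hw h => by
    rw [← oddPow_oddPow hκ' hz, h, oddPow_oddPow hκ' hw]
  have h := lintegral_image_eq_lintegral_abs_deriv_mul (measurableSet_singleton (0 : ℝ)).compl
    (fun z hz => (hasDerivAt_oddPow κ hz).hasDerivWithinAt) hinj f
  rw [himg] at h
  have hae : ({0}ᶜ : Set ℝ) =ᵐ[volume] univ := by
    rw [ae_eq_univ, compl_compl]
    exact Real.volume_singleton
  rw [setLIntegral_congr hae, setLIntegral_univ] at h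
  rw [h]
  refine lintegral_congr fun z => ?_
  rw [abs_of_nonneg (mul_nonneg hκ.le (Real.rpow_nonneg (sq_nonneg z) κ))]

/-- In degree 2 the change of variable is the identity, and the process is the Cauchy process
itself. -/
theorem exists_semistable_not_hasTimeInversion_of_univ :
    ∃ (p : ℝ → E 1 → E 1 → ℝ) (P : E 1 → Measure (Path 1)), IsMarkovProcess univ p P ∧
      IsSemistable univ ((2 : ℝ) / 2) P ∧ ¬ HasTimeInversion univ 2 P :=
  (exists_semistable_not_hasTimeInversion (U := univ) (ψ := id) (J := fun _ => 1) two_pos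
    isOpen_univ (fun _ _ _ _ => mem_univ _) (mem_univ _) contDiffOn_id contDiffOn_const
    (fun _ _ => one_pos) (by simp) (by simp) (by simp) rfl).2

/-- The exponent is chosen so that `oddPow` has degree 2/α. Unless α = 2, its derivative vanishes or
explodes at the origin, hence the punctured line. -/
theorem exists_semistable_not_hasTimeInversion_of_pos {α : ℝ} (hα : 0 < α) :
    ∃ D : Set (E 1), IsOpenCone D ∧
      ∃ (p : ℝ → E 1 → E 1 → ℝ) (P : E 1 → Measure (Path 1)),
        IsMarkovProcess D p P ∧ IsSemistable D (α / 2) P ∧ ¬ HasTimeInversion D α P := by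
  set κ : ℝ := (2 / α - 1) / 2 with hκdef
  have hκ : 1 + 2 * κ = 2 / α := by rw [hκdef]; ring
  have hκ0 : 0 < 1 + 2 * κ := by rw [hκ]; positivity
  have hsmooth : ContDiffOn ℝ 2 (fun z : ℝ => (z ^ 2) ^ κ) {0}ᶜ := fun z hz =>
    ((contDiffAt_id.pow 2).rpow_const_of_ne (pow_ne_zero 2 hz)).contDiffWithinAt
  refine ⟨_, exists_semistable_not_hasTimeInversion (U := {0}ᶜ) (ψ := oddPow κ)
    (J := fun z => (1 + 2 * κ) * (z ^ 2) ^ κ) hα isOpen_compl_singleton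
    (fun c hc z hz => mul_ne_zero hc.ne' hz) (by simp) (contDiffOn_id.mul hsmooth)
    (contDiffOn_const.mul hsmooth) (fun z hz => ?_) (lintegral_oddPow hκ0) (fun c hc z => ?_)
    (fun c hc z => ?_) (by simp [oddPow])⟩
  · have hz0 : z ≠ 0 := hz
    positivity
  · rw [oddPow_mul κ hc, hκ]
  · rw [mul_pow, Real.mul_rpow (by positivity) (by positivity), ← Real.rpow_two,
      ← Real.rpow_mul hc.le, show 2 / α - 1 = 2 * κ by linarith]
    ring

end Power

end TimeInversion

theorem mainTheorem3 :
    -- processes on `ℝⁿ`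
    (∀ (n : ℕ) (α : ℝ), 0 < α →
      ∀ (p : ℝ → E n → E n → ℝ) (P : E n → Measure (Path n)),
        IsMarkovProcess univ p P → HasTimeInversion univ α P →
          IsSemistable univ (α / 2) P ∨
          ∃ (r : ℝ → E n → E n → ℝ) (Q : E n → Measure (Path n)) (h : E n → ℝ) (ν : ℝ),
            IsMarkovProcess univ r Q ∧ IsSemistable univ (α / 2) Q ∧
              0 ≤ ν ∧ IsHTransform univ h ν Q P) ∧
    -- processes on an open cone, at the level of semigroup densities
    (∀ (n : ℕ) (α : ℝ), 0 < α → ∀ D : Set (E n), IsOpenCone D →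
      ∀ (p : ℝ → E n → E n → ℝ) (P : E n → Measure (Path n)),
        IsMarkovProcess D p P → HasTimeInversion D α P →
          ∃ (r : ℝ → E n → E n → ℝ) (h : E n → ℝ) (ν : ℝ),
            IsSemigroupDensity D r ∧ IsSemistableDensity D (α / 2) r ∧
              IsDensityHTransform D h ν r p) ∧
    -- the converse fails, on `ℝⁿ` for some degree, and on open cones for every degree
    (∃ (n : ℕ) (α : ℝ), 0 < α ∧
      ∃ (p : ℝ → E n → E n → ℝ) (P : E n → Measure (Path n)),
        IsMarkovProcess univ p P ∧ IsSemistable univ (α / 2) P ∧ ¬ HasTimeInversion univ α P) ∧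
    (∀ α : ℝ, 0 < α → ∃ (n : ℕ) (D : Set (E n)), IsOpenCone D ∧
      ∃ (p : ℝ → E n → E n → ℝ) (P : E n → Measure (Path n)),
        IsMarkovProcess D p P ∧ IsSemistable D (α / 2) P ∧ ¬ HasTimeInversion D α P) := by
  -- The second alternative always holds, since the transform may be trivial.
  exact ⟨fun _ _ hα _ _ hP hT => Or.inr (exists_semistable_of_hasTimeInversion hα hP hT),
    fun _ _ hα _ hD _ _ hP hT => by
      obtain ⟨r, h, ν, hr, hs, hh, -⟩ := exists_densityHTransform hα hD hP.density
        (isInvHomogeneous_of_hasTimeInversion hD hP hT)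
      exact ⟨r, h, ν, hr, hs, hh⟩,
    ⟨1, 2, two_pos, exists_semistable_not_hasTimeInversion_of_univ⟩,
    fun _ hα => ⟨1, exists_semistable_not_hasTimeInversion_of_pos hα⟩⟩
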